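/- Let $G$ be a (second countable, real, finite-dimensional) Lie group with Lie algebra $\mathfrak g$, acting smoothly and transitively on a smooth finite-dimensional Hausdorff manifold $M$, and let $j$ be a $G$-invariant almost complex structure on $M$, i.e. a smooth field of endomorphisms of $TM$ with $j^2=-\mathrm{id}$ and $\rho(g)_*\circ j=j\circ\rho(g)_*$ for every $g\in G$, where $\rho(g)x=g\cdot x$. Fix a base point $x_0\in M$, with stabilizer $H$ and Lie algebra $\mathfrak h$ of $H$. For $A\in\mathfrak g$ let $A^*_x=\frac{d}{dt}\big|_{t=0}\exp(-tA)\cdot x$ be the fundamental vector field, and let $J:\mathfrak g\to\mathfrak g$ be a linear map such that $j_{x_0}A^*_{x_0}=(JA)^*_{x_0}$ for all $A\in\mathfrak g$. Let $N^j(X,Y)=[jX,jY]-j[jX,Y]-j[X,jY]+j^2[X,Y]$ for smooth vector fields $X,Y$ on $M$, let $\operatorname{Im}N^j$ be the distribution whose value at $x$ is the span of all values $N^j(X,Y)_x$, and let $\mathcal D$ be the space of smooth vector fields on $M$ that are sections of $\operatorname{Im}N^j$. For $A,B\in\mathfrak g$ let $N^J(A,B)=[JA,JB]-J[JA,B]-J[A,JB]-[A,B]$,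 and let $\operatorname{Im}N^J\subset\mathfrak g$ be the span of all $N^J(A,B)$. Then the following are equivalent. (1) $\operatorname{Im}N^j$ is involutive (that is, $[\mathcal D,\mathcal D]\subset\mathcal D$), it is the tangent distribution of a smooth foliation of $M$ (around every point there is a smooth chart whose differential carries $\operatorname{Im}N^j$ onto a fixed linear subspace of the model space), and $j$ induces a $\mathcal D$-transverse complex structure: for all $F\in\mathcal D$ and all smooth vector fields $U,V$ on $M$, the vector fields $jF$, $j^2U+U$, $[F,jU]-j[F,U]$ and $N^j(U,V)$ belong to $\mathcal D$. (2) $[JA,N^J(B,C)]-J[A,N^J(B,C)]\in\operatorname{Im}N^J+\mathfrak h$ for all $A,B,C\in\mathfrak g$. -/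

import Mathlib

open scoped Manifold ContDiff Pointwise

noncomputable section

namespace TransverseComplex

/-! ### Vector fields, distributions and transverse complex structures -/

section Manifold

variable {E : Type*} [NormedAddCommGroup E] [NormedSpace ℝ E]
  {M : Type*} [TopologicalSpace M] [ChartedSpace E M] [IsManifold 𝓘(ℝ, E) ∞ M]

/-- Smoothness of a (globally defined) vector field: membership in `𝔛(M)`. -/
def IsSmoothField (X : ∀ x : M, TangentSpace 𝓘(ℝ, E) x) : Prop :=
  ContMDiff 𝓘(ℝ, E) 𝓘(ℝ, E).tangent ∞ (fun x => (⟨x, X x⟩ : TangentBundle 𝓘(ℝ, E) M))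

/-- Smoothness of a field of endomorphisms of the tangent bundle, as a section of `End(TM)`. -/
def IsSmoothEnd
    (k : ∀ x : M, TangentSpace 𝓘(ℝ, E) x →L[ℝ] TangentSpace 𝓘(ℝ, E) x) : Prop :=
  ContMDiff 𝓘(ℝ, E) (𝓘(ℝ, E).prod 𝓘(ℝ, E →L[ℝ] E)) ∞
    (fun x => Bundle.TotalSpace.mk' (E →L[ℝ] E)
      (E := fun x : M => TangentSpace 𝓘(ℝ, E) x →L[ℝ] TangentSpace 𝓘(ℝ, E) x) x (k x))

/-- An almost complex structure: a smooth field `j` of endomorphisms of `TM` with `j² = -id`. -/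
structure IsAlmostComplex
    (j : ∀ x : M, TangentSpace 𝓘(ℝ, E) x →L[ℝ] TangentSpace 𝓘(ℝ, E) x) : Prop where
  smooth : IsSmoothEnd j
  sq_eq_neg : ∀ (x : M) (v : TangentSpace 𝓘(ℝ, E) x), j x (j x v) = -v

/-- The vector field `kX`. -/
def endApply (k : ∀ x : M, TangentSpace 𝓘(ℝ, E) x →L[ℝ] TangentSpace 𝓘(ℝ, E) x)
    (X : ∀ x : M, TangentSpace 𝓘(ℝ, E) x) : ∀ x : M, TangentSpace 𝓘(ℝ, E) x :=
  fun x => k x (X x)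

/-- The Lie bracket `[X, Y]` of vector fields. -/
abbrev bracket (X Y : ∀ x : M, TangentSpace 𝓘(ℝ, E) x) : ∀ x : M, TangentSpace 𝓘(ℝ, E) x :=
  VectorField.mlieBracket 𝓘(ℝ, E) X Y

/-- The Nijenhuis tensor `N^k(X, Y) = [kX, kY] - k[kX, Y] - k[X, kY] + k²[X, Y]`. -/
def nijenhuis (k : ∀ x : M, TangentSpace 𝓘(ℝ, E) x →L[ℝ] TangentSpace 𝓘(ℝ, E) x)
    (X Y : ∀ x : M, TangentSpace 𝓘(ℝ, E) x) : ∀ x : M, TangentSpace 𝓘(ℝ, E) x :=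
  bracket (endApply k X) (endApply k Y) - endApply k (bracket (endApply k X) Y)
    - endApply k (bracket X (endApply k Y)) + endApply k (endApply k (bracket X Y))

/-- The image distribution `Im N^k`: at `x`, the span of all values `N^k(X, Y)_x`. -/
def imNijenhuis (k : ∀ x : M, TangentSpace 𝓘(ℝ, E) x →L[ℝ] TangentSpace 𝓘(ℝ, E) x) (x : M) :
    Submodule ℝ (TangentSpace 𝓘(ℝ, E) x) :=
  Submodule.span ℝ {v | ∃ X Y : ∀ y : M, TangentSpace 𝓘(ℝ, E) y,
    IsSmoothField X ∧ IsSmoothField Y ∧ nijenhuis k X Y x = v}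

/-- The space `Γ^∞(D)` of smooth sections of a distribution `D` (of possibly varying rank). -/
def smoothSections (D : ∀ x : M, Submodule ℝ (TangentSpace 𝓘(ℝ, E) x)) :
    Set (∀ x : M, TangentSpace 𝓘(ℝ, E) x) :=
  {X | IsSmoothField X ∧ ∀ x, X x ∈ D x}

/-- A space of vector fields is involutive if it is closed under the Lie bracket. -/
def IsInvolutive (𝒟 : Set (∀ x : M, TangentSpace 𝓘(ℝ, E) x)) : Prop :=
  ∀ X ∈ 𝒟, ∀ Y ∈ 𝒟, bracket X Y ∈ 𝒟

/-- The distribution `D` is tangent to a smooth (regular) foliation: around every point there is a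
smooth chart `φ` with values in the model space `E` whose differential carries `D` onto a fixed
linear subspace `F` of `E`, so that the plaques are the sets where `φ` stays in a translate of
`F`. -/
def DefinesFoliation (D : ∀ x : M, Submodule ℝ (TangentSpace 𝓘(ℝ, E) x)) : Prop :=
  ∃ F : Submodule ℝ E, ∀ x : M,
    ∃ φ ∈ IsManifold.maximalAtlas 𝓘(ℝ, E) ∞ M, x ∈ φ.source ∧
      ∀ y ∈ φ.source, ∀ v : TangentSpace 𝓘(ℝ, E) y,
        v ∈ D y ↔ (mfderiv 𝓘(ℝ, E) 𝓘(ℝ, E) φ y v : E) ∈ F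

/-- The smooth section `k` of `End(TM)` represents a `𝒟`-transverse almost complex structure. -/
structure IsTransverseAlmostComplex
    (𝒟 : Set (∀ x : M, TangentSpace 𝓘(ℝ, E) x))
    (k : ∀ x : M, TangentSpace 𝓘(ℝ, E) x →L[ℝ] TangentSpace 𝓘(ℝ, E) x) : Prop where
  smooth : IsSmoothEnd k
  map_mem : ∀ F ∈ 𝒟, endApply k F ∈ 𝒟
  sq_add_mem : ∀ U, IsSmoothField U → endApply k (endApply k U) + U ∈ 𝒟
  lie_mem : ∀ F ∈ 𝒟, ∀ U, IsSmoothField U →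
    bracket F (endApply k U) - endApply k (bracket F U) ∈ 𝒟

/-- The smooth section `k` of `End(TM)` represents a `𝒟`-transverse complex structure. -/
structure IsTransverseComplex
    (𝒟 : Set (∀ x : M, TangentSpace 𝓘(ℝ, E) x))
    (k : ∀ x : M, TangentSpace 𝓘(ℝ, E) x →L[ℝ] TangentSpace 𝓘(ℝ, E) x) : Prop
    extends IsTransverseAlmostComplex 𝒟 k where
  nijenhuis_mem : ∀ U V, IsSmoothField U → IsSmoothField V → nijenhuis k U V ∈ 𝒟

end Manifold

/-! ### Group actions -/

section Action

variable {EG : Type*} [NormedAddCommGroup EG] [NormedSpace ℝ EG]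
  {G : Type*} [TopologicalSpace G] [ChartedSpace EG G] [Group G]
  {E : Type*} [NormedAddCommGroup E] [NormedSpace ℝ E]
  {M : Type*} [TopologicalSpace M] [ChartedSpace E M] [MulAction G M]

/-- The fundamental vector field `A^*_x = d/dt|_{t=0} exp(-tA)·x`: the derivative at the neutral
element of `g ↦ g·x`, applied to `-A`. -/
def fundamentalField (M : Type*) [TopologicalSpace M] [ChartedSpace E M] [MulAction G M]
    (A : GroupLieAlgebra 𝓘(ℝ, EG) G) : ∀ x : M, TangentSpace 𝓘(ℝ, E) x :=
  fun x => -(show TangentSpace 𝓘(ℝ, E) x from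
    (mfderiv 𝓘(ℝ, EG) 𝓘(ℝ, E) (fun g : G => g • x) 1 A : E))

/-- Invariance of a field `j` of endomorphisms of `TM`: `ρ(g)_* ∘ j = j ∘ ρ(g)_*` for all `g`. -/
def IsInvariantEnd (G : Type*) [Group G] [MulAction G M]
    (j : ∀ x : M, TangentSpace 𝓘(ℝ, E) x →L[ℝ] TangentSpace 𝓘(ℝ, E) x) : Prop :=
  ∀ (g : G) (x : M) (v : TangentSpace 𝓘(ℝ, E) x),
    mfderiv 𝓘(ℝ, E) 𝓘(ℝ, E) (fun y : M => g • y) x (j x v) =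
      j (g • x) (mfderiv 𝓘(ℝ, E) 𝓘(ℝ, E) (fun y : M => g • y) x v)

/-- The Lie algebra `𝔥` of a closed subgroup `H`, i.e. the tangent space of `H` at the neutral
element: the velocities at `0` of the curves in `H` through the neutral element. -/
def subgroupLieAlgebra (H : Subgroup G) : Set (GroupLieAlgebra 𝓘(ℝ, EG) G) :=
  {A | ∃ γ : ℝ → G, γ 0 = 1 ∧ (∀ t, γ t ∈ H) ∧
    MDifferentiableAt 𝓘(ℝ, ℝ) 𝓘(ℝ, EG) γ 0 ∧
    (mfderiv 𝓘(ℝ, ℝ) 𝓘(ℝ, EG) γ 0 (1 : ℝ) : EG) = A}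

/-- `N^J(A, B) = [JA, JB] - J[JA, B] - J[A, JB] - [A, B]` on the Lie algebra of `G`. -/
def lieNijenhuis (J : GroupLieAlgebra 𝓘(ℝ, EG) G →ₗ[ℝ] GroupLieAlgebra 𝓘(ℝ, EG) G)
    (A B : GroupLieAlgebra 𝓘(ℝ, EG) G) : GroupLieAlgebra 𝓘(ℝ, EG) G :=
  ⁅J A, J B⁆ - J ⁅J A, B⁆ - J ⁅A, J B⁆ - ⁅A, B⁆

/-- `Im N^J`: the subspace of the Lie algebra spanned by the values of `N^J`. -/
def imLieNijenhuis (J : GroupLieAlgebra 𝓘(ℝ, EG) G →ₗ[ℝ] GroupLieAlgebra 𝓘(ℝ, EG) G) :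
    Submodule ℝ (GroupLieAlgebra 𝓘(ℝ, EG) G) :=
  Submodule.span ℝ {N | ∃ A B, lieNijenhuis J A B = N}

end Action

end TransverseComplex

end

open scoped Topology

set_option linter.unusedSectionVars false

namespace TransverseComplex

universe u

open Set Filter

/-! ### Inverse function theorem with a smooth inverse on the whole target -/

section InverseFunction

variable {E F : Type*} [NormedAddCommGroup E] [NormedSpace ℝ E] [CompleteSpace E]
  [NormedAddCommGroup F] [NormedSpace ℝ F]

/-! Write D for the distribution Im N^j. Homogeneity reduces everything to the Lie algebra and the
base point. Orbit maps of a transitive action are submersions (`orbitDeriv_surjective`), so the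
fundamental fields fill every tangent space. With the sign exp(-tA) they satisfy [A*, B*] = [A, B]*.
Since j is invariant, so is D; hence [A*, jU] = j[A*, U], and bracketing with A* preserves sections
of D.

The second ingredient is that a field V vanishing at x acts there linearly: [V, Y]_x depends only on
Y_x, and [jV, Y]_x = j[V, Y]_x (`exists_mlieBracket_eq_of_apply_eq_zero`). Consequently N^j is a
tensor, and so is U ↦ [F, jU] - j[F, U]. Applied to V = jA* - (JA)*, which vanishes at x₀, it turns
brackets with jA* into Lie algebra expressions. At x₀ this gives N^j(A*, B*) = -N^J(A, B)*, so D is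
the image of Im N^J; and if F is a section of D with value n*, then [F, jA*] - j[F, A*] equals ([JA,
n] - J[A, n])* modulo D (`bracket_endApply_fundamentalField_sub_mem`). The kernel of A ↦ A* at x₀ is
𝔥, so (2) says precisely that [F, jU] - j[F, U] is a section of D whenever F is: the Lie derivative
condition in (1).

The remaining clauses of (1) follow from that condition. Stability of D under j comes from jN^j(X,
Y) = -N^j(jX, Y); two clauses are immediate. For involutivity, L_F j vanishes modulo D along
sections F of D, so differentiating N^j(X, Y) along F gives only values of N^j and further terms of
the form L_δ j with δ a section of D (`bracket_nijenhuis_mem`). Every section of D agrees at a given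
point with a sum of such fields, and the difference, a section vanishing there, is handled by
replacing the other field by a fundamental one (`bracket_mem_imNijenhuis`). An invariant
distribution has constant rank, so the Frobenius theorem gives a flat chart at one point, and
translating it by G gives charts everywhere with the same model subspace.

The Frobenius theorem is proved through graphs: leaves are obtained from the equation η' = Φ(sp, η)p
by the inverse function theorem in a Banach space of paths, and the integrability condition with
Gronwall's inequality shows that the resulting parametrisation is tangent to the distribution. -/

theorem exists_openPartialHomeomorph_of_contDiffOn {f : E → F} {U : Set E} (hU : IsOpen U)
    (hf : ContDiffOn ℝ ∞ f U) {a : E} (ha : a ∈ U) {f' : E ≃L[ℝ] F}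
    (hf' : HasFDerivAt f (f' : E →L[ℝ] F) a) :
    ∃ e : OpenPartialHomeomorph E F, a ∈ e.source ∧ e.source ⊆ U ∧ (∀ x, e x = f x) ∧
      ContDiffOn ℝ ∞ e.symm e.target ∧
      ∀ x ∈ e.source, ∃ g : E ≃L[ℝ] F, HasFDerivAt f (g : E →L[ℝ] F) x := by
  have hfa : ContDiffAt ℝ ∞ f a := hf.contDiffAt (hU.mem_nhds ha)
  have hn : (∞ : WithTop ℕ∞) ≠ 0 := by simp
  set e₀ := hfa.toOpenPartialHomeomorph f hf' hn with he₀
  have hcont : ContinuousOn (fderiv ℝ f) U := hf.continuousOn_fderiv_of_isOpen hU (by simp)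
  -- Invertible operators form an open set. Restricting to points with invertible differential makes
  -- the inverse smooth on all of the target, not only near the image of `a`.
  have hVo : IsOpen (U ∩ fderiv ℝ f ⁻¹' range ((↑) : (E ≃L[ℝ] F) → E →L[ℝ] F)) :=
    hcont.isOpen_inter_preimage hU ContinuousLinearEquiv.isOpen
  set V := U ∩ fderiv ℝ f ⁻¹' range ((↑) : (E ≃L[ℝ] F) → E →L[ℝ] F)
  have hfV : ∀ x ∈ V, ∃ g : E ≃L[ℝ] F, HasFDerivAt f (g : E →L[ℝ] F) x := by
    rintro x ⟨hxU, g, hg⟩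
    refine ⟨g, ?_⟩
    rw [hg]
    exact ((hf.contDiffAt (hU.mem_nhds hxU)).differentiableAt hn).hasFDerivAt
  have hsrc : (e₀.restrOpen V hVo).source = e₀.source ∩ V := e₀.restrOpen_source V hVo
  refine ⟨e₀.restrOpen V hVo, ?_, ?_, fun x => rfl, ?_, ?_⟩
  · rw [hsrc]
    exact ⟨hfa.mem_toOpenPartialHomeomorph_source hf' hn, ha, f', hf'.fderiv.symm⟩
  · rw [hsrc]
    exact fun x hx => hx.2.1
  · intro y hy
    have hx := (e₀.restrOpen V hVo).map_target hy
    rw [hsrc] at hx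
    obtain ⟨g, hg⟩ := hfV _ hx.2
    exact (OpenPartialHomeomorph.contDiffAt_symm _ hy hg
      (hf.contDiffAt (hU.mem_nhds hx.2.1))).contDiffWithinAt
  · rw [hsrc]
    exact fun x hx => hfV x hx.2

end InverseFunction

/-! ### Smoothness of superposition operators on spaces of continuous maps -/

section Superposition

variable {K : Type*} [TopologicalSpace K] [CompactSpace K]

/-- Pointwise application of a continuous family of linear maps to a continuous map. -/
noncomputable def pointwiseApply (K E F : Type*) [TopologicalSpace K] [CompactSpace K]
    [NormedAddCommGroup E] [NormedSpace ℝ E] [NormedAddCommGroup F] [NormedSpace ℝ F] :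
    C(K, E →L[ℝ] F) →L[ℝ] C(K, E) →L[ℝ] C(K, F) :=
  LinearMap.mkContinuous₂
    (LinearMap.mk₂ ℝ
      (fun (A : C(K, E →L[ℝ] F)) (h : C(K, E)) =>
        (⟨fun s => A s (h s), by fun_prop⟩ : C(K, F)))
      (fun _ _ _ => by ext; simp) (fun _ _ _ => by ext; simp)
      (fun _ _ _ => by ext; simp) (fun _ _ _ => by ext; simp)) 1
    (fun A h => by
      rw [one_mul]
      refine (ContinuousMap.norm_le _ (by positivity)).2 fun s => ?_
      exact ((A s).le_opNorm _).trans
        (mul_le_mul (A.norm_coe_le_norm s) (h.norm_coe_le_norm s) (norm_nonneg _)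
          (norm_nonneg A)))

@[simp] theorem pointwiseApply_apply {E F : Type*}
    [NormedAddCommGroup E] [NormedSpace ℝ E] [NormedAddCommGroup F] [NormedSpace ℝ F]
    (A : C(K, E →L[ℝ] F)) (h : C(K, E)) (s : K) : pointwiseApply K E F A h s = A s (h s) := rfl

/-- The mean value inequality bounds the remainder at each `s`; uniformity in `s` comes from
continuity of `η ↦ g' ∘ η` in the sup norm, which rests on compactness of `K`. -/
theorem hasFDerivAt_comp_continuousMap {E F : Type*} [NormedAddCommGroup E] [NormedSpace ℝ E]
    [NormedAddCommGroup F] [NormedSpace ℝ F] (g : C(E, F)) (g' : C(E, E →L[ℝ] F))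
    (hg : ∀ x, HasFDerivAt g (g' x) x) (γ : C(K, E)) :
    HasFDerivAt (fun η : C(K, E) => g.comp η) (pointwiseApply K E F (g'.comp γ)) γ := by
  rw [hasFDerivAt_iff_isLittleO_nhds_zero, Asymptotics.isLittleO_iff]
  intro c hc
  have hcont : Continuous fun η : C(K, E) => g'.comp η := g'.continuous_postcomp
  obtain ⟨δ, hδ, H⟩ := Metric.continuousAt_iff
    (α := C(K, E)) (β := C(K, E →L[ℝ] F)).1 (hcont.continuousAt (x := γ)) c hc
  filter_upwards [Metric.ball_mem_nhds (0 : C(K, E)) hδ] with h hh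
  rw [mem_ball_zero_iff] at hh
  refine (ContinuousMap.norm_le _ (by positivity)).2 fun s => ?_
  -- The choice of `δ` concerns maps close to `γ`; testing it on `γ` shifted by the constant `v - γ
  -- s` yields the estimate at the point `v`.
  have key : ∀ v ∈ Metric.ball (γ s) δ, ‖g' v - g' (γ s)‖ ≤ c := by
    intro v hv
    have hd : dist (γ + ContinuousMap.const K (v - γ s)) γ < δ := by
      rw [dist_eq_norm, add_sub_cancel_left]
      refine lt_of_le_of_lt ((ContinuousMap.norm_le _ (norm_nonneg (v - γ s))).2 fun _ => ?_)
        (by rwa [mem_ball_iff_norm] at hv)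
      simp
    have := (ContinuousMap.dist_apply_le_dist s).trans (H hd).le
    simpa [dist_eq_norm] using this
  have hb : ∀ z, ‖z‖ < δ → γ s + z ∈ Metric.ball (γ s) δ := fun z hz => by
    simpa [mem_ball_iff_norm] using hz
  have := (convex_ball (γ s) δ).norm_image_sub_le_of_norm_hasFDerivWithin_le'
    (f := g) (f' := g') (φ := g' (γ s)) (C := c) (fun x _ => (hg x).hasFDerivWithinAt) key
    (Metric.mem_ball_self hδ) (hb (h s) ((h.norm_coe_le_norm s).trans_lt hh))
  rw [add_sub_cancel_left] at this
  exact this.trans (by gcongr; exact h.norm_coe_le_norm s)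

/-- The derivative is again a superposition operator, that of `g'`, followed by a continuous linear
map; this drives the induction. The target changes from `F` to `E →L[ℝ] F` at each step, which is
why both spaces share a universe. -/
theorem contDiff_comp_continuousMap_nat {E : Type u} [NormedAddCommGroup E] [NormedSpace ℝ E]
    (n : ℕ) : ∀ {F : Type u} [NormedAddCommGroup F] [NormedSpace ℝ F] (g : C(E, F)),
      ContDiff ℝ ∞ g → ContDiff ℝ n (fun η : C(K, E) => g.comp η) := by
  induction n with
  | zero =>
    intro F _ _ g _
    exact contDiff_zero.2 g.continuous_postcomp
  | succ n ih =>
    intro F _ _ g hg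
    have hd : ContDiff ℝ ∞ (fderiv ℝ g) := hg.fderiv_right (by simp)
    let g' : C(E, E →L[ℝ] F) := ⟨fderiv ℝ g, hd.continuous⟩
    rw [Nat.cast_succ, contDiff_succ_iff_hasFDerivAt]
    exact ⟨fun η => pointwiseApply K E F (g'.comp η),
      (ih g' hd).continuousLinearMap_comp (pointwiseApply K E F),
      hasFDerivAt_comp_continuousMap g g'
        fun x => (hg.differentiable (by simp) x).hasFDerivAt⟩

theorem contDiff_comp_continuousMap {E F : Type u} [NormedAddCommGroup E] [NormedSpace ℝ E]
    [NormedAddCommGroup F] [NormedSpace ℝ F] (g : C(E, F)) (hg : ContDiff ℝ ∞ g) :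
    ContDiff ℝ ∞ (fun η : C(K, E) => g.comp η) :=
  contDiff_infty.2 fun n => contDiff_comp_continuousMap_nat n g hg

end Superposition

/-! ### Integration of paths on the unit interval -/

section Integration

variable {F : Type*} [NormedAddCommGroup F] [NormedSpace ℝ F]

theorem continuous_extend_unitInterval (h : C(unitInterval, F)) :
    Continuous fun τ : ℝ => h (projIcc 0 1 zero_le_one τ) :=
  h.continuous.comp continuous_projIcc

/-- The primitive vanishing at `0` of a continuous map on the unit interval. -/
noncomputable def primitive (F : Type*) [NormedAddCommGroup F] [NormedSpace ℝ F] :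
    C(unitInterval, F) →L[ℝ] C(unitInterval, F) :=
  LinearMap.mkContinuous
    { toFun := fun h => ⟨fun s => ∫ τ in (0 : ℝ)..s, h (projIcc 0 1 zero_le_one τ),
        (intervalIntegral.continuous_primitive
          (fun a b => (continuous_extend_unitInterval h).intervalIntegrable a b) 0).comp
          continuous_subtype_val⟩
      map_add' := fun h k => by
        ext s
        exact intervalIntegral.integral_add
          ((continuous_extend_unitInterval h).intervalIntegrable _ _)
          ((continuous_extend_unitInterval k).intervalIntegrable _ _)
      map_smul' := fun c h => by
        ext s
        exact intervalIntegral.integral_smul c _ } 1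
    (fun h => by
      rw [one_mul]
      refine (ContinuousMap.norm_le _ (norm_nonneg h)).2 fun s => ?_
      refine (intervalIntegral.norm_integral_le_of_norm_le_const
        fun τ _ => h.norm_coe_le_norm (projIcc 0 1 zero_le_one τ)).trans ?_
      rw [sub_zero, abs_of_nonneg s.2.1]
      exact mul_le_of_le_one_right (norm_nonneg h) s.2.2)

theorem primitive_apply (h : C(unitInterval, F)) (s : unitInterval) :
    primitive F h s = ∫ τ in (0 : ℝ)..s, h (projIcc 0 1 zero_le_one τ) := rfl

@[simp] theorem primitive_apply_zero (h : C(unitInterval, F)) : primitive F h 0 = 0 := by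
  simp [primitive_apply]

/-- A map of the unit interval that equals a constant plus a primitive, extended to the line by
constants, has the integrand as right derivative. -/
theorem hasDerivWithinAt_of_eq_add_primitive [CompleteSpace F] {η h : C(unitInterval, F)} {c : F}
    (hη : ∀ s, η s = c + primitive F h s) {s : ℝ} (hs : s ∈ Ico (0 : ℝ) 1) :
    HasDerivWithinAt (fun τ : ℝ => η (projIcc 0 1 zero_le_one τ))
      (h (projIcc 0 1 zero_le_one s)) (Ici s) s := by
  have hc := continuous_extend_unitInterval h
  have h1 : HasDerivAt (fun s : ℝ => c + ∫ τ in (0 : ℝ)..s, h (projIcc 0 1 zero_le_one τ))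
      (h (projIcc 0 1 zero_le_one s)) s :=
    (intervalIntegral.integral_hasDerivAt_right (hc.intervalIntegrable _ _)
      hc.aestronglyMeasurable.stronglyMeasurableAtFilter hc.continuousAt).const_add c
  refine (h1.hasDerivWithinAt (s := Ici s)).congr_of_eventuallyEq ?_ ?_
  · filter_upwards [Icc_mem_nhdsGE hs.2] with τ hτ
    have h2 : τ ∈ Icc (0 : ℝ) 1 := ⟨hs.1.trans hτ.1, hτ.2⟩
    rw [hη, primitive_apply, projIcc_of_mem _ h2]
  · have h2 : s ∈ Icc (0 : ℝ) 1 := ⟨hs.1, hs.2.le⟩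
    rw [hη, primitive_apply, projIcc_of_mem _ h2]

end Integration

/-! ### The Frobenius theorem for fields of graphs -/

section Frobenius

variable {R C A : Type u} [NormedAddCommGroup R] [NormedSpace ℝ R]
  [NormedAddCommGroup C] [NormedSpace ℝ C] [NormedAddCommGroup A] [NormedSpace ℝ A]

/-- Pointwise application of a bilinear map to continuous maps. -/
noncomputable def pointwiseBilin (K : Type*) [TopologicalSpace K] [CompactSpace K]
    (b : A →L[ℝ] R →L[ℝ] C) : C(K, A) →L[ℝ] C(K, R) →L[ℝ] C(K, C) :=
  LinearMap.mkContinuous₂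
    (LinearMap.mk₂ ℝ
      (fun (f : C(K, A)) (h : C(K, R)) => (⟨fun s => b (f s) (h s), by fun_prop⟩ : C(K, C)))
      (fun _ _ _ => by ext; simp) (fun _ _ _ => by ext; simp)
      (fun _ _ _ => by ext; simp) (fun _ _ _ => by ext; simp)) ‖b‖
    (fun f h => by
      refine (ContinuousMap.norm_le _ (by positivity)).2 fun s => ?_
      refine (b.le_opNorm₂ _ _).trans ?_
      gcongr
      · exact f.norm_coe_le_norm s
      · exact h.norm_coe_le_norm s)

@[simp] theorem pointwiseBilin_apply {K : Type*} [TopologicalSpace K] [CompactSpace K]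
    (b : A →L[ℝ] R →L[ℝ] C) (f : C(K, A)) (h : C(K, R)) (s : K) :
    pointwiseBilin K b f h s = b (f s) (h s) := rfl

/-- The inclusion of constant maps. -/
noncomputable def constMap (K E : Type*) [TopologicalSpace K] [CompactSpace K]
    [NormedAddCommGroup E] [NormedSpace ℝ E] : E →L[ℝ] C(K, E) :=
  LinearMap.mkContinuous
    { toFun := ContinuousMap.const K
      map_add' := fun _ _ => rfl
      map_smul' := fun _ _ => rfl } 1
    (fun v => by
      rw [one_mul]
      exact (ContinuousMap.norm_le _ (norm_nonneg v)).2 fun _ => le_rfl)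

@[simp] theorem constMap_apply {K E : Type*} [TopologicalSpace K] [CompactSpace K]
    [NormedAddCommGroup E] [NormedSpace ℝ E] (v : E) (s : K) : constMap K E v s = v := rfl

/-- The path `s ↦ (s p, η s)` attached to `((p, q), η)`. -/
noncomputable def leafPath (R C : Type*) [NormedAddCommGroup R] [NormedSpace ℝ R]
    [NormedAddCommGroup C] [NormedSpace ℝ C] :
    (R × C) × C(unitInterval, C) →L[ℝ] C(unitInterval, R × C) :=
  LinearMap.mkContinuous
    { toFun := fun w => ⟨fun s => ((s : ℝ) • w.1.1, w.2 s), by fun_prop⟩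
      map_add' := fun _ _ => by ext s <;> simp
      map_smul' := fun c w => by ext s <;> simp [smul_comm c] } 1
    (fun w => by
      rw [one_mul]
      refine (ContinuousMap.norm_le _ (norm_nonneg w)).2 fun s => ?_
      refine norm_prod_le_iff.2 ⟨?_, (w.2.norm_coe_le_norm s).trans (norm_snd_le w)⟩
      have h1 : ‖(s : ℝ) • w.1.1‖ ≤ ‖w.1.1‖ := by
        rw [norm_smul, Real.norm_of_nonneg s.2.1]
        exact mul_le_of_le_one_left (norm_nonneg _) s.2.2
      exact h1.trans ((norm_fst_le w.1).trans (norm_fst_le w)))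

@[simp] theorem leafPath_apply (w : (R × C) × C(unitInterval, C)) (s : unitInterval) :
    leafPath R C w s = ((s : ℝ) • w.1.1, w.2 s) := rfl

/-- The Picard operator of the equation `η' = Φ (s p, η) p`, `η 0 = q`. -/
noncomputable def leafPicard (b : A →L[ℝ] R →L[ℝ] C) (Φ : C(R × C, A)) (w : (R × C) × C(unitInterval, C)) :
    C(unitInterval, C) :=
  constMap unitInterval C w.1.2 +
    primitive C (pointwiseBilin unitInterval b (Φ.comp (leafPath R C w))
      (constMap unitInterval R w.1.1))

theorem contDiff_leafPicard (b : A →L[ℝ] R →L[ℝ] C) (Φ : C(R × C, A)) (hΦ : ContDiff ℝ ∞ Φ) :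
    ContDiff ℝ ∞ (leafPicard b Φ) := by
  have h1 : ContDiff ℝ ∞ fun w => Φ.comp (leafPath R C w) :=
    (contDiff_comp_continuousMap Φ hΦ).comp (leafPath R C).contDiff
  have h2 : ContDiff ℝ ∞ fun w : (R × C) × C(unitInterval, C) =>
      constMap unitInterval R w.1.1 := (constMap unitInterval R).contDiff.comp (by fun_prop)
  have h3 : ContDiff ℝ ∞ fun w : (R × C) × C(unitInterval, C) =>
      constMap unitInterval C w.1.2 := (constMap unitInterval C).contDiff.comp (by fun_prop)
  exact h3.add ((((h1.continuousLinearMap_comp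
    (pointwiseBilin unitInterval b)).clm_apply h2)).continuousLinearMap_comp (primitive C))

theorem hasFDerivAt_clm_comp_continuousMap {K X E F H : Type*} [TopologicalSpace K]
    [CompactSpace K] [NormedAddCommGroup X] [NormedSpace ℝ X] [NormedAddCommGroup E]
    [NormedSpace ℝ E] [NormedAddCommGroup F] [NormedSpace ℝ F] [NormedAddCommGroup H]
    [NormedSpace ℝ H] (T : C(K, F) →L[ℝ] H) (ℓ : X →L[ℝ] C(K, E)) (g : C(E, F))
    (g' : C(E, E →L[ℝ] F)) (hg : ∀ x, HasFDerivAt g (g' x) x) (w : X) :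
    HasFDerivAt (fun w => T (g.comp (ℓ w)))
      (T.comp ((pointwiseApply K E F (g'.comp (ℓ w))).comp ℓ)) w :=
  T.hasFDerivAt.comp w
    ((hasFDerivAt_comp_continuousMap g g' hg (ℓ w)).comp w ℓ.hasFDerivAt)

/-- This is the linearised integral equation. The derivative is recorded through its values, which
are what the fixed-point arguments use. -/
theorem hasFDerivAt_leafPicard (b : A →L[ℝ] R →L[ℝ] C) (Φ : C(R × C, A)) (Φ' : C(R × C, R × C →L[ℝ] A))
    (hΦ : ∀ y, HasFDerivAt Φ (Φ' y) y) (w : (R × C) × C(unitInterval, C)) :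
    ∃ L : (R × C) × C(unitInterval, C) →L[ℝ] C(unitInterval, C), HasFDerivAt (leafPicard b Φ) L w ∧
      ∀ v, L v = constMap unitInterval C v.1.2 + primitive C
        (pointwiseBilin unitInterval b (Φ.comp (leafPath R C w))
          (constMap unitInterval R v.1.1) +
        pointwiseBilin unitInterval b (pointwiseApply unitInterval (R × C) A
          (Φ'.comp (leafPath R C w)) (leafPath R C v)) (constMap unitInterval R w.1.1)) := by
  have h1' : HasFDerivAt (fun w => pointwiseBilin unitInterval b (Φ.comp (leafPath R C w)))
      ((pointwiseBilin unitInterval b).comp ((pointwiseApply unitInterval (R × C) A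
        (Φ'.comp (leafPath R C w))).comp (leafPath R C))) w :=
    hasFDerivAt_clm_comp_continuousMap (H := C(unitInterval, R) →L[ℝ] C(unitInterval, C))
      (pointwiseBilin unitInterval b) (leafPath R C) Φ Φ' hΦ w
  have h2 := ((constMap unitInterval R).comp ((ContinuousLinearMap.fst ℝ R C).comp
    (ContinuousLinearMap.fst ℝ (R × C) C(unitInterval, C)))).hasFDerivAt (x := w)
  have h3 := ((constMap unitInterval C).comp ((ContinuousLinearMap.snd ℝ R C).comp
    (ContinuousLinearMap.fst ℝ (R × C) C(unitInterval, C)))).hasFDerivAt (x := w)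
  have h4 := h3.add ((primitive C).hasFDerivAt.comp w (h1'.clm_apply h2))
  exact ⟨_, h4, fun v => rfl⟩

theorem leafPicard_of_fst_eq_zero (b : A →L[ℝ] R →L[ℝ] C) (Φ : C(R × C, A)) (q : C) (η : C(unitInterval, C)) :
    leafPicard b Φ ((0, q), η) = constMap unitInterval C q := by
  simp [leafPicard]

variable [CompleteSpace R] [CompleteSpace C]

/-- The inverse function theorem for `(x, η) ↦ (x, η - leafPicard (x, η))` gives existence of the
paths and their smooth dependence on `(p, q)` at once. No contraction estimate is needed: at `p = 0`
the operator does not depend on the path. -/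
theorem exists_contDiffOn_leafPicard_fixedPoint (b : A →L[ℝ] R →L[ℝ] C) (Φ : C(R × C, A)) (hΦ : ContDiff ℝ ∞ Φ)
    {r : ℝ} (hr : 0 < r) :
    ∃ W : Set (R × C), IsOpen W ∧ 0 ∈ W ∧ ∃ η : R × C → C(unitInterval, C),
      ContDiffOn ℝ ∞ η W ∧ ∀ x ∈ W, η x = leafPicard b Φ (x, η x) ∧ ‖x‖ < r ∧ ‖η x‖ < r := by
  have hd : ContDiff ℝ ∞ (fderiv ℝ Φ) := hΦ.fderiv_right (by simp)
  obtain ⟨L, hL, hLv⟩ := hasFDerivAt_leafPicard b Φ ⟨fderiv ℝ Φ, hd.continuous⟩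
    (fun y => (hΦ.differentiable (by simp) y).hasFDerivAt) 0
  have hK0 : leafPicard b Φ 0 = 0 :=
    (leafPicard_of_fst_eq_zero b Φ 0 0).trans (map_zero _)
  let f : (R × C) × C(unitInterval, C) → (R × C) × C(unitInterval, C) :=
    fun w => (w.1, w.2 - leafPicard b Φ w)
  have hf : ContDiff ℝ ∞ f := contDiff_fst.prodMk (contDiff_snd.sub (contDiff_leafPicard b Φ hΦ))
  let f' : ((R × C) × C(unitInterval, C)) ≃L[ℝ] ((R × C) × C(unitInterval, C)) :=
    (ContinuousLinearEquiv.refl ℝ (R × C)).skewProd (ContinuousLinearEquiv.refl ℝ _)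
      (-(L.comp (ContinuousLinearMap.inl ℝ (R × C) C(unitInterval, C))))
  have hf' : HasFDerivAt f (f' : _ →L[ℝ] _) 0 := by
    refine ((hasFDerivAt_fst (𝕜 := ℝ) (p := (0 : (R × C) × C(unitInterval, C)))).prodMk
      (hasFDerivAt_snd.sub hL)).congr_fderiv
        (ContinuousLinearMap.ext fun v => Prod.ext rfl ?_)
    -- The path variable enters `L` only through the term multiplied by the `p` of the base point,
    -- which is 0 here; so the differential of `f` is triangular with identity diagonal.
    have h1 : L (v.1, 0) = L v := by
      rw [hLv, hLv]
      simp
    simp [f', h1, sub_eq_add_neg]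
  obtain ⟨e, h0, -, hef, hes, -⟩ := exists_openPartialHomeomorph_of_contDiffOn isOpen_univ
    hf.contDiffOn (mem_univ 0) hf'
  have hf0 : f 0 = 0 := by simp [f, hK0]
  let ι : R × C → (R × C) × C(unitInterval, C) := fun x => (x, 0)
  have hι : ContDiff ℝ ∞ ι := contDiff_id.prodMk contDiff_const
  let η : R × C → C(unitInterval, C) := fun x => (e.symm (ι x)).2
  have hWo : IsOpen (ι ⁻¹' e.target) := e.open_target.preimage hι.continuous
  have hη : ContDiffOn ℝ ∞ η (ι ⁻¹' e.target) :=
    contDiff_snd.comp_contDiffOn (hes.comp hι.contDiffOn fun x hx => hx)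
  have hfix : ∀ x ∈ ι ⁻¹' e.target, η x = leafPicard b Φ (x, η x) := by
    intro x hx
    have h1 : f (e.symm (ι x)) = ι x := by rw [← hef, e.right_inv hx]
    have h2 : (e.symm (ι x)).1 = x := congrArg Prod.fst h1
    have h3 : η x - leafPicard b Φ (e.symm (ι x)) = 0 := congrArg Prod.snd h1
    have h4 : e.symm (ι x) = (x, η x) := Prod.ext h2 rfl
    rw [h4] at h3
    exact sub_eq_zero.1 h3
  have h0W : (0 : R × C) ∈ ι ⁻¹' e.target := by
    have : ι 0 = e 0 := by rw [hef, hf0]; rfl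
    rw [mem_preimage, this]
    exact e.map_source h0
  have hη0 : η 0 = 0 := by
    rw [hfix 0 h0W]
    exact leafPicard_of_fst_eq_zero b Φ 0 _
  -- The neighbourhood is shrunk so that the parameter and the whole path stay within radius `r`,
  -- where the integrability condition will be available.
  refine ⟨ι ⁻¹' e.target ∩ (fun x => (x, η x)) ⁻¹' Metric.ball 0 r,
    (continuousOn_id.prodMk hη.continuousOn).isOpen_inter_preimage hWo Metric.isOpen_ball,
    ⟨h0W, by simp [hη0, hr]⟩, η, hη.mono inter_subset_left, ?_⟩
  rintro x ⟨hx, hxr⟩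
  rw [mem_preimage, mem_ball_zero_iff] at hxr
  exact ⟨hfix x hx, (norm_fst_le (x, η x)).trans_lt hxr, (norm_snd_le (x, η x)).trans_lt hxr⟩

end Frobenius

section Frobenius

variable {R C A : Type u} [NormedAddCommGroup R] [NormedSpace ℝ R]
  [NormedAddCommGroup C] [NormedSpace ℝ C] [NormedAddCommGroup A] [NormedSpace ℝ A]

/-- The variation `ζ` of the path in the direction `v` solves the linearised equation. By the
integrability condition `hinv`, `τ • b (Φ) v` along the path solves it too. Both vanish at 0, so
their difference `ξ` solves a homogeneous linear equation with zero initial value, and Gronwall's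
inequality gives `ξ = 0`. At `s = 1` this says that the endpoint moves tangentially to the graph. -/
theorem fderiv_leafPicard_fixedPoint [CompleteSpace C] (b : A →L[ℝ] R →L[ℝ] C) (Φ : C(R × C, A))
    (Φ' : C(R × C, R × C →L[ℝ] A)) (hΦ : ∀ y, HasFDerivAt Φ (Φ' y) y) {r : ℝ}
    (hinv : ∀ y, ‖y‖ < r → ∀ u v, b (Φ' y (u, b (Φ y) u)) v = b (Φ' y (v, b (Φ y) v)) u)
    {η : R × C → C(unitInterval, C)} {x : R × C} (hηx : DifferentiableAt ℝ η x)
    (hfix : ∀ᶠ y in 𝓝 x, η y = leafPicard b Φ (y, η y)) (hx : ‖x‖ < r) (hηr : ‖η x‖ < r)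
    (v : R) (s : unitInterval) :
    fderiv ℝ η x (v, 0) s = (s : ℝ) • b (Φ ((s : ℝ) • x.1, η x s)) v := by
  set ζ := fderiv ℝ η x (v, 0) with hζ
  obtain ⟨L, hL, hLv⟩ := hasFDerivAt_leafPicard b Φ Φ' hΦ (x, η x)
  let h : C(unitInterval, C) := pointwiseBilin unitInterval b (Φ.comp (leafPath R C (x, η x)))
    (constMap unitInterval R v) + pointwiseBilin unitInterval b
      (pointwiseApply unitInterval (R × C) A (Φ'.comp (leafPath R C (x, η x)))
        (leafPath R C ((v, 0), ζ))) (constMap unitInterval R x.1)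
  have hζe : ζ = primitive C h := by
    have h1 : HasFDerivAt (fun y => leafPicard b Φ (y, η y))
        (L.comp ((ContinuousLinearMap.id ℝ (R × C)).prod (fderiv ℝ η x))) x :=
      HasFDerivAt.comp (g := leafPicard b Φ) x hL ((hasFDerivAt_id x).prodMk hηx.hasFDerivAt)
    have h2 : HasFDerivAt η
        (L.comp ((ContinuousLinearMap.id ℝ (R × C)).prod (fderiv ℝ η x))) x :=
      h1.congr_of_eventuallyEq hfix
    have h3 : ζ = L ((v, 0), ζ) := congrArg (fun T => T (v, 0)) h2.fderiv
    rw [hLv] at h3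
    refine h3.trans ?_
    change constMap unitInterval C 0 + primitive C h = _
    rw [map_zero, zero_add]
  let π : ℝ → unitInterval := projIcc 0 1 zero_le_one
  have hπ : ∀ τ ∈ Ico (0 : ℝ) 1, (π τ : ℝ) = τ := fun τ hτ => by
    rw [show π τ = ⟨τ, hτ.1, hτ.2.le⟩ from projIcc_of_mem _ ⟨hτ.1, hτ.2.le⟩]
  have hζd : ∀ τ ∈ Ico (0 : ℝ) 1, HasDerivWithinAt (fun τ => ζ (π τ)) (h (π τ)) (Ici τ) τ :=
    fun τ hτ => hasDerivWithinAt_of_eq_add_primitive (c := 0)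
      (fun s => by rw [zero_add, ← hζe]) hτ
  have hηd : ∀ τ ∈ Ico (0 : ℝ) 1, HasDerivWithinAt (fun τ => η x (π τ))
      (b (Φ (τ • x.1, η x (π τ))) x.1) (Ici τ) τ := fun τ hτ => by
    have := hasDerivWithinAt_of_eq_add_primitive (c := x.2) (η := η x)
      (h := pointwiseBilin unitInterval b (Φ.comp (leafPath R C (x, η x)))
        (constMap unitInterval R x.1))
      (fun s => congrArg (fun k : C(unitInterval, C) => k s) hfix.self_of_nhds) hτ
    simpa only [pointwiseBilin_apply, ContinuousMap.comp_apply, leafPath_apply, constMap_apply,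
      show (projIcc 0 1 zero_le_one τ : unitInterval) = π τ from rfl, hπ τ hτ] using this
  let ξ : ℝ → C := fun τ => ζ (π τ) - τ • b (Φ (τ • x.1, η x (π τ))) v
  have hpath : ∀ τ ∈ Ico (0 : ℝ) 1, ‖(τ • x.1, η x (π τ))‖ < r := by
    intro τ hτ
    refine (norm_prod_le_iff.2 ⟨?_, ?_⟩).trans_lt (max_lt hx hηr)
    · rw [norm_smul, Real.norm_of_nonneg hτ.1]
      exact (mul_le_of_le_one_left (norm_nonneg _) hτ.2.le).trans
        ((norm_fst_le x).trans (le_max_left _ _))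
    · exact ((η x).norm_coe_le_norm _).trans (le_max_right _ _)
  have hξd : ∀ τ ∈ Ico (0 : ℝ) 1, HasDerivWithinAt ξ
      (b (Φ' (τ • x.1, η x (π τ)) (0, ξ τ)) x.1) (Ici τ) τ := by
    intro τ hτ
    have h1 : HasDerivWithinAt (fun τ : ℝ => (τ • x.1, η x (π τ)))
        (x.1, b (Φ (τ • x.1, η x (π τ))) x.1) (Ici τ) τ := by
      have := ((hasDerivAt_id τ).smul_const x.1).hasDerivWithinAt (s := Ici τ)
      rw [one_smul] at this
      exact this.prodMk (hηd τ hτ)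
    have h2 := (hΦ (τ • x.1, η x (π τ))).comp_hasDerivWithinAt τ h1
    have h3 := (b.flip v).hasFDerivAt.comp_hasDerivWithinAt τ h2
    have h4 := (hζd τ hτ).sub ((hasDerivAt_id τ).hasDerivWithinAt.smul h3)
    refine h4.congr_deriv ?_
    -- The vector tangent to the graph is split off: on it `hinv` exchanges `v` and `x.1`,
    -- cancelling the derivative of `b (Φ) v` along the path, and only `ξ` remains.
    have h5 : (τ • v, ζ (π τ)) = τ • (v, b (Φ (τ • x.1, η x (π τ))) v) + (0, ξ τ) := by
      ext <;> simp [ξ]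
    have h6 := hinv _ (hpath τ hτ) v x.1
    simp only [h, ContinuousMap.add_apply, pointwiseBilin_apply, pointwiseApply_apply,
      ContinuousMap.comp_apply, leafPath_apply, constMap_apply, hπ τ hτ, h5, map_add, map_smul,
      add_apply, smul_apply, h6, Function.comp_apply,
      ContinuousLinearMap.flip_apply, one_smul, id_eq]
    abel
  have hcη : Continuous fun τ => η x (π τ) := (η x).continuous.comp continuous_projIcc
  have hξc : Continuous ξ := by
    have h1 : Continuous fun τ => ζ (π τ) := ζ.continuous.comp continuous_projIcc
    have h2 : Continuous fun τ : ℝ => b (Φ (τ • x.1, η x (π τ))) v :=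
      (b.flip v).continuous.comp (Φ.continuous.comp (by fun_prop))
    exact h1.sub (continuous_id.smul h2)
  obtain ⟨k, hk⟩ : ∃ k : ℝ, ∀ τ ∈ Icc (0 : ℝ) 1, ‖Φ' (τ • x.1, η x (π τ))‖ ≤ k := by
    have : Continuous fun τ : ℝ => Φ' (τ • x.1, η x (π τ)) := Φ'.continuous.comp (by fun_prop)
    exact isCompact_Icc.exists_bound_of_continuousOn this.continuousOn
  have hbound := norm_le_gronwallBound_of_norm_deriv_right_le (δ := 0) (ε := 0)
    (K := ‖b‖ * k * ‖x.1‖) hξc.continuousOn hξd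
    (by
      have h0 : π 0 = 0 := projIcc_left (zero_le_one (α := ℝ))
      simp [ξ, h0, hζe])
    (fun τ hτ => by
      have h1 := hk τ ⟨hτ.1, hτ.2.le⟩
      have h2 : ‖((0 : R), ξ τ)‖ = ‖ξ τ‖ := by simp [Prod.norm_def]
      calc _ ≤ ‖b‖ * ‖Φ' (τ • x.1, η x (π τ)) (0, ξ τ)‖ * ‖x.1‖ := b.le_opNorm₂ _ _
        _ ≤ ‖b‖ * (‖Φ' (τ • x.1, η x (π τ))‖ * ‖((0 : R), ξ τ)‖) * ‖x.1‖ := by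
          gcongr
          exact ContinuousLinearMap.le_opNorm _ _
        _ ≤ ‖b‖ * (k * ‖ξ τ‖) * ‖x.1‖ := by
          rw [h2]
          gcongr
        _ = _ := by ring)
  have hs := hbound s ⟨s.2.1, s.2.2⟩
  rw [gronwallBound_ε0_δ0, norm_le_zero_iff] at hs
  have hπs : π s = s := projIcc_val _ s
  simpa only [ξ, hπs, sub_eq_zero] using hs

/-- Superposition operators need maps defined on the whole space, so local data are first cut off by
a bump function. -/
theorem exists_contDiff_eqOn_ball {E F : Type*} [NormedAddCommGroup E] [NormedSpace ℝ E]
    [FiniteDimensional ℝ E] [NormedAddCommGroup F] [NormedSpace ℝ F] {f : E → F} {U : Set E}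
    {a : E} (hU : U ∈ 𝓝 a) (hf : ContDiffOn ℝ ∞ f U) :
    ∃ r > 0, Metric.ball a r ⊆ U ∧ ∃ g : E → F, ContDiff ℝ ∞ g ∧ EqOn g f (Metric.ball a r) := by
  obtain ⟨ε, hε, hεU⟩ := Metric.mem_nhds_iff.1 hU
  let χ : ContDiffBump a := ⟨ε / 3, ε / 2, by positivity, by linarith⟩
  refine ⟨ε / 3, by positivity, (Metric.ball_subset_ball (by linarith)).trans hεU,
    fun x => χ x • f x, contDiff_iff_contDiffAt.2 fun x => ?_, fun x hx => ?_⟩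
  · by_cases hx : x ∈ Metric.ball a ε
    · exact χ.contDiff.contDiffAt.smul
        ((hf.mono hεU).contDiffAt (Metric.isOpen_ball.mem_nhds hx))
    · have hx' : x ∈ (Metric.closedBall a (ε / 2))ᶜ := fun h =>
        hx (Metric.closedBall_subset_ball (by linarith) h)
      refine (contDiffAt_const (c := (0 : F))).congr_of_eventuallyEq ?_
      filter_upwards [Metric.isClosed_closedBall.isOpen_compl.mem_nhds hx'] with y hy
      rw [χ.zero_of_le_dist (by simpa using (lt_of_not_ge fun h => hy h).le), zero_smul]
  · change χ x • f x = f x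
    rw [χ.one_of_mem_closedBall (Metric.ball_subset_closedBall hx), one_smul]

/-- The Frobenius theorem for a distribution given as the field of graphs of `b (Φ y)`. -/
theorem exists_flattening_of_graph [FiniteDimensional ℝ R] [FiniteDimensional ℝ C]
    (b : A →L[ℝ] R →L[ℝ] C) {Φ : R × C → A} {U : Set (R × C)} (hU : IsOpen U) (h0 : 0 ∈ U)
    (hΦ : ContDiffOn ℝ ∞ Φ U)
    (hinv : ∀ y ∈ U, ∀ u v, b (fderiv ℝ Φ y (u, b (Φ y) u)) v = b (fderiv ℝ Φ y (v, b (Φ y) v)) u) :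
    ∃ e : OpenPartialHomeomorph (R × C) (R × C), 0 ∈ e.source ∧ e.source ⊆ U ∧
      ContDiffOn ℝ ∞ e e.source ∧ ContDiffOn ℝ ∞ e.symm e.target ∧
      ∀ y ∈ e.source, ∀ w, (fderiv ℝ e y w).2 = 0 ↔ w.2 = b (Φ y) w.1 := by
  obtain ⟨r, hr, hrU, g, hg, hgΦ⟩ := exists_contDiff_eqOn_ball (hU.mem_nhds h0) hΦ
  have hgd : ContDiff ℝ ∞ (fderiv ℝ g) := hg.fderiv_right (by simp)
  let Ψ : C(R × C, A) := ⟨g, hg.continuous⟩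
  let Ψ' : C(R × C, R × C →L[ℝ] A) := ⟨fderiv ℝ g, hgd.continuous⟩
  have hΨ : ∀ y, HasFDerivAt Ψ (Ψ' y) y := fun y => (hg.differentiable (by simp) y).hasFDerivAt
  have hgΦ' : ∀ y, ‖y‖ < r → fderiv ℝ Φ y = fderiv ℝ g y := fun y hy =>
    Filter.EventuallyEq.fderiv_eq ((hgΦ.symm.eventuallyEq_of_mem
      (Metric.isOpen_ball.mem_nhds (by simpa using hy))))
  have hΨinv : ∀ y, ‖y‖ < r → ∀ u v, b (Ψ' y (u, b (Ψ y) u)) v = b (Ψ' y (v, b (Ψ y) v)) u := by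
    intro y hy u v
    have hyb : y ∈ Metric.ball (0 : R × C) r := by simpa using hy
    have := hinv y (hrU hyb) u v
    rw [hgΦ' y hy, ← hgΦ hyb] at this
    exact this
  obtain ⟨W, hWo, h0W, η, hη, hηW⟩ := exists_contDiffOn_leafPicard_fixedPoint b Ψ hg hr
  have hηd : ∀ x ∈ W, DifferentiableAt ℝ η x := fun x hx =>
    (hη.contDiffAt (hWo.mem_nhds hx)).differentiableAt (by simp)
  have key : ∀ x ∈ W, ∀ v s, fderiv ℝ η x (v, 0) s = (s : ℝ) • b (Ψ ((s : ℝ) • x.1, η x s)) v :=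
    fun x hx v s => fderiv_leafPicard_fixedPoint b Ψ Ψ' hΨ hΨinv (hηd x hx)
      (by filter_upwards [hWo.mem_nhds hx] with y hy using (hηW y hy).1)
      (hηW x hx).2.1 (hηW x hx).2.2 v s
  let ev : C(unitInterval, C) →L[ℝ] C := ContinuousMap.evalCLM ℝ 1
  -- `ψ (p, q)` is the endpoint of the path that starts at `(0, q)` and lies over the segment from 0
  -- to `p`. For fixed `q` its values should sweep out the leaf through `(0, q)`; `hψv` is the
  -- tangency.
  let ψ : R × C → R × C := fun x => (x.1, ev (η x))
  have hψ : ContDiffOn ℝ ∞ ψ W := contDiffOn_fst.prodMk (ev.contDiff.comp_contDiffOn hη)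
  have hψd : ∀ x ∈ W, HasFDerivAt ψ
      ((ContinuousLinearMap.fst ℝ R C).prod (ev.comp (fderiv ℝ η x))) x := fun x hx =>
    hasFDerivAt_fst.prodMk (HasFDerivAt.comp (g := ev) x ev.hasFDerivAt (hηd x hx).hasFDerivAt)
  have hψr : ∀ x ∈ W, ψ x ∈ Metric.ball (0 : R × C) r := fun x hx => by
    rw [mem_ball_zero_iff, Prod.norm_def]
    exact max_lt ((norm_fst_le x).trans_lt (hηW x hx).2.1)
      (((η x).norm_coe_le_norm 1).trans_lt (hηW x hx).2.2)
  have hψv : ∀ x ∈ W, ∀ v, ((ContinuousLinearMap.fst ℝ R C).prod (ev.comp (fderiv ℝ η x))) (v, 0) =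
      (v, b (Ψ (ψ x)) v) := by
    intro x hx v
    refine Prod.ext rfl ?_
    have := key x hx v 1
    simpa [ψ, ev] using this
  have hη0 : ∀ q, ((0 : R), q) ∈ W → η (0, q) = constMap unitInterval C q := fun q hq => by
    rw [(hηW _ hq).1, leafPicard_of_fst_eq_zero]
  have hη0' : ∀ c, ev (fderiv ℝ η 0 (0, c)) = c := by
    intro c
    have h1 : HasFDerivAt (fun q : C => η (0, q)) ((fderiv ℝ η 0).comp
        (ContinuousLinearMap.inr ℝ R C)) 0 :=
      HasFDerivAt.comp (g := η) (0 : C) (hηd 0 h0W).hasFDerivAt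
        (ContinuousLinearMap.inr ℝ R C).hasFDerivAt
    have h2 : HasFDerivAt (fun q : C => η (0, q)) (constMap unitInterval C) 0 := by
      refine (constMap unitInterval C).hasFDerivAt.congr_of_eventuallyEq ?_
      have : (fun q : C => ((0 : R), q)) ⁻¹' W ∈ 𝓝 0 :=
        (hWo.preimage (by fun_prop)).mem_nhds h0W
      filter_upwards [this] with q hq using hη0 q hq
    have h3 := congrArg (fun T => ev (T c)) (h1.unique h2)
    simpa [ev] using h3
  have hψ0 : ψ 0 = 0 := Prod.ext rfl (by
    have : η 0 = 0 := (hη0 0 h0W).trans (map_zero _)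
    simp [ψ, this])
  -- Over `p = 0` the path is constant, so `ψ` is the identity in `q` to first order and its
  -- differential at 0 is triangular.
  let ψ' : (R × C) ≃L[ℝ] (R × C) := (ContinuousLinearEquiv.refl ℝ R).skewProd
    (ContinuousLinearEquiv.refl ℝ C) (b (Ψ 0))
  have hψ' : HasFDerivAt ψ (ψ' : R × C →L[ℝ] R × C) 0 := by
    refine (hψd 0 h0W).congr_fderiv (ContinuousLinearMap.ext fun w => ?_)
    have h1 : w = (w.1, 0) + (0, w.2) := by simp
    conv_lhs => rw [h1, map_add, hψv 0 h0W, hψ0]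
    refine Prod.ext ?_ ?_
    · simp [ψ']
    · simp [ψ', hη0', add_comm]
  obtain ⟨e, h0e, heW, heψ, hes, hinvt⟩ :=
    exists_openPartialHomeomorph_of_contDiffOn hWo hψ h0W hψ'
  have heC : ContDiffOn ℝ ∞ e e.source := (hψ.mono heW).congr fun x _ => heψ x
  -- `ψ` parametrises the leaves by horizontal slices; the flattening map is its inverse.
  refine ⟨e.symm, ?_, ?_, hes, by simpa using heC, ?_⟩
  · have := e.map_source h0e
    rwa [heψ, hψ0] at this
  · intro y hy
    have hx := heW (e.map_target hy)
    apply hrU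
    rw [← e.right_inv hy, heψ]
    exact hψr _ hx
  · intro y hy w
    have hyt : y ∈ e.target := hy
    have hx := heW (e.map_target hyt)
    have hψy : ψ (e.symm y) = y := by rw [← heψ, e.right_inv hyt]
    have hyb : y ∈ Metric.ball (0 : R × C) r := by
      rw [← hψy]
      exact hψr _ hx
    obtain ⟨T, hT⟩ := hinvt _ (e.map_target hyt)
    have hTs : HasFDerivAt e.symm (T.symm : R × C →L[ℝ] R × C) y :=
      e.hasFDerivAt_symm hyt (hT.congr_of_eventuallyEq (.of_forall heψ))
    have hTv : ∀ v, T (v, 0) = (v, b (Φ y) v) := fun v => by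
      have h1 := congrArg (fun S => S (v, 0)) ((hψd _ hx).unique hT)
      rw [← hgΦ hyb]
      refine h1.symm.trans ((hψv _ hx v).trans ?_)
      rw [hψy]
      rfl
    rw [hTs.fderiv]
    change (T.symm w).2 = 0 ↔ _
    constructor
    · intro h
      have h1 : T.symm w = ((T.symm w).1, 0) := Prod.ext rfl h
      have h2 : w = T ((T.symm w).1, 0) := by rw [← h1, T.apply_symm_apply]
      rw [hTv] at h2
      rw [h2]
    · intro h
      have h1 : w = T (w.1, 0) := by
        rw [hTv]
        exact Prod.ext rfl h
      rw [h1, T.symm_apply_apply]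

end Frobenius

/-! ### The Frobenius theorem for involutive distributions on a vector space -/

section Frobenius

variable {E : Type u} [NormedAddCommGroup E] [NormedSpace ℝ E] [FiniteDimensional ℝ E]

/-- A distribution of constant rank with a smooth frame is locally a smooth field of graphs over
its value at a point. -/
theorem exists_graph_of_frame {D : E → Submodule ℝ E} {U : Set E} (hU : IsOpen U) {a : E}
    (ha : a ∈ U) (hrank : ∀ y ∈ U, Module.finrank ℝ (D y) = Module.finrank ℝ (D a))
    {S : E → D a →L[ℝ] E} (hS : ContDiffOn ℝ ∞ S U) (hSa : ∀ u, S a u = u)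
    (hSD : ∀ y ∈ U, ∀ u, S y u ∈ D y) {C : Submodule ℝ E} {P : E →L[ℝ] D a} {Q : E →L[ℝ] C}
    (hPQ : ∀ w, (P w : E) + Q w = w) (hPu : ∀ u : D a, P u = u) (hQu : ∀ u : D a, Q u = 0)
    (hPC : ∀ c : C, P c = 0) (hQC : ∀ c : C, Q c = c) :
    ∃ V ⊆ U, IsOpen V ∧ a ∈ V ∧ ∃ Φ : E → D a →L[ℝ] C, ContDiffOn ℝ ∞ Φ V ∧
      ∀ y ∈ V, ∀ w, w ∈ D y ↔ Q w = Φ y (P w) := by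
  have hM : ContDiffOn ℝ ∞ (fun y => P.comp (S y)) U :=
    contDiffOn_const.clm_comp hS
  have hMa : P.comp (S a) = ContinuousLinearMap.id ℝ (D a) := by
    ext u
    simp [hSa, hPu]
  -- Where `P ∘ S y` is invertible the frame can be reparametrised by its `P` component, and its `Q`
  -- component then becomes the function whose graph is `D y`.
  let V := U ∩ (fun y => P.comp (S y)) ⁻¹'
    range ((↑) : (D a ≃L[ℝ] D a) → D a →L[ℝ] D a)
  refine ⟨V, inter_subset_left, hM.continuousOn.isOpen_inter_preimage hU
    ContinuousLinearEquiv.isOpen, ⟨ha, ContinuousLinearEquiv.refl ℝ _, hMa.symm⟩,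
    fun y => (Q.comp (S y)).comp (P.comp (S y)).inverse, ?_, ?_⟩
  · intro y hy
    obtain ⟨T, hT : (T : D a →L[ℝ] D a) = P.comp (S y)⟩ := hy.2
    have h1 : ContDiffAt ℝ ∞ (fun y => P.comp (S y)) y := hM.contDiffAt (hU.mem_nhds hy.1)
    have h2 : ContDiffAt ℝ ∞ ContinuousLinearMap.inverse (P.comp (S y)) := by
      rw [← hT]
      exact contDiffAt_map_inverse (𝕜 := ℝ) (E := D a) (F := D a) T
    exact (((contDiffAt_const (c := Q)).clm_comp (hS.contDiffAt (hU.mem_nhds hy.1))).clm_comp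
      (h2.comp y h1)).contDiffWithinAt
  · intro y hy w
    obtain ⟨T, hT : (T : D a →L[ℝ] D a) = P.comp (S y)⟩ := hy.2
    have hT' : ∀ u, P (S y u) = T u := fun u => (congrArg (fun A => A u) hT).symm
    have hinv : (P.comp (S y)).inverse = T.symm := by
      rw [← hT, ContinuousLinearMap.inverse_equiv]
    simp only [hinv]
    have hmem : ∀ u : D a, (u : E) + Q (S y (T.symm u)) ∈ D y := fun u => by
      have h1 := hPQ (S y (T.symm u))
      rw [hT', T.apply_symm_apply] at h1
      rw [h1]
      exact hSD y hy.1 _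
    -- The graph lies in `D y` and has the dimension of `D a`; constancy of the rank makes the
    -- inclusion an equality.
    let γ : D a →ₗ[ℝ] E := (D a).subtype + C.subtype ∘ₗ (Q : E →ₗ[ℝ] C) ∘ₗ
      (S y : D a →ₗ[ℝ] E) ∘ₗ (T.symm : D a →ₗ[ℝ] D a)
    have hγ : ∀ u, γ u = (u : E) + Q (S y (T.symm u)) := fun u => rfl
    have hPγ : ∀ u, P (γ u) = u := fun u => by rw [hγ, map_add, hPu, hPC, add_zero]
    have hQγ : ∀ u, Q (γ u) = Q (S y (T.symm u)) := fun u => by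
      rw [hγ, map_add, hQu, hQC, zero_add]
    have hγD : γ.range = D y := by
      refine Submodule.eq_of_le_of_finrank_eq ?_ ?_
      · rintro _ ⟨u, rfl⟩
        exact hmem u
      · rw [hrank y hy.1]
        exact LinearMap.finrank_range_of_inj (Function.LeftInverse.injective hPγ)
    rw [← hγD]
    constructor
    · rintro ⟨u, rfl⟩
      rw [hPγ, hQγ]
      rfl
    · intro h
      refine ⟨P w, ?_⟩
      rw [hγ, ← hPQ w, hPQ w]
      have h' : Q w = Q (S y (T.symm (P w))) := h
      rw [← h', hPQ]

/-- Near `a` the distribution is a graph over `D a` with values in a complement `C`. The frame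
fields `u + Φ u` have constant component along `D a`, so their brackets lie in `C`; by involutivity
they also lie in `D`, hence vanish. This vanishing is the integrability condition for graphs. -/
theorem exists_flattening_of_involutive {D : E → Submodule ℝ E} {U : Set E} (hU : IsOpen U) {a : E}
    (ha : a ∈ U) (hrank : ∀ y ∈ U, Module.finrank ℝ (D y) = Module.finrank ℝ (D a))
    {S : E → D a →L[ℝ] E} (hS : ContDiffOn ℝ ∞ S U) (hSa : ∀ u, S a u = u)
    (hSD : ∀ y ∈ U, ∀ u, S y u ∈ D y)
    (hinv : ∀ y ∈ U, ∀ X Y : E → E, ContDiffAt ℝ ∞ X y → ContDiffAt ℝ ∞ Y y →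
      (∀ᶠ z in 𝓝 y, X z ∈ D z) → (∀ᶠ z in 𝓝 y, Y z ∈ D z) →
      VectorField.lieBracket ℝ X Y y ∈ D y) :
    ∃ e : OpenPartialHomeomorph E E, a ∈ e.source ∧ e.source ⊆ U ∧
      ContDiffOn ℝ ∞ e e.source ∧ ContDiffOn ℝ ∞ e.symm e.target ∧
      ∀ y ∈ e.source, ∀ v, v ∈ D y ↔ fderiv ℝ e y v ∈ D a := by
  obtain ⟨C, hC⟩ := (D a).exists_isCompl
  let T : E ≃L[ℝ] D a × C := ((D a).prodEquivOfIsCompl C hC).symm.toContinuousLinearEquiv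
  have hTs : ∀ w : D a × C, T.symm w = (w.1 : E) + w.2 := fun w => rfl
  let P : E →L[ℝ] D a := (ContinuousLinearMap.fst ℝ (D a) C).comp (T : E →L[ℝ] D a × C)
  let Q : E →L[ℝ] C := (ContinuousLinearMap.snd ℝ (D a) C).comp (T : E →L[ℝ] D a × C)
  have hTPQ : ∀ w, T w = (P w, Q w) := fun w => rfl
  have hTu : ∀ u : D a, T u = (u, 0) := fun u => by
    rw [← T.symm_apply_eq.1 (show T.symm (u, (0 : C)) = u by simp [hTs])]
  have hTc : ∀ c : C, T c = (0, c) := fun c => by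
    rw [← T.symm_apply_eq.1 (show T.symm ((0 : D a), c) = c by simp [hTs])]
  have hPQ : ∀ w, (P w : E) + Q w = w := fun w => by
    rw [← hTs (P w, Q w), ← hTPQ, T.symm_apply_apply]
  obtain ⟨V, hVU, hVo, haV, Φ, hΦ, hΦD⟩ := exists_graph_of_frame hU ha hrank hS hSa hSD hPQ
    (fun u => congrArg Prod.fst (hTu u)) (fun u => congrArg Prod.snd (hTu u))
    (fun c => congrArg Prod.fst (hTc c)) (fun c => congrArg Prod.snd (hTc c))
  have hΦd : ∀ y ∈ V, HasFDerivAt Φ (fderiv ℝ Φ y) y := fun y hy =>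
    ((hΦ.contDiffAt (hVo.mem_nhds hy)).differentiableAt (by simp)).hasFDerivAt
  -- the local frame fields `u + Φ u`
  let X : D a → E → E := fun u y => u + Φ y u
  have hXD : ∀ u, ∀ y ∈ V, X u y ∈ D y := fun u y hy => by
    rw [hΦD y hy]
    have h1 : T (X u y) = (u, Φ y u) := by
      simp only [X]
      rw [map_add, hTu, hTc]
      simp
    have h2 := hTPQ (X u y)
    rw [h1] at h2
    rw [Prod.mk.injEq] at h2
    rw [← h2.1, ← h2.2]
  have hXs : ∀ u, ∀ y ∈ V, ContDiffAt ℝ ∞ (X u) y := fun u y hy => by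
    have h1 : ContDiffAt ℝ ∞ (fun y => Φ y u) y :=
      (hΦ.contDiffAt (hVo.mem_nhds hy)).clm_apply contDiffAt_const
    exact contDiffAt_const.add (C.subtypeL.contDiff.contDiffAt.comp y h1)
  have hXd : ∀ u, ∀ y ∈ V, ∀ w, fderiv ℝ (X u) y w = fderiv ℝ Φ y w u := fun u y hy w => by
    have h1 : HasFDerivAt (fun y => Φ y u) ((fderiv ℝ Φ y).flip u) y := by
      have := (hΦd y hy).clm_apply (hasFDerivAt_const u y)
      refine this.congr_fderiv ?_
      ext
      simp
    have h2 : HasFDerivAt (X u) (C.subtypeL.comp ((fderiv ℝ Φ y).flip u)) y :=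
      (C.subtypeL.hasFDerivAt.comp y h1).const_add (u : E)
    rw [h2.fderiv]
    rfl
  have hsymm : ∀ y ∈ V, ∀ u v, fderiv ℝ Φ y (X u y) v = fderiv ℝ Φ y (X v y) u := by
    intro y hy u v
    have h1 := hinv y (hVU hy) (X u) (X v) (hXs u y hy) (hXs v y hy)
      (by filter_upwards [hVo.mem_nhds hy] with z hz using hXD u z hz)
      (by filter_upwards [hVo.mem_nhds hy] with z hz using hXD v z hz)
    change fderiv ℝ (X v) y (X u y) - fderiv ℝ (X u) y (X v y) ∈ D y at h1
    rw [hXd _ _ hy, hXd _ _ hy, ← Submodule.coe_sub, hΦD y hy] at h1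
    have h2 := hTc (fderiv ℝ Φ y (X u y) v - fderiv ℝ Φ y (X v y) u)
    rw [hTPQ, Prod.mk.injEq] at h2
    rw [h2.1, h2.2, map_zero, sub_eq_zero] at h1
    exact h1
  let h : E ≃ₜ D a × C := (Homeomorph.subRight a).trans T.toHomeomorph
  have hh : ∀ y, h y = T (y - a) := fun y => rfl
  have hhs : ∀ z, h.symm z = T.symm z + a := fun z => rfl
  have hhs' : ContDiff ℝ ∞ h.symm := T.symm.contDiff.add contDiff_const
  have hh' : ContDiff ℝ ∞ h := T.contDiff.comp (contDiff_id.sub contDiff_const)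
  have hhd : ∀ y, HasFDerivAt h (T : E →L[ℝ] D a × C) y := fun y =>
    T.hasFDerivAt.comp y ((hasFDerivAt_id y).sub_const a)
  have hhsd : ∀ z, HasFDerivAt h.symm (T.symm : D a × C →L[ℝ] E) z := fun z =>
    T.symm.hasFDerivAt.add_const a
  have hΨd : ∀ z ∈ h.symm ⁻¹' V, HasFDerivAt (Φ ∘ h.symm)
      ((fderiv ℝ Φ (h.symm z)).comp (T.symm : D a × C →L[ℝ] E)) z := fun z hz =>
    HasFDerivAt.comp (g := Φ) z (hΦd _ hz) (hhsd z)
  obtain ⟨e, h0e, heV, hes, hest, heD⟩ := exists_flattening_of_graph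
    (ContinuousLinearMap.id ℝ (D a →L[ℝ] C)) (Φ := Φ ∘ h.symm) (U := h.symm ⁻¹' V)
    (hVo.preimage h.symm.continuous) (by simpa [hhs] using haV)
    (hΦ.comp hhs'.contDiffOn fun _ hz => hz)
    (by
      intro z hz u v
      rw [(hΨd z hz).fderiv]
      exact hsymm _ hz u v)
  -- The splitting is undone after flattening, so that the chart takes values in `E` and the fixed
  -- subspace is `D a` itself.
  refine ⟨(h.transOpenPartialHomeomorph e).transHomeomorph T.symm.toHomeomorph, ?_, ?_, ?_, ?_, ?_⟩
  · change h a ∈ e.source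
    rw [hh, sub_self, map_zero]
    exact h0e
  · intro y hy
    have := heV (show h y ∈ e.source from hy)
    rw [mem_preimage, h.symm_apply_apply] at this
    exact hVU this
  · exact T.symm.contDiff.comp_contDiffOn (hes.comp hh'.contDiffOn fun _ hy => hy)
  · exact hhs'.comp_contDiffOn (hest.comp T.contDiff.contDiffOn fun _ hy => hy)
  · intro y hy v
    have hy' : h y ∈ e.source := hy
    have hyV : y ∈ V := by
      have := heV hy'
      rwa [mem_preimage, h.symm_apply_apply] at this
    have hed : HasFDerivAt e (fderiv ℝ e (h y)) (h y) :=
      ((hes.contDiffAt (e.open_source.mem_nhds hy')).differentiableAt (by simp)).hasFDerivAt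
    have h1 : HasFDerivAt ((h.transOpenPartialHomeomorph e).transHomeomorph T.symm.toHomeomorph)
        ((T.symm : D a × C →L[ℝ] E).comp ((fderiv ℝ e (h y)).comp (T : E →L[ℝ] D a × C))) y :=
      T.symm.hasFDerivAt.comp y (hed.comp y (hhd y))
    have h2 := heD _ hy' (T v)
    rw [Function.comp_apply, h.symm_apply_apply] at h2
    rw [h1.fderiv, hΦD y hyV]
    refine Iff.trans h2.symm ?_
    change _ ↔ T.symm (fderiv ℝ e (h y) (T v)) ∈ D a
    set w := fderiv ℝ e (h y) (T v)
    constructor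
    · intro hw
      rw [hTs, hw]
      simp
    · intro hw
      have h3 := hTu ⟨_, hw⟩
      rw [T.apply_symm_apply] at h3
      rw [h3]

end Frobenius

/-! ### Images of maps of non-maximal constant rank -/

section ConstantRank

variable {V E : Type*} [NormedAddCommGroup V] [NormedSpace ℝ V] [FiniteDimensional ℝ V]
  [NormedAddCommGroup E] [NormedSpace ℝ E] [FiniteDimensional ℝ E]

/-- On the ball `g` depends only on the `R` coordinate, so its image lies in the image of `e ↦ g (P
e, z.2)`, a map from `E` to itself. The differential of that map kills the nonzero kernel of `P`,
and a map with zero Jacobian has an image of measure zero. -/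
theorem image_notMem_nhds_of_linear_fst {R K : Type*} [NormedAddCommGroup R] [NormedSpace ℝ R]
    [NormedAddCommGroup K] [NormedSpace ℝ K] {g : R × K → E} {z : R × K} {ε : ℝ}
    (hg : DifferentiableOn ℝ g (Metric.ball z ε))
    (hgK : ∀ w ∈ Metric.ball z ε, ∀ k, fderiv ℝ g w (0, k) = 0) (P : E →L[ℝ] R)
    (hPs : Function.Surjective P)
    (hP : LinearMap.ker (P : E →ₗ[ℝ] R) ≠ ⊥) (x : E) : g '' Metric.ball z ε ∉ 𝓝 x := by
  intro hmem
  have hgd : ∀ w ∈ Metric.ball z ε, HasFDerivAt g (fderiv ℝ g w) w := fun w hw =>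
    ((hg w hw).differentiableAt (Metric.isOpen_ball.mem_nhds hw)).hasFDerivAt
  have hprod : Metric.ball z ε = Metric.ball z.1 ε ×ˢ Metric.ball z.2 ε :=
    (ball_prod_same z.1 z.2 ε).symm
  have hslice : ∀ u ∈ Metric.ball z.1 ε, ∀ k ∈ Metric.ball z.2 ε, g (u, k) = g (u, z.2) := by
    intro u hu k hk
    have hd : ∀ k' ∈ Metric.ball z.2 ε, HasFDerivAt (fun k => g (u, k)) (0 : K →L[ℝ] E) k' := by
      intro k' hk'
      have hw : (u, k') ∈ Metric.ball z ε := hprod ▸ ⟨hu, hk'⟩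
      have h1 : HasFDerivAt (fun k : K => (u, k)) (ContinuousLinearMap.inr ℝ R K) k' :=
        (hasFDerivAt_const u k').prodMk (hasFDerivAt_id k')
      refine ((hgd _ hw).comp k' h1).congr_fderiv ?_
      ext v
      exact hgK _ hw v
    exact Metric.isOpen_ball.is_const_of_fderiv_eq_zero (convex_ball z.2 ε).isPreconnected
      (fun k' hk' => (hd k' hk').differentiableAt.differentiableWithinAt)
      (fun k' hk' => (hd k' hk').fderiv) hk (Metric.mem_ball_self (Metric.pos_of_mem_ball hk))
  have hsub : g '' Metric.ball z ε ⊆ (fun e => g (P e, z.2)) '' (P ⁻¹' Metric.ball z.1 ε) := by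
    rintro _ ⟨w, hw, rfl⟩
    obtain ⟨e, he⟩ := hPs w.1
    rw [hprod] at hw
    refine ⟨e, by rw [mem_preimage, he]; exact hw.1, ?_⟩
    change g (P e, z.2) = g w
    rw [he, ← hslice w.1 hw.1 w.2 hw.2]
  let _ : MeasurableSpace E := borel E
  have : BorelSpace E := ⟨rfl⟩
  let μ : MeasureTheory.Measure E := MeasureTheory.Measure.addHaar
  have hzero : μ ((fun e => g (P e, z.2)) '' (P ⁻¹' Metric.ball z.1 ε)) = 0 := by
    refine MeasureTheory.addHaar_image_eq_zero_of_det_fderivWithin_eq_zero μ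
      (f' := fun e => ((fderiv ℝ g (P e, z.2)).comp (ContinuousLinearMap.inl ℝ R K)).comp P)
      (fun e he => ?_) (fun e _ => ?_)
    · have hw : (P e, z.2) ∈ Metric.ball z ε :=
        hprod ▸ ⟨he, Metric.mem_ball_self (Metric.pos_of_mem_ball he)⟩
      have h1 : HasFDerivAt (fun u : R => (u, z.2)) (ContinuousLinearMap.inl ℝ R K) (P e) :=
        (hasFDerivAt_id (P e)).prodMk (hasFDerivAt_const z.2 (P e))
      exact (HasFDerivAt.comp (g := fun u => g (u, z.2)) e
        (HasFDerivAt.comp (g := g) (P e) (hgd _ hw) h1) P.hasFDerivAt).hasFDerivWithinAt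
    · refine LinearMap.det_eq_zero_iff_ker_ne_bot.2 fun h => hP (le_bot_iff.1 ?_)
      rw [← h]
      intro v hv
      have hv' : P v = 0 := hv
      change fderiv ℝ g (P e, z.2) (P v, 0) = 0
      rw [hv']
      exact map_zero _
  exact (MeasureTheory.Measure.measure_pos_of_mem_nhds μ hmem).ne'
    (MeasureTheory.measure_mono_null hsub hzero)

/-- A smooth map whose rank is maximal at a point, but not full, maps some neighbourhood of the
point onto a set which is not a neighbourhood of its image. -/
theorem exists_image_notMem_nhds_of_rank_le {f : V → E} {U : Set V} (hU : IsOpen U)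
    (hf : ContDiffOn ℝ ∞ f U) {a : V} (ha : a ∈ U)
    (hrank : ∀ y ∈ U, Module.finrank ℝ (LinearMap.range (fderiv ℝ f y : V →ₗ[ℝ] E)) ≤
      Module.finrank ℝ (LinearMap.range (fderiv ℝ f a : V →ₗ[ℝ] E)))
    (hns : LinearMap.range (fderiv ℝ f a : V →ₗ[ℝ] E) ≠ ⊤) :
    ∃ N ∈ 𝓝 a, f '' N ∉ 𝓝 (f a) := by
  set f' : V →ₗ[ℝ] E := (fderiv ℝ f a : V →ₗ[ℝ] E) with hf'
  set R := LinearMap.range f' with hR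
  set K := LinearMap.ker f'
  obtain ⟨p, hp⟩ := R.subtype.exists_leftInverse_of_injective R.ker_subtype
  obtain ⟨κ, hκ⟩ := K.subtype.exists_leftInverse_of_injective K.ker_subtype
  have hp' : ∀ u : R, p u = u := fun u => congrArg (fun T => T u) hp
  have hκ' : ∀ u : K, κ u = u := fun u => congrArg (fun T => T u) hκ
  let P : E →L[ℝ] R := LinearMap.toContinuousLinearMap p
  let κc : V →L[ℝ] K := LinearMap.toContinuousLinearMap κ
  have hfd : ∀ y ∈ U, HasFDerivAt f (fderiv ℝ f y) y := fun y hy =>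
    ((hf.contDiffAt (hU.mem_nhds hy)).differentiableAt (by simp)).hasFDerivAt
  -- The coordinates are the projection of `f` to the range of its differential at `a` and the
  -- component along the kernel; together they form a local diffeomorphism.
  let h : V → R × K := fun y => (P (f y), κc y)
  have hh : ContDiffOn ℝ ∞ h U :=
    (P.contDiff.comp_contDiffOn hf).prodMk κc.contDiff.contDiffOn
  have hhd : ∀ y ∈ U, HasFDerivAt h ((P.comp (fderiv ℝ f y)).prod κc) y := fun y hy =>
    (HasFDerivAt.comp (g := P) y P.hasFDerivAt (hfd y hy)).prodMk κc.hasFDerivAt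
  have hinj : Function.Injective ((P.comp (fderiv ℝ f a)).prod κc : V →ₗ[ℝ] R × K) := by
    rw [← LinearMap.ker_eq_bot, LinearMap.ker_eq_bot']
    intro v hv
    have h1 : p (f' v) = 0 := congrArg Prod.fst hv
    have h2 : κ v = 0 := congrArg Prod.snd hv
    have h3 := hp' ⟨f' v, v, rfl⟩
    rw [h1] at h3
    have h4 : f' v = 0 := (congrArg Subtype.val h3).symm
    have h5 := hκ' ⟨v, h4⟩
    rw [h2] at h5
    exact (congrArg Subtype.val h5).symm
  have hdim : Module.finrank ℝ V = Module.finrank ℝ (R × K) := by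
    rw [Module.finrank_prod, LinearMap.finrank_range_add_finrank_ker]
  let T : V ≃L[ℝ] R × K := (LinearMap.linearEquivOfInjective _ hinj hdim).toContinuousLinearEquiv
  have hT : HasFDerivAt h (T : V →L[ℝ] R × K) a := by
    refine (hhd a ha).congr_fderiv (ContinuousLinearMap.ext fun v => ?_)
    exact (LinearMap.linearEquivOfInjective_apply hinj hdim v).symm
  obtain ⟨e, hae, heU, heh, hes, -⟩ := exists_openPartialHomeomorph_of_contDiffOn hU hh ha hT
  obtain ⟨ε, hε, hball⟩ := Metric.isOpen_iff.1 e.open_target (h a)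
    (by rw [← heh]; exact e.map_source hae)
  let g : R × K → E := fun w => f (e.symm w)
  have hg : ContDiffOn ℝ ∞ g e.target :=
    hf.comp hes fun w hw => heU (e.map_target hw)
  have hgd : ∀ w ∈ e.target, HasFDerivAt g
      ((fderiv ℝ f (e.symm w)).comp (fderiv ℝ e.symm w)) w := fun w hw =>
    HasFDerivAt.comp (g := f) w (hfd _ (heU (e.map_target hw)))
      ((hes.contDiffAt (e.open_target.mem_nhds hw)).differentiableAt (by simp)).hasFDerivAt
  have hPg : ∀ w ∈ e.target, P (g w) = w.1 := fun w hw => by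
    have h1 : h (e.symm w) = w := by rw [← heh, e.right_inv hw]
    exact congrArg Prod.fst h1
  have hPgd : ∀ w ∈ e.target, ∀ v, P (fderiv ℝ g w v) = v.1 := fun w hw v => by
    have h1 : HasFDerivAt (fun w => P (g w)) (P.comp (fderiv ℝ g w)) w :=
      HasFDerivAt.comp (g := P) w P.hasFDerivAt (hgd w hw).differentiableAt.hasFDerivAt
    have h2 : HasFDerivAt (fun w => P (g w)) (ContinuousLinearMap.fst ℝ R K) w :=
      hasFDerivAt_fst.congr_of_eventuallyEq (by
        filter_upwards [e.open_target.mem_nhds hw] with w hw using hPg w hw)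
    exact congrArg (fun S => S v) (h1.unique h2)
  -- The range of the differential projects onto `R` and has at most its dimension, so the
  -- projection is injective on it. A derivative along `K` projects to 0 and therefore vanishes.
  have hgK : ∀ w ∈ e.target, ∀ k, fderiv ℝ g w (0, k) = 0 := by
    intro w hw k
    set S := LinearMap.range (fderiv ℝ f (e.symm w) : V →ₗ[ℝ] E)
    have hmem : ∀ v, fderiv ℝ g w v ∈ S := fun v => by
      rw [(hgd w hw).fderiv]
      exact ⟨_, rfl⟩
    have hsurj : Function.Surjective (p.domRestrict S) := fun u =>
      ⟨⟨_, hmem (u, 0)⟩, hPgd w hw (u, 0)⟩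
    have hle : Module.finrank ℝ S ≤ Module.finrank ℝ R := hrank _ (heU (e.map_target hw))
    have heq : Module.finrank ℝ S = Module.finrank ℝ R :=
      le_antisymm hle (LinearMap.finrank_le_finrank_of_surjective hsurj)
    have hinj' := (LinearMap.injective_iff_surjective_of_finrank_eq_finrank heq).2 hsurj
    have h0 : p.domRestrict S ⟨_, hmem (0, k)⟩ = p.domRestrict S 0 := by
      rw [map_zero]
      exact hPgd w hw (0, k)
    exact congrArg Subtype.val (hinj' h0)
  refine ⟨e.source ∩ h ⁻¹' Metric.ball (h a) ε, ?_, fun hmem => ?_⟩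
  · have hc : ContinuousAt h a := (hhd a ha).continuousAt
    exact inter_mem (e.open_source.mem_nhds hae) (hc (Metric.ball_mem_nhds _ hε))
  · refine image_notMem_nhds_of_linear_fst (g := g) (z := h a) (ε := ε)
      ((hg.mono hball).differentiableOn (by simp)) (fun w hw => hgK w (hball hw)) P
      (fun u => ⟨u, hp' u⟩) ?_ (f a) (mem_of_superset hmem ?_)
    · intro hker
      apply hns
      rw [eq_top_iff]
      intro x _
      have h1 : x - (p x : E) ∈ LinearMap.ker (P : E →ₗ[ℝ] R) := by
        change p (x - (p x : E)) = 0
        rw [map_sub, hp', sub_self]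
      rw [hker, Submodule.mem_bot, sub_eq_zero] at h1
      rw [h1]
      exact (p x).2
    · rintro _ ⟨y, ⟨hy, hyb⟩, rfl⟩
      refine ⟨h y, hyb, ?_⟩
      change f (e.symm (h y)) = f y
      rw [← heh, e.left_inv hy]

end ConstantRank

open Bundle

/-! ### Lie brackets on manifolds as commutators of derivations -/

section ManifoldBracket

variable {E : Type*} [NormedAddCommGroup E] [NormedSpace ℝ E]
  {F : Type*} [NormedAddCommGroup F] [NormedSpace ℝ F]
  {M : Type*} [TopologicalSpace M] [ChartedSpace E M] [IsManifold 𝓘(ℝ, E) ∞ M]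

/-- The derivative of a vector-valued function along a vector field. -/
noncomputable def derivAlong (g : M → F) (X : ∀ x : M, TangentSpace 𝓘(ℝ, E) x) : M → F :=
  fun y => mfderiv 𝓘(ℝ, E) 𝓘(ℝ, F) g y (X y)

/-- Differentiability of a vector field at a point. -/
abbrev FieldDiffAt (X : ∀ x : M, TangentSpace 𝓘(ℝ, E) x) (x : M) : Prop :=
  MDifferentiableAt 𝓘(ℝ, E) 𝓘(ℝ, E).tangent
    (fun x => (⟨x, X x⟩ : TangentBundle 𝓘(ℝ, E) M)) x

/-- The coordinate expression of a vector field in the preferred chart at a point. -/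
noncomputable def chartField (x : M) (X : ∀ x : M, TangentSpace 𝓘(ℝ, E) x) : E → E :=
  VectorField.mpullbackWithin 𝓘(ℝ, E) 𝓘(ℝ, E) (extChartAt 𝓘(ℝ, E) x).symm X
    (range 𝓘(ℝ, E))

theorem FieldDiffAt.differentiableAt_chartField [CompleteSpace E] {X : ∀ x : M, TangentSpace 𝓘(ℝ, E) x} {x : M}
    (hX : FieldDiffAt X x) :
    DifferentiableAt ℝ (chartField x X) (extChartAt 𝓘(ℝ, E) x x) := by
  have h1 := MDifferentiableWithinAt.differentiableWithinAt_mpullbackWithin_vectorField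
    (mdifferentiableWithinAt_univ.2 hX)
  have h2 : (extChartAt 𝓘(ℝ, E) x).symm ⁻¹' univ ∩ range 𝓘(ℝ, E) = univ := by simp
  rw [h2] at h1
  exact differentiableWithinAt_univ.1 h1

theorem mfderiv_extChartAt_mlieBracket (X Y : ∀ x : M, TangentSpace 𝓘(ℝ, E) x) (x : M) :
    (mfderiv 𝓘(ℝ, E) 𝓘(ℝ, E) (extChartAt 𝓘(ℝ, E) x) x
      (VectorField.mlieBracket 𝓘(ℝ, E) X Y x) : E) =
      VectorField.lieBracket ℝ (chartField x X) (chartField x Y) (extChartAt 𝓘(ℝ, E) x x) := by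
  have h1 := VectorField.mlieBracketWithin_apply (I := 𝓘(ℝ, E)) (V := X) (W := Y) (s := univ)
    (x₀ := x)
  have h2 : (extChartAt 𝓘(ℝ, E) x).symm ⁻¹' univ ∩ range 𝓘(ℝ, E) = univ := by simp
  rw [VectorField.mlieBracketWithin_univ, h2] at h1
  have h3 := congrFun (VectorField.lieBracketWithin_univ (𝕜 := ℝ) (V := chartField x X)
    (W := chartField x Y)) (extChartAt 𝓘(ℝ, E) x x)
  rw [h1, ← h3]
  exact (isInvertible_mfderiv_extChartAt (mem_extChartAt_source x)).self_apply_inverse _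

theorem mfderiv_comp_extChartAt_symm {g : M → F} {x : M} {y : E}
    (hy : y ∈ (extChartAt 𝓘(ℝ, E) x).target)
    (hg : MDifferentiableAt 𝓘(ℝ, E) 𝓘(ℝ, F) g ((extChartAt 𝓘(ℝ, E) x).symm y))
    (X : ∀ x : M, TangentSpace 𝓘(ℝ, E) x) :
    fderiv ℝ (g ∘ (extChartAt 𝓘(ℝ, E) x).symm) y (chartField x X y) =
      derivAlong g X ((extChartAt 𝓘(ℝ, E) x).symm y) := by
  have h1 := isInvertible_mfderivWithin_extChartAt_symm (I := 𝓘(ℝ, E)) hy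
  have h2 := (mdifferentiableWithinAt_extChartAt_symm (I := 𝓘(ℝ, E)) hy)
  rw [ModelWithCorners.range_eq_univ, mdifferentiableWithinAt_univ] at h2
  rw [ModelWithCorners.range_eq_univ, mfderivWithin_univ] at h1
  have h3 := mfderiv_comp y hg h2
  rw [mfderiv_eq_fderiv] at h3
  rw [h3]
  simp only [derivAlong, chartField, VectorField.mpullbackWithin,
    ModelWithCorners.range_eq_univ, mfderivWithin_univ]
  exact congrArg _ (h1.self_apply_inverse _)

theorem chartField_apply {x : M} {y : E} (hy : y ∈ (extChartAt 𝓘(ℝ, E) x).target)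
    (X : ∀ x : M, TangentSpace 𝓘(ℝ, E) x) :
    chartField x X y = derivAlong (extChartAt 𝓘(ℝ, E) x) X ((extChartAt 𝓘(ℝ, E) x).symm y) := by
  have hsrc := (extChartAt 𝓘(ℝ, E) x).map_target hy
  rw [extChartAt_source] at hsrc
  rw [← mfderiv_comp_extChartAt_symm hy (mdifferentiableAt_extChartAt hsrc) X]
  have h1 : extChartAt 𝓘(ℝ, E) x ∘ (extChartAt 𝓘(ℝ, E) x).symm =ᶠ[𝓝 y] id := by
    filter_upwards [(isOpen_extChartAt_target x).mem_nhds hy] with z hz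
      using (extChartAt 𝓘(ℝ, E) x).right_inv hz
  rw [h1.fderiv_eq, fderiv_id]
  rfl

theorem chartField_apply_self (x : M) (X : ∀ x : M, TangentSpace 𝓘(ℝ, E) x) :
    chartField x X (extChartAt 𝓘(ℝ, E) x x) = derivAlong (extChartAt 𝓘(ℝ, E) x) X x := by
  rw [chartField_apply (mem_extChartAt_target x), extChartAt_to_inv]

omit [IsManifold 𝓘(ℝ, E) ∞ M] in
theorem contDiffAt_comp_extChartAt_symm {g : M → F} {x : M} {n : WithTop ℕ∞}
    (hg : ContMDiffAt 𝓘(ℝ, E) 𝓘(ℝ, F) n g x) :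
    ContDiffAt ℝ n (g ∘ (extChartAt 𝓘(ℝ, E) x).symm) (extChartAt 𝓘(ℝ, E) x x) := by
  have h1 := contMDiffAt_iff_source.1 hg
  rw [ModelWithCorners.range_eq_univ, contMDiffWithinAt_univ] at h1
  exact h1.contDiffAt

theorem differentiableAt_comp_extChartAt_symm {g : M → F} {x : M}
    (hg : MDifferentiableAt 𝓘(ℝ, E) 𝓘(ℝ, F) g x) :
    DifferentiableAt ℝ (g ∘ (extChartAt 𝓘(ℝ, E) x).symm) (extChartAt 𝓘(ℝ, E) x x) := by
  have h1 := (mdifferentiableAt_iff_source_of_mem_source (mem_chart_source E x)).1 hg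
  rw [ModelWithCorners.range_eq_univ, mdifferentiableWithinAt_univ] at h1
  exact h1.differentiableAt

theorem mdifferentiableAt_of_comp_extChartAt_symm {g : M → F} {x : M}
    (hg : DifferentiableAt ℝ (g ∘ (extChartAt 𝓘(ℝ, E) x).symm) (extChartAt 𝓘(ℝ, E) x x)) :
    MDifferentiableAt 𝓘(ℝ, E) 𝓘(ℝ, F) g x := by
  refine (mdifferentiableAt_iff_source_of_mem_source (mem_chart_source E x)).2 ?_
  rw [ModelWithCorners.range_eq_univ, mdifferentiableWithinAt_univ]
  exact hg.mdifferentiableAt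

theorem derivAlong_comp_extChartAt_symm_eventuallyEq {g : M → F} {x : M}
    (hg : ∀ᶠ y in 𝓝 x, MDifferentiableAt 𝓘(ℝ, E) 𝓘(ℝ, F) g y)
    (X : ∀ x : M, TangentSpace 𝓘(ℝ, E) x) :
    derivAlong g X ∘ (extChartAt 𝓘(ℝ, E) x).symm =ᶠ[𝓝 (extChartAt 𝓘(ℝ, E) x x)]
      fun y => fderiv ℝ (g ∘ (extChartAt 𝓘(ℝ, E) x).symm) y (chartField x X y) := by
  have h1 : Tendsto (extChartAt 𝓘(ℝ, E) x).symm (𝓝 (extChartAt 𝓘(ℝ, E) x x)) (𝓝 x) := by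
    have := continuousAt_extChartAt_symm (I := 𝓘(ℝ, E)) x
    rwa [ContinuousAt, extChartAt_to_inv] at this
  filter_upwards [extChartAt_target_mem_nhds (I := 𝓘(ℝ, E)) x, h1.eventually hg] with y hy hgy
  exact (mfderiv_comp_extChartAt_symm hy hgy X).symm

variable [CompleteSpace E]

theorem FieldDiffAt.mdifferentiableAt_derivAlong {g : M → F} {x : M}
    (hg : ContMDiffAt 𝓘(ℝ, E) 𝓘(ℝ, F) 2 g x) {X : ∀ x : M, TangentSpace 𝓘(ℝ, E) x}
    (hX : FieldDiffAt X x) : MDifferentiableAt 𝓘(ℝ, E) 𝓘(ℝ, F) (derivAlong g X) x := by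
  have hev : ∀ᶠ y in 𝓝 x, MDifferentiableAt 𝓘(ℝ, E) 𝓘(ℝ, F) g y := by
    filter_upwards [(contMDiffAt_iff_contMDiffAt_nhds (by simp)).1 hg] with y hy
      using hy.mdifferentiableAt (by simp)
  refine mdifferentiableAt_of_comp_extChartAt_symm ?_
  refine DifferentiableAt.congr_of_eventuallyEq ?_
    (derivAlong_comp_extChartAt_symm_eventuallyEq hev X)
  have h1 : ContDiffAt ℝ 1 (fderiv ℝ (g ∘ (extChartAt 𝓘(ℝ, E) x).symm))
      (extChartAt 𝓘(ℝ, E) x x) :=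
    (contDiffAt_comp_extChartAt_symm hg).fderiv_right (by norm_num)
  exact (h1.differentiableAt (by simp)).clm_apply hX.differentiableAt_chartField

/-- The derivative along a Lie bracket is the commutator of the derivatives. -/
theorem derivAlong_mlieBracket {g : M → F} {x : M} (hg : ContMDiffAt 𝓘(ℝ, E) 𝓘(ℝ, F) 2 g x)
    {X Y : ∀ x : M, TangentSpace 𝓘(ℝ, E) x} (hX : FieldDiffAt X x) (hY : FieldDiffAt Y x) :
    derivAlong g (VectorField.mlieBracket 𝓘(ℝ, E) X Y) x =
      derivAlong (derivAlong g Y) X x - derivAlong (derivAlong g X) Y x := by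
  have hev : ∀ᶠ y in 𝓝 x, MDifferentiableAt 𝓘(ℝ, E) 𝓘(ℝ, F) g y := by
    filter_upwards [(contMDiffAt_iff_contMDiffAt_nhds (by simp)).1 hg] with y hy
      using hy.mdifferentiableAt (by simp)
  have hinv : (extChartAt 𝓘(ℝ, E) x).symm (extChartAt 𝓘(ℝ, E) x x) = x := extChartAt_to_inv x
  have htgt := mem_extChartAt_target (I := 𝓘(ℝ, E)) x
  have hval : ∀ {k : M → F}, MDifferentiableAt 𝓘(ℝ, E) 𝓘(ℝ, F) k x →
      ∀ Z : ∀ x : M, TangentSpace 𝓘(ℝ, E) x, derivAlong k Z x =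
      fderiv ℝ (k ∘ (extChartAt 𝓘(ℝ, E) x).symm) (extChartAt 𝓘(ℝ, E) x x)
        (chartField x Z (extChartAt 𝓘(ℝ, E) x x)) := by
    intro k hk Z
    rw [mfderiv_comp_extChartAt_symm htgt (by rwa [hinv]), hinv]
  have hbr : chartField x (VectorField.mlieBracket 𝓘(ℝ, E) X Y) (extChartAt 𝓘(ℝ, E) x x) =
      VectorField.lieBracket ℝ (chartField x X) (chartField x Y) (extChartAt 𝓘(ℝ, E) x x) := by
    rw [← mfderiv_extChartAt_mlieBracket, chartField_apply_self]
    rfl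
  rw [hval hev.self_of_nhds, hbr, VectorField.fderiv_apply_lieBracket
    (contDiffAt_comp_extChartAt_symm hg) (by simp)
    hY.differentiableAt_chartField hX.differentiableAt_chartField,
    hval (hY.mdifferentiableAt_derivAlong hg), hval (hX.mdifferentiableAt_derivAlong hg),
    (derivAlong_comp_extChartAt_symm_eventuallyEq hev X).fderiv_eq,
    (derivAlong_comp_extChartAt_symm_eventuallyEq hev Y).fderiv_eq]

end ManifoldBracket

section ManifoldBracket

variable {E : Type*} [NormedAddCommGroup E] [NormedSpace ℝ E] [CompleteSpace E]
  {E' : Type*} [NormedAddCommGroup E'] [NormedSpace ℝ E'] [CompleteSpace E']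
  {M : Type*} [TopologicalSpace M] [ChartedSpace E M] [IsManifold 𝓘(ℝ, E) ∞ M]
  {N : Type*} [TopologicalSpace N] [ChartedSpace E' N] [IsManifold 𝓘(ℝ, E') ∞ N]

omit [CompleteSpace E] in
theorem mfderiv_extChartAt_injective (x : M) :
    Function.Injective (mfderiv 𝓘(ℝ, E) 𝓘(ℝ, E) (extChartAt 𝓘(ℝ, E) x) x) :=
  (isInvertible_mfderiv_extChartAt (mem_extChartAt_source x)).injective

/-- Lie brackets of related vector fields are related. -/
theorem mfderiv_mlieBracket_of_related {f : N → M} {x : N}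
    (hf : ContMDiffAt 𝓘(ℝ, E') 𝓘(ℝ, E) 2 f x)
    {X Y : ∀ x : N, TangentSpace 𝓘(ℝ, E') x} {X' Y' : ∀ x : M, TangentSpace 𝓘(ℝ, E) x}
    (hX : FieldDiffAt X x) (hY : FieldDiffAt Y x) (hX' : FieldDiffAt X' (f x))
    (hY' : FieldDiffAt Y' (f x))
    (hXX' : ∀ᶠ y in 𝓝 x, mfderiv 𝓘(ℝ, E') 𝓘(ℝ, E) f y (X y) = X' (f y))
    (hYY' : ∀ᶠ y in 𝓝 x, mfderiv 𝓘(ℝ, E') 𝓘(ℝ, E) f y (Y y) = Y' (f y)) :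
    mfderiv 𝓘(ℝ, E') 𝓘(ℝ, E) f x (bracket X Y x) = bracket X' Y' (f x) := by
  -- The differential of a chart is injective, so it suffices to compare both sides as derivations
  -- acting on the chart, where brackets become commutators.
  set g := extChartAt 𝓘(ℝ, E) (f x) with hgdef
  have hg : ContMDiffAt 𝓘(ℝ, E) 𝓘(ℝ, E) 2 g (f x) := contMDiffAt_extChartAt
  have hgev : ∀ᶠ y in 𝓝 x, MDifferentiableAt 𝓘(ℝ, E) 𝓘(ℝ, E) g (f y) := by
    have := (contMDiffAt_iff_contMDiffAt_nhds (by simp)).1 hg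
    filter_upwards [hf.continuousAt.eventually this] with y hy using hy.mdifferentiableAt (by simp)
  have hfev : ∀ᶠ y in 𝓝 x, MDifferentiableAt 𝓘(ℝ, E') 𝓘(ℝ, E) f y := by
    filter_upwards [(contMDiffAt_iff_contMDiffAt_nhds (by simp)).1 hf] with y hy
      using hy.mdifferentiableAt (by simp)
  have hcomp : ∀ (k : M → E) (y : N), MDifferentiableAt 𝓘(ℝ, E) 𝓘(ℝ, E) k (f y) →
      MDifferentiableAt 𝓘(ℝ, E') 𝓘(ℝ, E) f y → ∀ Z : ∀ x : N, TangentSpace 𝓘(ℝ, E') x,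
      ∀ Z' : ∀ x : M, TangentSpace 𝓘(ℝ, E) x,
      mfderiv 𝓘(ℝ, E') 𝓘(ℝ, E) f y (Z y) = Z' (f y) →
      derivAlong (k ∘ f) Z y = derivAlong k Z' (f y) := by
    intro k y hk hfy Z Z' h
    simp only [derivAlong]
    rw [mfderiv_comp y hk hfy, ← h]
    rfl
  have hgf : ContMDiffAt 𝓘(ℝ, E') 𝓘(ℝ, E) 2 (g ∘ f) x := hg.comp x hf
  have key : ∀ (Z : ∀ x : N, TangentSpace 𝓘(ℝ, E') x) (Z' : ∀ x : M, TangentSpace 𝓘(ℝ, E) x),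
      (∀ᶠ y in 𝓝 x, mfderiv 𝓘(ℝ, E') 𝓘(ℝ, E) f y (Z y) = Z' (f y)) →
      derivAlong (g ∘ f) Z =ᶠ[𝓝 x] derivAlong g Z' ∘ f := by
    intro Z Z' h
    filter_upwards [hgev, hfev, h] with y h1 h2 h3 using hcomp g y h1 h2 Z Z' h3
  have hX2 := hXX'.self_of_nhds
  have hY2 := hYY'.self_of_nhds
  have h1 := derivAlong_mlieBracket hgf hX hY
  have h2 := derivAlong_mlieBracket hg hX' hY'
  have h3 : ∀ {k k' : N → E} (Z : ∀ x : N, TangentSpace 𝓘(ℝ, E') x), k =ᶠ[𝓝 x] k' →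
      derivAlong k Z x = derivAlong k' Z x := by
    intro k k' Z h
    simp only [derivAlong]
    rw [h.mfderiv_eq]
    rfl
  rw [h3 X (key Y Y' hYY'), h3 Y (key X X' hXX'),
    hcomp _ x (hY'.mdifferentiableAt_derivAlong hg) hfev.self_of_nhds X X' hX2,
    hcomp _ x (hX'.mdifferentiableAt_derivAlong hg) hfev.self_of_nhds Y Y' hY2, ← h2] at h1
  apply mfderiv_extChartAt_injective (f x)
  refine Eq.trans ?_ h1
  simp only [derivAlong]
  rw [mfderiv_comp x hgev.self_of_nhds hfev.self_of_nhds]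
  rfl

omit [CompleteSpace E] in
/-- In a chart, a smooth field of endomorphisms is a smooth family of matrices. -/
theorem IsSmoothEnd.exists_chart
    {j : ∀ x : M, TangentSpace 𝓘(ℝ, E) x →L[ℝ] TangentSpace 𝓘(ℝ, E) x} (hj : IsSmoothEnd j)
    (x : M) : ∃ A : M → E →L[ℝ] E, ContMDiffAt 𝓘(ℝ, E) 𝓘(ℝ, E →L[ℝ] E) ∞ A x ∧
      ∀ᶠ y in 𝓝 x, ∀ v : TangentSpace 𝓘(ℝ, E) y,
        mfderiv 𝓘(ℝ, E) 𝓘(ℝ, E) (extChartAt 𝓘(ℝ, E) x) y (j y v) =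
          A y (mfderiv 𝓘(ℝ, E) 𝓘(ℝ, E) (extChartAt 𝓘(ℝ, E) x) y v) := by
  have h1 := ((contMDiffAt_hom_bundle _).1 (hj x)).2
  refine ⟨_, h1, ?_⟩
  filter_upwards [(chartAt E x).open_source.mem_nhds (mem_chart_source E x)] with y hy v
  have hb : y ∈ (trivializationAt E (TangentSpace 𝓘(ℝ, E)) x).baseSet := hy
  have e1 : ∀ w : TangentSpace 𝓘(ℝ, E) y, mfderiv 𝓘(ℝ, E) 𝓘(ℝ, E) (extChartAt 𝓘(ℝ, E) x) y w =
      (trivializationAt E (TangentSpace 𝓘(ℝ, E)) x).continuousLinearMapAt ℝ y w := by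
    intro w
    rw [TangentBundle.continuousLinearMapAt_trivializationAt hy]
    rfl
  rw [e1, e1]
  exact (congrArg (fun w => (trivializationAt E (TangentSpace 𝓘(ℝ, E)) x).continuousLinearMapAt ℝ y
    (j y w))
    ((trivializationAt E (TangentSpace 𝓘(ℝ, E)) x).symmL_continuousLinearMapAt (R := ℝ) hb v)).symm

omit [CompleteSpace E] in
theorem FieldDiffAt.endApply
    {j : ∀ x : M, TangentSpace 𝓘(ℝ, E) x →L[ℝ] TangentSpace 𝓘(ℝ, E) x} (hj : IsSmoothEnd j)
    {X : ∀ x : M, TangentSpace 𝓘(ℝ, E) x} {x : M} (hX : FieldDiffAt X x) :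
    FieldDiffAt (endApply j X) x :=
  MDifferentiableAt.clm_bundle_apply (IM := 𝓘(ℝ, E)) (F₁ := E) (F₂ := E)
    (E₁ := (TangentSpace 𝓘(ℝ, E) : M → Type _)) (E₂ := (TangentSpace 𝓘(ℝ, E) : M → Type _))
    (b := fun x => x) ((hj x).mdifferentiableAt (by simp)) hX

/-- The bracket with a vector field vanishing at a point is a linear operator there. -/
theorem exists_mlieBracket_eq_of_apply_eq_zero
    {j : ∀ x : M, TangentSpace 𝓘(ℝ, E) x →L[ℝ] TangentSpace 𝓘(ℝ, E) x} (hj : IsSmoothEnd j)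
    {V : ∀ x : M, TangentSpace 𝓘(ℝ, E) x} {x : M} (hV : FieldDiffAt V x) (hV0 : V x = 0) :
    ∃ L : TangentSpace 𝓘(ℝ, E) x →L[ℝ] TangentSpace 𝓘(ℝ, E) x,
      ∀ Y : ∀ x : M, TangentSpace 𝓘(ℝ, E) x, FieldDiffAt Y x →
        bracket V Y x = -L (Y x) ∧ bracket (endApply j V) Y x = -j x (L (Y x)) := by
  set g := extChartAt 𝓘(ℝ, E) x with hgdef
  have hg : ContMDiffAt 𝓘(ℝ, E) 𝓘(ℝ, E) 2 g x := contMDiffAt_extChartAt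
  obtain ⟨A, hA, hAj⟩ := hj.exists_chart x
  have hinv := isInvertible_mfderiv_extChartAt (I := 𝓘(ℝ, E)) (mem_extChartAt_source (I := 𝓘(ℝ, E)) x)
  have hinj := mfderiv_extChartAt_injective (E := E) x
  have hVg0 : derivAlong g V x = 0 := by
    simp only [derivAlong, hV0]
    exact map_zero _
  have hbr : ∀ (W Y : ∀ x : M, TangentSpace 𝓘(ℝ, E) x), FieldDiffAt W x → W x = 0 →
      FieldDiffAt Y x → derivAlong g (bracket W Y) x = - derivAlong (derivAlong g W) Y x := by
    intro W Y hW hW0 hY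
    have h1 := derivAlong_mlieBracket hg hW hY
    have h2 : derivAlong (derivAlong g Y) W x = 0 :=
      (congrArg (mfderiv 𝓘(ℝ, E) 𝓘(ℝ, E) (derivAlong g Y) x) hW0).trans (map_zero _)
    rw [h2, zero_sub] at h1
    exact h1
  have hjV : derivAlong g (endApply j V) =ᶠ[𝓝 x] fun y => A y (derivAlong g V y) := by
    filter_upwards [hAj] with y hy using hy (V y)
  have hjV0 : endApply j V x = 0 := by
    simp only [endApply, hV0]
    exact map_zero _
  -- In the product rule for `A · dg(V)` the term containing the derivative of `A` is multiplied by
  -- the value of `V` at `x`, which is 0.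
  have hdj : ∀ Y : ∀ x : M, TangentSpace 𝓘(ℝ, E) x,
      derivAlong (derivAlong g (endApply j V)) Y x = A x (derivAlong (derivAlong g V) Y x) := by
    intro Y
    have hinv' : (extChartAt 𝓘(ℝ, E) x).symm (extChartAt 𝓘(ℝ, E) x x) = x := extChartAt_to_inv x
    have hval : ∀ {k : M → E}, MDifferentiableAt 𝓘(ℝ, E) 𝓘(ℝ, E) k x → derivAlong k Y x =
        fderiv ℝ (k ∘ (extChartAt 𝓘(ℝ, E) x).symm) (extChartAt 𝓘(ℝ, E) x x)
          (chartField x Y (extChartAt 𝓘(ℝ, E) x x)) := by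
      intro k hk
      rw [mfderiv_comp_extChartAt_symm (mem_extChartAt_target x) (by rwa [hinv']), hinv']
    have hd := hV.mdifferentiableAt_derivAlong hg
    have hAd := hA.mdifferentiableAt (by simp)
    have h1 : derivAlong (derivAlong g (endApply j V)) Y x =
        derivAlong (fun y => A y (derivAlong g V y)) Y x := by
      exact congrArg (fun T : E →L[ℝ] E => T (Y x)) (hjV.mfderiv_eq (I := 𝓘(ℝ, E)) (I' := 𝓘(ℝ, E)))
    rw [h1, hval (hAd.clm_apply hd), hval hd]
    have h2 := fderiv_clm_apply (differentiableAt_comp_extChartAt_symm hAd)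
      (differentiableAt_comp_extChartAt_symm hd)
    refine (congrArg (fun T : E →L[ℝ] E => T (chartField x Y (extChartAt 𝓘(ℝ, E) x x))) h2).trans ?_
    simp only [Function.comp_apply, hinv', hVg0]
    simp
  refine ⟨(mfderiv 𝓘(ℝ, E) 𝓘(ℝ, E) g x).inverse.comp
    (mfderiv 𝓘(ℝ, E) 𝓘(ℝ, E) (derivAlong g V) x), fun Y hY => ⟨?_, ?_⟩⟩
  · apply hinj
    refine (hbr V Y hV hV0 hY).trans ?_
    refine Eq.trans ?_ (map_neg _ _).symm
    exact congrArg Neg.neg (hinv.self_apply_inverse _).symm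
  · apply hinj
    refine (hbr _ Y (hV.endApply hj) hjV0 hY).trans ?_
    refine Eq.trans ?_ (map_neg _ _).symm
    refine congrArg Neg.neg ((hdj Y).trans ?_)
    refine Eq.trans ?_ (hAj.self_of_nhds _).symm
    exact congrArg (A x) (hinv.self_apply_inverse _).symm

/-- The operator `U ↦ [F, jU] - j[F, U]` is tensorial. -/
theorem mlieBracket_endApply_of_apply_eq_zero
    {j : ∀ x : M, TangentSpace 𝓘(ℝ, E) x →L[ℝ] TangentSpace 𝓘(ℝ, E) x} (hj : IsSmoothEnd j)
    {F V : ∀ x : M, TangentSpace 𝓘(ℝ, E) x} {x : M} (hF : FieldDiffAt F x)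
    (hV : FieldDiffAt V x) (hV0 : V x = 0) :
    bracket F (endApply j V) x = j x (bracket F V x) := by
  obtain ⟨L, hL⟩ := exists_mlieBracket_eq_of_apply_eq_zero hj hV hV0
  obtain ⟨h1, h2⟩ := hL F hF
  have h3 : bracket F (endApply j V) x = -bracket (endApply j V) F x :=
    VectorField.mlieBracket_swap_apply
  have h4 : bracket F V x = -bracket V F x := VectorField.mlieBracket_swap_apply
  rw [h3, h4, h1, h2, neg_neg, neg_neg]

/-- With `L` the linearisation of `V` at `x`, the four terms are `-jLjY`, `+jjLY`, `+jLjY` and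
`-jjLY`. The cancellation does not need `j² = -id`. -/
theorem nijenhuis_of_apply_eq_zero
    {j : ∀ x : M, TangentSpace 𝓘(ℝ, E) x →L[ℝ] TangentSpace 𝓘(ℝ, E) x} (hj : IsSmoothEnd j)
    {V Y : ∀ x : M, TangentSpace 𝓘(ℝ, E) x} {x : M} (hV : FieldDiffAt V x) (hY : FieldDiffAt Y x)
    (hV0 : V x = 0) : nijenhuis j V Y x = 0 := by
  obtain ⟨L, hL⟩ := exists_mlieBracket_eq_of_apply_eq_zero hj hV hV0
  obtain ⟨h1, h2⟩ := hL Y hY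
  obtain ⟨h3, h4⟩ := hL _ (hY.endApply hj)
  change bracket (endApply j V) (endApply j Y) x - j x (bracket (endApply j V) Y x) -
    j x (bracket V (endApply j Y) x) + j x (j x (bracket V Y x)) = 0
  rw [h1, h2, h3, h4]
  simp only [map_neg]
  abel

/-- Infinitesimal version of transport by a one-parameter family of maps. -/
theorem hasDerivAt_of_mfderiv_eq {θ : ℝ → M → M} {x : M}
    (hθ : ContMDiffAt (𝓘(ℝ, ℝ).prod 𝓘(ℝ, E)) 𝓘(ℝ, E) 2 (Function.uncurry θ) (0, x))
    (hθ0 : ∀ y, θ 0 y = y) {V U : ∀ x : M, TangentSpace 𝓘(ℝ, E) x}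
    (hθV : ∀ y, (mfderiv 𝓘(ℝ, ℝ) 𝓘(ℝ, E) (fun t => θ t y) 0 (1 : ℝ) : E) = V y)
    (hV : FieldDiffAt V x) (hU : FieldDiffAt U x) {u : ℝ → E}
    (hu : ∀ᶠ t in 𝓝 (0 : ℝ), (mfderiv 𝓘(ℝ, E) 𝓘(ℝ, E) (θ t) x (u t) : E) = U (θ t x)) :
    HasDerivAt u (bracket V U x) 0 := by
  set g := extChartAt 𝓘(ℝ, E) x with hgdef
  set y₀ := g x with hy₀
  have hg : ContMDiffAt 𝓘(ℝ, E) 𝓘(ℝ, E) 2 g x := contMDiffAt_extChartAt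
  have hgsymm : ContMDiffAt 𝓘(ℝ, E) 𝓘(ℝ, E) 2 g.symm y₀ :=
    (contMDiffOn_extChartAt_symm x).contMDiffAt (extChartAt_target_mem_nhds x)
  have hinv : g.symm y₀ = x := extChartAt_to_inv x
  set Θ : ℝ × E → E := fun p => g (θ p.1 (g.symm p.2)) with hΘdef
  have hΘ : ContDiffAt ℝ 2 Θ (0, y₀) := by
    have h1 : ContMDiffAt 𝓘(ℝ, ℝ × E) (𝓘(ℝ, ℝ).prod 𝓘(ℝ, E)) 2
        (fun p : ℝ × E => (p.1, g.symm p.2)) (0, y₀) :=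
      contDiff_fst.contMDiff.contMDiffAt.prodMk
        (ContMDiffAt.comp (0, y₀) (by exact hgsymm) contDiff_snd.contMDiff.contMDiffAt)
    have h2 : ContMDiffAt 𝓘(ℝ, ℝ × E) 𝓘(ℝ, E) 2
        (fun p : ℝ × E => Function.uncurry θ (p.1, g.symm p.2)) (0, y₀) :=
      ContMDiffAt.comp (0, y₀) (by rw [hinv]; exact hθ) h1
    have h3 : ContMDiffAt 𝓘(ℝ, ℝ × E) 𝓘(ℝ, E) 2 Θ (0, y₀) :=
      ContMDiffAt.comp (0, y₀) (by
        change ContMDiffAt _ _ _ _ (θ 0 (g.symm y₀)); rw [hθ0, hinv]; exact hg) h2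
    exact h3.contDiffAt
  have hΘd : DifferentiableAt ℝ (fderiv ℝ Θ) (0, y₀) :=
    (hΘ.fderiv_right (m := 1) (by norm_num)).differentiableAt (by simp)
  have hΘev : ∀ᶠ p in 𝓝 ((0 : ℝ), y₀), DifferentiableAt ℝ Θ p := by
    filter_upwards [hΘ.eventually (by simp)] with p hp using hp.differentiableAt (by simp)
  have hsymm : IsSymmSndFDerivAt ℝ Θ (0, y₀) := hΘ.isSymmSndFDerivAt (by simp)
  set D2 := fderiv ℝ (fderiv ℝ Θ) (0, y₀) with hD2
  -- differentials of the maps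
  set B : ℝ → E →L[ℝ] E := fun t => (fderiv ℝ Θ (t, y₀)).comp (ContinuousLinearMap.inr ℝ ℝ E) with hB
  have hline : HasDerivAt (fun t : ℝ => (t, y₀)) ((1 : ℝ), (0 : E)) 0 :=
    (hasDerivAt_id 0).prodMk (hasDerivAt_const 0 y₀)
  have hBd : HasDerivAt B ((D2 (1, 0)).comp (ContinuousLinearMap.inr ℝ ℝ E)) 0 := by
    have h1 := hΘd.hasFDerivAt.comp_hasDerivAt 0 hline
    simpa using h1.clm_comp (hasDerivAt_const (0 : ℝ) (ContinuousLinearMap.inr ℝ ℝ E))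
  have hΘ0 : ∀ᶠ y in 𝓝 y₀, Θ (0, y) = y := by
    filter_upwards [extChartAt_target_mem_nhds (I := 𝓘(ℝ, E)) x] with y hy
    change g (θ 0 (g.symm y)) = y
    rw [hθ0, g.right_inv hy]
  have hpart : ∀ t, DifferentiableAt ℝ Θ (t, y₀) →
      HasFDerivAt (fun y => Θ (t, y)) (B t) y₀ := fun t ht =>
    ht.hasFDerivAt.comp y₀ ((hasFDerivAt_const t y₀).prodMk (hasFDerivAt_id y₀))
  have hB0 : B 0 = ContinuousLinearMap.id ℝ E :=
    ((hpart 0 hΘev.self_of_nhds).congr_of_eventuallyEq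
      (hΘ0.mono fun y hy => hy.symm)).unique (hasFDerivAt_id y₀)
  -- the velocity field
  set dg : E →L[ℝ] E := mfderiv 𝓘(ℝ, E) 𝓘(ℝ, E) g x with hdg
  have hev : ∀ᶠ p in 𝓝 ((0 : ℝ), x), ContMDiffAt (𝓘(ℝ, ℝ).prod 𝓘(ℝ, E)) 𝓘(ℝ, E) 2
      (Function.uncurry θ) p := (contMDiffAt_iff_contMDiffAt_nhds (by simp)).1 hθ
  have hgev : ∀ᶠ y in 𝓝 x, MDifferentiableAt 𝓘(ℝ, E) 𝓘(ℝ, E) g y := by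
    filter_upwards [(contMDiffAt_iff_contMDiffAt_nhds (by simp)).1 hg] with y hy
      using hy.mdifferentiableAt (by simp)
  have hline' : ∀ y : M, ContMDiff 𝓘(ℝ, ℝ) (𝓘(ℝ, ℝ).prod 𝓘(ℝ, E)) 2 (fun t : ℝ => (t, y)) :=
    fun y => contMDiff_id.prodMk contMDiff_const
  have hflow : ∀ᶠ y in 𝓝 x, MDifferentiableAt 𝓘(ℝ, ℝ) 𝓘(ℝ, E) (fun t => θ t y) 0 := by
    have h1 : Tendsto (fun y : M => ((0 : ℝ), y)) (𝓝 x) (𝓝 (0, x)) :=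
      (Continuous.prodMk_right (0 : ℝ)).tendsto x
    filter_upwards [h1.eventually hev] with y hy
    exact (ContMDiffAt.comp (0 : ℝ) (g := Function.uncurry θ) hy (hline' y 0)).mdifferentiableAt
      (by simp)
  have hgsymm_tendsto : Tendsto g.symm (𝓝 y₀) (𝓝 x) := by
    have := hgsymm.continuousAt
    rwa [ContinuousAt, hinv] at this
  have hmfd : ∀ (k : M → E) (z : M), MDifferentiableAt 𝓘(ℝ, E) 𝓘(ℝ, E) k z →
      MDifferentiableAt 𝓘(ℝ, ℝ) 𝓘(ℝ, E) (fun t => θ t z) 0 →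
      HasDerivAt (fun t => k (θ t z)) (derivAlong k V z) 0 := by
    intro k z hk hf
    have hk' : MDifferentiableAt 𝓘(ℝ, E) 𝓘(ℝ, E) k (θ 0 z) := by rwa [hθ0]
    have h1 := (hk'.comp (0 : ℝ) (f := fun t => θ t z) hf).differentiableAt.hasDerivAt
    refine HasDerivAt.congr_deriv (f := fun t => k (θ t z)) h1 ?_
    symm
    have h2 := mfderiv_comp (0 : ℝ) (f := fun t => θ t z) hk' hf
    rw [mfderiv_eq_fderiv] at h2
    refine Eq.trans ?_ (congrArg (fun T : ℝ →L[ℝ] E => T 1) h2).symm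
    refine Eq.trans ?_ (congrArg (fun z' => (mfderiv 𝓘(ℝ, E) 𝓘(ℝ, E) k z' : E →L[ℝ] E)
      (mfderiv 𝓘(ℝ, ℝ) 𝓘(ℝ, E) (fun t => θ t z) 0 (1 : ℝ) : E)) (hθ0 z)).symm
    exact congrArg (mfderiv 𝓘(ℝ, E) 𝓘(ℝ, E) k z : E →L[ℝ] E) (hθV z).symm
  have hw : ∀ᶠ y in 𝓝 y₀, fderiv ℝ Θ (0, y) (1, 0) = derivAlong g V (g.symm y) := by
    have h1 : Tendsto (fun y : E => ((0 : ℝ), y)) (𝓝 y₀) (𝓝 (0, y₀)) :=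
      (Continuous.prodMk_right (0 : ℝ)).tendsto y₀
    filter_upwards [h1.eventually hΘev, hgsymm_tendsto.eventually hflow,
      hgsymm_tendsto.eventually hgev] with y h2 h3 h4
    have h5 := hmfd g (g.symm y) h4 h3
    have h6 : HasDerivAt (fun t : ℝ => (t, y)) ((1 : ℝ), (0 : E)) 0 :=
      (hasDerivAt_id 0).prodMk (hasDerivAt_const 0 y)
    have h7 := h2.hasFDerivAt.comp_hasDerivAt (0 : ℝ) h6
    exact h7.unique h5
  have hũ : HasDerivAt (fun t => derivAlong g U (θ t x))
      (derivAlong (derivAlong g U) V x) 0 :=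
    hmfd _ x (hU.mdifferentiableAt_derivAlong hg) hflow.self_of_nhds
  have hθx : Tendsto (fun t => θ t x) (𝓝 0) (𝓝 x) := by
    have := hflow.self_of_nhds.continuousAt
    rwa [ContinuousAt, hθ0] at this
  have hrel : ∀ᶠ t in 𝓝 (0 : ℝ), B t (dg (u t)) = derivAlong g U (θ t x) := by
    filter_upwards [(hline' x).continuous.continuousAt.eventually hev, hθx.eventually hgev,
      hline.continuousAt.eventually hΘev, hu] with t h1 h2 h3 h4
    have h5 : ContMDiffAt 𝓘(ℝ, E) 𝓘(ℝ, E) 2 (θ t) x :=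
      ContMDiffAt.comp x (g := Function.uncurry θ) h1
        ((contMDiff_const (c := t)).prodMk contMDiff_id).contMDiffAt
    have h5' := h5.mdifferentiableAt (by simp)
    have h6 : g ∘ θ t =ᶠ[𝓝 x] (fun y => Θ (t, y)) ∘ g := by
      filter_upwards [extChartAt_source_mem_nhds (I := 𝓘(ℝ, E)) x] with y hy
      simp only [hΘdef, Function.comp_apply, g.left_inv hy]
    have h7 : (mfderiv 𝓘(ℝ, E) 𝓘(ℝ, E) (g ∘ θ t) x : E →L[ℝ] E) =
        mfderiv 𝓘(ℝ, E) 𝓘(ℝ, E) ((fun y => Θ (t, y)) ∘ g) x := h6.mfderiv_eq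
    have h8 := mfderiv_comp x h2 h5'
    have h9 := (HasMFDerivAt.comp x (hpart t h3).hasMFDerivAt hgev.self_of_nhds.hasMFDerivAt).mfderiv
    replace h7 := (h9.symm.trans h7.symm).trans h8
    refine (congrArg (fun T : E →L[ℝ] E => T (u t)) h7).trans ?_
    exact congrArg (mfderiv 𝓘(ℝ, E) 𝓘(ℝ, E) g (θ t x)) h4
  -- Differentiability of `u` is not assumed. It is recovered by solving `B t (dg (u t)) = dg U (θ t
  -- x)`, since `B t` is invertible for small `t`.
  have hBinv0 : ContDiffAt ℝ 1 ContinuousLinearMap.inverse (B 0) := by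
    rw [hB0]
    exact contDiffAt_map_inverse (ContinuousLinearEquiv.refl ℝ E)
  have hBinv : ∀ᶠ t in 𝓝 (0 : ℝ), (B t).inverse (derivAlong g U (θ t x)) = dg (u t) := by
    have h1 : ∀ᶠ t in 𝓝 (0 : ℝ), B t ∈ range ((↑) : (E ≃L[ℝ] E) → E →L[ℝ] E) := by
      refine hBd.continuousAt.eventually ?_
      rw [hB0]
      exact ContinuousLinearEquiv.nhds (ContinuousLinearEquiv.refl ℝ E)
    filter_upwards [h1, hrel] with t ⟨e, he⟩ h2
    rw [← h2, ← he]
    simp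
  have hû : DifferentiableAt ℝ (fun t => dg (u t)) 0 := by
    refine DifferentiableAt.congr_of_eventuallyEq ?_ (hBinv.mono fun t ht => ht.symm)
    exact ((hBinv0.differentiableAt (by simp)).comp (0 : ℝ) hBd.differentiableAt).clm_apply
      hũ.differentiableAt
  have hinj := mfderiv_extChartAt_injective (E := E) x
  have hdgu0 : dg (u 0) = dg (U x) := by
    have h1 := hrel.self_of_nhds
    rw [hB0] at h1
    exact h1.trans (congrArg (derivAlong g U) (hθ0 x))
  have hprod := hBd.clm_apply hû.hasDerivAt
  have hval := (hprod.congr_of_eventuallyEq (hrel.mono fun t ht => ht.symm)).unique hũ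
  -- Symmetry of the second derivative identifies the time derivative of the differentials `B t`
  -- with the space derivative of the velocity field `V`.
  have hD2w : ∀ v, D2 (1, 0) (0, v) = fderiv ℝ (derivAlong g V ∘ g.symm) y₀ v := by
    intro v
    have h1 : HasFDerivAt (fun y : E => ((0 : ℝ), y)) (ContinuousLinearMap.inr ℝ ℝ E) y₀ :=
      (hasFDerivAt_const (0 : ℝ) y₀).prodMk (hasFDerivAt_id y₀)
    have h2 := ((hΘd.hasFDerivAt.comp y₀ h1).clm_apply
      (hasFDerivAt_const ((1 : ℝ), (0 : E)) y₀)).congr_of_eventuallyEq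
      (hw.mono fun y hy => hy.symm)
    have h3 : fderiv ℝ (derivAlong g V ∘ g.symm) y₀ = _ := h2.fderiv
    rw [h3, hsymm.eq (1, 0) (0, v)]
    simp
  have hdV : D2 (1, 0) (0, dg (U x)) = derivAlong (derivAlong g V) U x := by
    rw [hD2w]
    have h1 := mfderiv_comp_extChartAt_symm (mem_extChartAt_target (I := 𝓘(ℝ, E)) x)
      (by rw [extChartAt_to_inv]; exact hV.mdifferentiableAt_derivAlong hg) U
    rw [chartField_apply_self, extChartAt_to_inv] at h1
    exact h1
  have hbr := derivAlong_mlieBracket hg hV hU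
  have hdû : HasDerivAt (fun t => dg (u t)) (dg (bracket V U x)) 0 := by
    convert hû.hasDerivAt using 1
    refine hbr.trans ?_
    rw [← hval, ← hdV, hdgu0, hB0]
    simp
  have hdginv := isInvertible_mfderiv_extChartAt (I := 𝓘(ℝ, E)) (mem_extChartAt_source (I := 𝓘(ℝ, E)) x)
  set dgi : E →L[ℝ] E := (mfderiv 𝓘(ℝ, E) 𝓘(ℝ, E) g x).inverse
  have h9 := dgi.hasFDerivAt.comp_hasDerivAt (0 : ℝ) hdû
  have h10 : ∀ v : E, dgi (dg v) = v := hdginv.inverse_apply_self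
  exact HasDerivAt.congr_deriv (f := u)
    (h9.congr_of_eventuallyEq (Eventually.of_forall fun t => (h10 (u t)).symm)) (h10 _)

end ManifoldBracket

/-! ### Fundamental vector fields of a smooth action -/

section LieGroupAction

variable {EG : Type*} [NormedAddCommGroup EG] [NormedSpace ℝ EG]
  {G : Type*} [TopologicalSpace G] [ChartedSpace EG G] [Group G] [LieGroup 𝓘(ℝ, EG) ∞ G]
  {E : Type*} [NormedAddCommGroup E] [NormedSpace ℝ E]
  {M : Type*} [TopologicalSpace M] [ChartedSpace E M] [IsManifold 𝓘(ℝ, E) ∞ M]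
  [MulAction G M] [ContMDiffSMul 𝓘(ℝ, EG) 𝓘(ℝ, E) ∞ G M]

variable (EG G E M) in
omit [LieGroup 𝓘(ℝ, EG) ∞ G] [IsManifold 𝓘(ℝ, E) ∞ M] in
theorem contMDiff_smul_prod :
    ContMDiff (𝓘(ℝ, EG).prod 𝓘(ℝ, E)) 𝓘(ℝ, E) ∞ (fun p : G × M => p.1 • p.2) :=
  contMDiff_smul

omit [LieGroup 𝓘(ℝ, EG) ∞ G] [IsManifold 𝓘(ℝ, E) ∞ M] in
theorem contMDiff_orbit (x : M) :
    ContMDiff 𝓘(ℝ, EG) 𝓘(ℝ, E) ∞ (fun g : G => g • x) :=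
  (contMDiff_smul_prod EG G E M).comp (contMDiff_id.prodMk contMDiff_const)

omit [IsManifold 𝓘(ℝ, E) ∞ M] in
theorem contMDiff_orbit_inv (x : M) :
    ContMDiff 𝓘(ℝ, EG) 𝓘(ℝ, E) ∞ (fun g : G => g⁻¹ • x) :=
  (contMDiff_orbit x).comp (contMDiff_inv 𝓘(ℝ, EG) ∞)

theorem contMDiff_translation (EG : Type*) [NormedAddCommGroup EG] [NormedSpace ℝ EG]
    {G : Type*} [TopologicalSpace G] [ChartedSpace EG G] [Group G]
    (E : Type*) [NormedAddCommGroup E] [NormedSpace ℝ E]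
    (M : Type*) [TopologicalSpace M] [ChartedSpace E M]
    [MulAction G M] [ContMDiffSMul 𝓘(ℝ, EG) 𝓘(ℝ, E) ∞ G M] (g : G) :
    ContMDiff 𝓘(ℝ, E) 𝓘(ℝ, E) ∞ (fun x : M => g • x) :=
  ContMDiffSMul.contMDiff_const_smul (I := 𝓘(ℝ, EG)) g

/-- Every tangent space is the model space `E` by definition, so vectors at points that are only
propositionally equal can be compared in `E` without casts. -/
theorem tangentBundle_mk_eq {E : Type*} [NormedAddCommGroup E] [NormedSpace ℝ E]
    {M : Type*} [TopologicalSpace M] [ChartedSpace E M] {x y : M} (h : x = y) {v w : E} (hvw : v = w) :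
    (⟨x, v⟩ : TangentBundle 𝓘(ℝ, E) M) = ⟨y, w⟩ := by
  subst h
  rw [hvw]

/-- Fundamental vector fields are smooth. -/
theorem isSmoothField_fundamentalField (A : GroupLieAlgebra 𝓘(ℝ, EG) G) :
    IsSmoothField (fundamentalField (E := E) M A) := by
  -- The value of the fundamental field at `x` is the tangent map of the action at `(1, x)` applied
  -- to `(-A, 0)`, a composite of smooth maps.
  let f1 : M → TangentBundle 𝓘(ℝ, EG) G := fun _ => TotalSpace.mk' EG 1 (-A)
  have s1 : ContMDiff 𝓘(ℝ, E) 𝓘(ℝ, EG).tangent ∞ f1 := contMDiff_const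
  let f2 : M → TangentBundle 𝓘(ℝ, E) M := fun x => TotalSpace.mk' E x 0
  have s2 : ContMDiff 𝓘(ℝ, E) 𝓘(ℝ, E).tangent ∞ f2 := contMDiff_zeroSection _ _
  have s3 : ContMDiff 𝓘(ℝ, E) (𝓘(ℝ, EG).prod 𝓘(ℝ, E)).tangent ∞
      (fun x => (equivTangentBundleProd 𝓘(ℝ, EG) G 𝓘(ℝ, E) M).symm (f1 x, f2 x)) :=
    contMDiff_equivTangentBundleProd_symm.comp (s1.prodMk s2)
  have s4 : ContMDiff (𝓘(ℝ, EG).prod 𝓘(ℝ, E)).tangent 𝓘(ℝ, E).tangent ∞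
      (tangentMap (𝓘(ℝ, EG).prod 𝓘(ℝ, E)) 𝓘(ℝ, E) (fun p : G × M => p.1 • p.2)) :=
    (contMDiff_smul_prod EG G E M).contMDiff_tangentMap (m := ∞) (by simp)
  have s5 := s4.comp s3
  refine s5.congr fun x => ?_
  have hd : MDifferentiableAt (𝓘(ℝ, EG).prod 𝓘(ℝ, E)) 𝓘(ℝ, E) (fun p : G × M => p.1 • p.2)
      (1, x) := (contMDiff_smul_prod EG G E M).mdifferentiable (by simp) _
  set T : EG →L[ℝ] E := mfderiv 𝓘(ℝ, EG) 𝓘(ℝ, E) (fun g : G => g • x) 1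
  set T' : E →L[ℝ] E := mfderiv 𝓘(ℝ, E) 𝓘(ℝ, E) (fun y : M => (1 : G) • y) x
  have h3 : (mfderiv (𝓘(ℝ, EG).prod 𝓘(ℝ, E)) 𝓘(ℝ, E) (fun p : G × M => p.1 • p.2) (1, x)
      ((-A, 0) : EG × E) : E) = T (-A) + T' 0 :=
    mfderiv_prod_eq_add_apply (v := ((-A, 0) : EG × E)) hd
  have h4 : T (-A) + T' 0 = -T A := by
    rw [map_zero, add_zero]
    exact map_neg T A
  exact tangentBundle_mk_eq (one_smul G x).symm (h3.trans h4).symm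

omit [IsManifold 𝓘(ℝ, E) ∞ M] in
/-- The fundamental vector field in terms of the inverse orbit map. -/
theorem mfderiv_orbit_inv_one (A : GroupLieAlgebra 𝓘(ℝ, EG) G) (x : M) :
    (mfderiv 𝓘(ℝ, EG) 𝓘(ℝ, E) (fun g : G => g⁻¹ • x) 1 A : E) =
      fundamentalField (E := E) M A x := by
  -- The map `g ↦ (g⁻¹ * g) • x` is constant; differentiating it along the diagonal shows that
  -- inverting `g` changes the sign of the differential of the orbit map.
  have hf : ContMDiff (𝓘(ℝ, EG).prod 𝓘(ℝ, EG)) 𝓘(ℝ, E) ∞ (fun p : G × G => (p.1⁻¹ * p.2) • x) :=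
    (contMDiff_orbit x).comp (((contMDiff_inv 𝓘(ℝ, EG) ∞).comp contMDiff_fst).mul contMDiff_snd)
  have hd : MDifferentiableAt (𝓘(ℝ, EG).prod 𝓘(ℝ, EG)) 𝓘(ℝ, E)
      (fun p : G × G => (p.1⁻¹ * p.2) • x) (1, 1) := hf.mdifferentiable (by simp) _
  have h1 := mfderiv_prod_eq_add_apply (v := ((A, A) : EG × EG)) hd
  have h2 : MDifferentiableAt 𝓘(ℝ, EG) (𝓘(ℝ, EG).prod 𝓘(ℝ, EG)) (fun g : G => (g, g)) 1 :=
    mdifferentiableAt_id.prodMk mdifferentiableAt_id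
  have h3 := mfderiv_comp (1 : G) (f := fun g : G => (g, g)) hd h2
  have h4 : (fun p : G × G => (p.1⁻¹ * p.2) • x) ∘ (fun g : G => (g, g)) = fun _ => x := by
    funext g
    simp
  rw [h4, mfderiv_const] at h3
  set T : EG →L[ℝ] E := mfderiv 𝓘(ℝ, EG) 𝓘(ℝ, E) (fun g : G => g • x) 1
  set T' : EG →L[ℝ] E := mfderiv 𝓘(ℝ, EG) 𝓘(ℝ, E) (fun g : G => g⁻¹ • x) 1
  have h5 : (mfderiv (𝓘(ℝ, EG).prod 𝓘(ℝ, EG)) 𝓘(ℝ, E) (fun p : G × G => (p.1⁻¹ * p.2) • x) (1, 1)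
      ((A, A) : EG × EG) : E) = T' A + T A := by
    refine h1.trans ?_
    have e1 : (fun z : G => (z⁻¹ * 1) • x) = fun g => g⁻¹ • x := by simp
    have e2 : (fun z : G => ((1 : G)⁻¹ * z) • x) = fun g => g • x := by simp
    refine congrArg₂ (fun a b : E => a + b) ?_ ?_
    · exact congrArg (fun f : G → M => (mfderiv 𝓘(ℝ, EG) 𝓘(ℝ, E) f 1 A : E)) e1
    · exact congrArg (fun f : G → M => (mfderiv 𝓘(ℝ, EG) 𝓘(ℝ, E) f 1 A : E)) e2
  have h6 : mfderiv 𝓘(ℝ, EG) (𝓘(ℝ, EG).prod 𝓘(ℝ, EG)) (fun g : G => (g, g)) 1 A =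
      ((A, A) : EG × EG) := by
    have e1 : mfderiv 𝓘(ℝ, EG) (𝓘(ℝ, EG).prod 𝓘(ℝ, EG)) (fun g : G => (g, g)) 1 = _ :=
      ((hasMFDerivAt_id (1 : G)).prodMk (hasMFDerivAt_id (1 : G))).mfderiv
    exact congrArg (fun S : EG →L[ℝ] EG × EG => S A) e1
  have h7 : T' A + T A = 0 := by
    rw [← h5]
    refine Eq.trans ?_ (congrArg (fun S : EG →L[ℝ] E => S A) h3).symm
    exact congrArg (mfderiv (𝓘(ℝ, EG).prod 𝓘(ℝ, EG)) 𝓘(ℝ, E) (fun p : G × G => (p.1⁻¹ * p.2) • x)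
      (1, 1) : EG × EG →L[ℝ] E) h6.symm
  exact eq_neg_of_add_eq_zero_left h7

/-- The fundamental vector fields form a representation of the Lie algebra. -/
theorem bracket_fundamentalField [CompleteSpace EG] [CompleteSpace E]
    (A B : GroupLieAlgebra 𝓘(ℝ, EG) G) :
    bracket (fundamentalField (E := E) M A) (fundamentalField (E := E) M B) =
      fundamentalField (E := E) M ⁅A, B⁆ := by
  have : LieGroup 𝓘(ℝ, EG) (minSmoothness ℝ 3) G := LieGroup.of_le (n := ∞) (by simpa using ENat.LEInfty.out)
  funext x
  -- Because (gh)⁻¹x = h⁻¹(g⁻¹x), the left-invariant field of `A` is related to the fundamental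
  -- field of `A` by g ↦ g⁻¹x. Inversion absorbs the sign in exp(-tA), so the brackets correspond
  -- without a sign.
  have hrel : ∀ (A : GroupLieAlgebra 𝓘(ℝ, EG) G) (g : G),
      (mfderiv 𝓘(ℝ, EG) 𝓘(ℝ, E) (fun g : G => g⁻¹ • x) g (mulInvariantVectorField A g) : E) =
        fundamentalField (E := E) M A (g⁻¹ • x) := by
    intro A g
    refine Eq.trans ?_ (mfderiv_orbit_inv_one A (g⁻¹ • x))
    have e1 : (fun h : G => h⁻¹ • g⁻¹ • x) = (fun h : G => h⁻¹ • x) ∘ (fun h : G => g * h) := by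
      funext h
      simp [mul_smul]
    have h1 := mfderiv_comp (I := 𝓘(ℝ, EG)) (I' := 𝓘(ℝ, EG)) (I'' := 𝓘(ℝ, E)) (1 : G) (f := fun h : G => g * h) (g := fun h : G => h⁻¹ • x)
      ((contMDiff_orbit_inv x).mdifferentiable (by simp) _)
      ((contMDiff_mul_left (I := 𝓘(ℝ, EG)) (n := ∞) (a := g)).mdifferentiable (by simp) _)
    rw [← e1] at h1
    refine Eq.trans ?_ (congrArg (fun T : EG →L[ℝ] E => T A) h1).symm
    exact congrArg (fun h => (mfderiv 𝓘(ℝ, EG) 𝓘(ℝ, E) (fun g : G => g⁻¹ • x) h : EG →L[ℝ] E)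
      (mulInvariantVectorField A g)) (mul_one g).symm
  have h1 := mfderiv_mlieBracket_of_related (f := fun g : G => g⁻¹ • x) (x := (1 : G))
    (X := mulInvariantVectorField A) (Y := mulInvariantVectorField B)
    (X' := fundamentalField (E := E) M A) (Y' := fundamentalField (E := E) M B)
    ((contMDiff_orbit_inv x).contMDiffAt.of_le ENat.LEInfty.out)
    (mdifferentiableAt_mulInvariantVectorField A) (mdifferentiableAt_mulInvariantVectorField B)
    ((isSmoothField_fundamentalField A).mdifferentiable (by simp) _)
    ((isSmoothField_fundamentalField B).mdifferentiable (by simp) _)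
    (Eventually.of_forall (hrel A)) (Eventually.of_forall (hrel B))
  have h2 : (fundamentalField (E := E) M ⁅A, B⁆ ((1 : G)⁻¹ • x) : E) =
      bracket (fundamentalField (E := E) M A) (fundamentalField (E := E) M B) ((1 : G)⁻¹ • x) := by
    refine Eq.trans ?_ h1
    refine (mfderiv_orbit_inv_one ⁅A, B⁆ ((1 : G)⁻¹ • x)).symm.trans ?_
    have e1 : (1 : G)⁻¹ • x = x := by simp
    exact congrArg (fun y : M => (mfderiv 𝓘(ℝ, EG) 𝓘(ℝ, E) (fun g : G => g⁻¹ • y) 1 ⁅A, B⁆ : E)) e1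
  rw [inv_one, one_smul] at h2
  exact h2.symm

end LieGroupAction

theorem mem_of_hasDerivAt_of_eventually_mem {E : Type*} [NormedAddCommGroup E] [NormedSpace ℝ E]
    [FiniteDimensional ℝ E] (S : Submodule ℝ E) {u : ℝ → E} {u' : E} {t : ℝ}
    (hu : HasDerivAt u u' t) (hS : ∀ᶠ s in 𝓝 t, u s ∈ S) : u' ∈ S := by
  have h1 := hasDerivAt_iff_tendsto_slope.1 hu
  refine S.closed_of_finiteDimensional.mem_of_tendsto h1 ?_
  filter_upwards [hS.filter_mono nhdsWithin_le_nhds] with s hs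
  exact S.smul_mem _ (S.sub_mem hs hS.self_of_nhds)

section LieGroupAction

variable {EG : Type*} [NormedAddCommGroup EG] [NormedSpace ℝ EG]
  {G : Type*} [TopologicalSpace G] [ChartedSpace EG G] [Group G] [LieGroup 𝓘(ℝ, EG) ∞ G]
  {E : Type*} [NormedAddCommGroup E] [NormedSpace ℝ E]
  {M : Type*} [TopologicalSpace M] [ChartedSpace E M] [IsManifold 𝓘(ℝ, E) ∞ M]
  [MulAction G M] [ContMDiffSMul 𝓘(ℝ, EG) 𝓘(ℝ, E) ∞ G M]

/-- The velocity of a curve given in the preferred chart. -/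
theorem mfderiv_extChartAt_symm_comp {x : M} {c : ℝ → E} {v : TangentSpace 𝓘(ℝ, E) x}
    (hc0 : c 0 = extChartAt 𝓘(ℝ, E) x x)
    (hc : HasDerivAt c (mfderiv 𝓘(ℝ, E) 𝓘(ℝ, E) (extChartAt 𝓘(ℝ, E) x) x v) 0) :
    MDifferentiableAt 𝓘(ℝ, ℝ) 𝓘(ℝ, E) (fun t => (extChartAt 𝓘(ℝ, E) x).symm (c t)) 0 ∧
      (mfderiv 𝓘(ℝ, ℝ) 𝓘(ℝ, E) (fun t => (extChartAt 𝓘(ℝ, E) x).symm (c t)) 0 (1 : ℝ) : E) = v := by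
  set φ := extChartAt 𝓘(ℝ, E) x with hφ
  let dφ : E →L[ℝ] E := mfderiv 𝓘(ℝ, E) 𝓘(ℝ, E) φ x
  have hγ0 : φ.symm (c 0) = x := by rw [hc0]; exact extChartAt_to_inv x
  have hsymm : MDifferentiableAt 𝓘(ℝ, E) 𝓘(ℝ, E) φ.symm (c 0) := by
    rw [hc0]
    exact ((contMDiffOn_extChartAt_symm (n := ∞) x).contMDiffAt
      (extChartAt_target_mem_nhds x)).mdifferentiableAt (by simp)
  have hγ : MDifferentiableAt 𝓘(ℝ, ℝ) 𝓘(ℝ, E) (fun t => φ.symm (c t)) 0 :=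
    MDifferentiableAt.comp (0 : ℝ) (g := φ.symm) hsymm hc.differentiableAt.mdifferentiableAt
  refine ⟨hγ, ?_⟩
  have hφd : MDifferentiableAt 𝓘(ℝ, E) 𝓘(ℝ, E) φ (φ.symm (c 0)) := by
    rw [hγ0]
    exact (contMDiffAt_extChartAt (n := ∞)).mdifferentiableAt (by simp)
  have h1 := mfderiv_comp (0 : ℝ) (f := fun t => φ.symm (c t)) hφd hγ
  have h2 : φ ∘ (fun t => φ.symm (c t)) =ᶠ[𝓝 0] c := by
    have : ∀ᶠ t in 𝓝 (0 : ℝ), c t ∈ φ.target := by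
      refine hc.continuousAt.eventually ?_
      rw [hc0]
      exact extChartAt_target_mem_nhds (I := 𝓘(ℝ, E)) x
    filter_upwards [this] with t ht using φ.right_inv ht
  rw [h2.mfderiv_eq, mfderiv_eq_fderiv] at h1
  have h5 : (mfderiv 𝓘(ℝ, E) 𝓘(ℝ, E) φ (φ.symm (c 0)) : E →L[ℝ] E) = dφ :=
    congrArg (fun y : M => (show E →L[ℝ] E from mfderiv 𝓘(ℝ, E) 𝓘(ℝ, E) φ y)) hγ0
  have h6 : dφ (mfderiv 𝓘(ℝ, ℝ) 𝓘(ℝ, E) (fun t => φ.symm (c t)) 0 (1 : ℝ)) = dφ v := by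
    have h4 : fderiv ℝ c 0 1 = dφ v := hc.deriv
    rw [← h4, ← h5]
    exact (congrArg (fun S : ℝ →L[ℝ] E => S 1) h1).symm
  exact mfderiv_extChartAt_injective x h6

/-- A straight line in the preferred chart suffices; only the velocity at 0 matters, so no
one-parameter subgroup is needed. -/
theorem exists_curve_of_tangent (A : GroupLieAlgebra 𝓘(ℝ, EG) G) :
    ∃ γ : ℝ → G, γ 0 = 1 ∧ ContMDiffAt 𝓘(ℝ, ℝ) 𝓘(ℝ, EG) ∞ γ 0 ∧
      (mfderiv 𝓘(ℝ, ℝ) 𝓘(ℝ, EG) γ 0 (1 : ℝ) : EG) = A := by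
  set φ := extChartAt 𝓘(ℝ, EG) (1 : G) with hφ
  set dφ : EG →L[ℝ] EG := mfderiv 𝓘(ℝ, EG) 𝓘(ℝ, EG) φ 1 with hdφ
  have hsymm : ContMDiffAt 𝓘(ℝ, EG) 𝓘(ℝ, EG) ∞ φ.symm (φ 1) :=
    (contMDiffOn_extChartAt_symm 1).contMDiffAt (extChartAt_target_mem_nhds 1)
  set c : ℝ → EG := fun t => φ 1 + t • dφ A with hc
  have hc0 : c 0 = φ 1 := by simp [hc]
  have hcd : ContDiff ℝ ∞ c := contDiff_const.add (contDiff_id.smul contDiff_const)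
  have hγ : ContMDiffAt 𝓘(ℝ, ℝ) 𝓘(ℝ, EG) ∞ (fun t => φ.symm (c t)) 0 :=
    ContMDiffAt.comp (0 : ℝ) (g := φ.symm) (by rwa [hc0]) hcd.contMDiff.contMDiffAt
  have hγ0 : φ.symm (c 0) = 1 := by rw [hc0]; exact extChartAt_to_inv 1
  have h3 : HasDerivAt c (dφ A) 0 := by
    simpa [hc] using ((hasDerivAt_id (0 : ℝ)).smul_const (dφ A)).const_add (φ 1)
  exact ⟨fun t => φ.symm (c t), hγ0, hγ, (mfderiv_extChartAt_symm_comp hc0 h3).2⟩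

theorem mfderiv_translation_mul (EG : Type*) [NormedAddCommGroup EG] [NormedSpace ℝ EG]
    {G : Type*} [TopologicalSpace G] [ChartedSpace EG G] [Group G]
    {E : Type*} [NormedAddCommGroup E] [NormedSpace ℝ E]
    {M : Type*} [TopologicalSpace M] [ChartedSpace E M]
    [MulAction G M] [ContMDiffSMul 𝓘(ℝ, EG) 𝓘(ℝ, E) ∞ G M] (g h : G) (x : M) (v : E) :
    (mfderiv 𝓘(ℝ, E) 𝓘(ℝ, E) (fun y : M => g • y) (h • x)
      (mfderiv 𝓘(ℝ, E) 𝓘(ℝ, E) (fun y : M => h • y) x v : E) : E) =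
      mfderiv 𝓘(ℝ, E) 𝓘(ℝ, E) (fun y : M => (g * h) • y) x v := by
  have h1 := mfderiv_comp (I' := 𝓘(ℝ, E)) x (f := fun y : M => h • y) (g := fun y : M => g • y)
    ((contMDiff_translation EG E M g).mdifferentiable (by simp) _)
    ((contMDiff_translation EG E M h).mdifferentiable (by simp) _)
  have h2 : (fun y : M => g • y) ∘ (fun y : M => h • y) = fun y => (g * h) • y := by
    funext y
    simp [mul_smul]
  rw [h2] at h1
  exact (congrArg (fun S : E →L[ℝ] E => S v) h1).symm

theorem mfderiv_translation_one {G : Type*} [Group G]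
    {E : Type*} [NormedAddCommGroup E] [NormedSpace ℝ E]
    {M : Type*} [TopologicalSpace M] [ChartedSpace E M] [MulAction G M]
    {g : G} (hg : g = 1) (x : M) (v : E) :
    (mfderiv 𝓘(ℝ, E) 𝓘(ℝ, E) (fun y : M => g • y) x v : E) = v := by
  have : (fun y : M => g • y) = id := by funext y; simp [hg]
  rw [this, mfderiv_id]
  rfl

variable [FiniteDimensional ℝ E]

/-- A curve of velocity `-A` moves points with velocity `A^*`, so pulling `U` back along it
differentiates to the bracket. One curve serves all fields `U`, which permits comparing `U` with
`jU`. -/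
theorem exists_curve_hasDerivAt_pullback (A : GroupLieAlgebra 𝓘(ℝ, EG) G) (x : M) :
    ∃ γ : ℝ → G, Tendsto (fun t => γ t • x) (𝓝 0) (𝓝 x) ∧
      ∀ U : ∀ x : M, TangentSpace 𝓘(ℝ, E) x, FieldDiffAt U x →
        HasDerivAt (fun t => (mfderiv 𝓘(ℝ, E) 𝓘(ℝ, E) (fun y : M => (γ t)⁻¹ • y) (γ t • x)
          (U (γ t • x)) : E)) (bracket (fundamentalField (E := E) M A) U x) 0 := by
  obtain ⟨γ, hγ0, hγ, hγA⟩ := exists_curve_of_tangent (-A)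
  have := FiniteDimensional.complete ℝ E
  have hγd := hγ.mdifferentiableAt (by simp)
  refine ⟨γ, ?_, fun U hU => ?_⟩
  · have h1 : ContinuousAt (fun t => γ t • x) 0 :=
      ContinuousAt.comp (g := fun g : G => g • x) (contMDiff_orbit (E := E) (EG := EG) x).continuous.continuousAt
        hγ.continuousAt
    rwa [ContinuousAt, hγ0, one_smul] at h1
  refine hasDerivAt_of_mfderiv_eq (θ := fun t y => γ t • y) ?_ (fun y => by rw [hγ0, one_smul])
    (fun y => ?_) ((isSmoothField_fundamentalField A).mdifferentiable (by simp) _) hU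
    (Eventually.of_forall fun t => ?_)
  · refine ContMDiffAt.of_le ?_ (ENat.LEInfty.out : (2 : WithTop ℕ∞) ≤ ∞)
    refine ContMDiffAt.comp ((0 : ℝ), x) (g := fun p : G × M => p.1 • p.2)
      (f := fun p : ℝ × M => (γ p.1, p.2))
      (contMDiff_smul_prod EG G E M).contMDiffAt ?_
    exact ContMDiffAt.prodMk (ContMDiffAt.comp ((0 : ℝ), x) (g := γ) hγ contMDiffAt_fst)
      contMDiffAt_snd
  · have h1 := mfderiv_comp (I' := 𝓘(ℝ, EG)) (0 : ℝ) (f := γ) (g := fun g : G => g • y)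
      ((contMDiff_orbit (E := E) y).mdifferentiable (by simp) _) hγd
    refine (congrArg (fun S : ℝ →L[ℝ] E => S 1) h1).trans ?_
    have h2 : (mfderiv 𝓘(ℝ, EG) 𝓘(ℝ, E) (fun g : G => g • y) (γ 0) : EG →L[ℝ] E) =
      mfderiv 𝓘(ℝ, EG) 𝓘(ℝ, E) (fun g : G => g • y) 1 :=
      congrArg (fun h : G => (show EG →L[ℝ] E from
        mfderiv 𝓘(ℝ, EG) 𝓘(ℝ, E) (fun g : G => g • y) h)) hγ0
    refine (congrArg₂ (fun (S : EG →L[ℝ] E) (v : EG) => S v) h2 hγA).trans ?_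
    exact map_neg (mfderiv 𝓘(ℝ, EG) 𝓘(ℝ, E) (fun g : G => g • y) 1 : EG →L[ℝ] E) A
  · have h1 := mfderiv_translation_mul (E := E) EG (γ t) (γ t)⁻¹ (γ t • x) (U (γ t • x))
    replace h1 := h1.trans (mfderiv_translation_one (E := E) (mul_inv_cancel (γ t)) (γ t • x) (U (γ t • x)))
    refine Eq.trans ?_ h1
    exact congrArg (fun z : M => (mfderiv 𝓘(ℝ, E) 𝓘(ℝ, E) (fun y : M => γ t • y) z : E →L[ℝ] E)
      (mfderiv 𝓘(ℝ, E) 𝓘(ℝ, E) (fun y : M => (γ t)⁻¹ • y) (γ t • x) (U (γ t • x)) : E))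
      (inv_smul_smul _ _).symm

/-- A fundamental vector field preserves sections of an invariant distribution. -/
theorem bracket_fundamentalField_mem {D : ∀ x : M, Submodule ℝ (TangentSpace 𝓘(ℝ, E) x)}
    (hD : ∀ (g : G) (x : M), ∀ v ∈ D x,
      mfderiv 𝓘(ℝ, E) 𝓘(ℝ, E) (fun y : M => g • y) x v ∈ D (g • x))
    (A : GroupLieAlgebra 𝓘(ℝ, EG) G) {F : ∀ x : M, TangentSpace 𝓘(ℝ, E) x} {x : M}
    (hF : FieldDiffAt F x) (hFD : ∀ᶠ y in 𝓝 x, F y ∈ D y) :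
    bracket (fundamentalField (E := E) M A) F x ∈ D x := by
  obtain ⟨γ, hγ, h⟩ := exists_curve_hasDerivAt_pullback (E := E) A x
  refine mem_of_hasDerivAt_of_eventually_mem (E := E) (D x) (h F hF) ?_
  filter_upwards [hγ.eventually hFD] with t ht
  have h1 := hD (γ t)⁻¹ _ _ ht
  have h2 : ∀ {y : M} (w : E), y = x → w ∈ (D y : Submodule ℝ E) →
      w ∈ (D x : Submodule ℝ E) := by
    rintro y w rfl hw
    exact hw
  exact h2 _ (inv_smul_smul _ _) h1

/-- An invariant field of endomorphisms commutes with fundamental vector fields. -/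
theorem bracket_fundamentalField_endApply
    {j : ∀ x : M, TangentSpace 𝓘(ℝ, E) x →L[ℝ] TangentSpace 𝓘(ℝ, E) x} (hj : IsSmoothEnd j)
    (hinv : IsInvariantEnd G j) (A : GroupLieAlgebra 𝓘(ℝ, EG) G)
    {U : ∀ x : M, TangentSpace 𝓘(ℝ, E) x} {x : M} (hU : FieldDiffAt U x) :
    bracket (fundamentalField (E := E) M A) (endApply j U) x =
      j x (bracket (fundamentalField (E := E) M A) U x) := by
  obtain ⟨γ, -, h⟩ := exists_curve_hasDerivAt_pullback (E := E) A x
  have h1 := h _ (hU.endApply hj)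
  let T : E →L[ℝ] E := j x
  have h2 := T.hasFDerivAt.comp_hasDerivAt (0 : ℝ) (h U hU)
  refine HasDerivAt.unique (F := E) h1 (h2.congr_of_eventuallyEq (Eventually.of_forall fun t => ?_))
  refine (hinv (γ t)⁻¹ (γ t • x) (U (γ t • x))).trans ?_
  exact congrArg (fun z : M => (show E →L[ℝ] E from j z)
    (mfderiv 𝓘(ℝ, E) 𝓘(ℝ, E) (fun y : M => (γ t)⁻¹ • y) (γ t • x) (U (γ t • x)) : E))
    (inv_smul_smul (γ t) x)

end LieGroupAction

/-! ### Orbit maps are submersions; the Lie algebra of a stabilizer -/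

section LieGroupAction

variable {EG : Type*} [NormedAddCommGroup EG] [NormedSpace ℝ EG]
  {G : Type*} [TopologicalSpace G] [ChartedSpace EG G] [Group G] [LieGroup 𝓘(ℝ, EG) ∞ G]
  {E : Type*} [NormedAddCommGroup E] [NormedSpace ℝ E]
  {M : Type*} [TopologicalSpace M] [ChartedSpace E M] [IsManifold 𝓘(ℝ, E) ∞ M]
  [MulAction G M] [ContMDiffSMul 𝓘(ℝ, EG) 𝓘(ℝ, E) ∞ G M]

/-- The differential of an orbit map at the neutral element. -/
noncomputable def orbitDeriv (EG : Type*) [NormedAddCommGroup EG] [NormedSpace ℝ EG]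
    (G : Type*) [TopologicalSpace G] [ChartedSpace EG G] [Group G]
    (E : Type*) [NormedAddCommGroup E] [NormedSpace ℝ E]
    {M : Type*} [TopologicalSpace M] [ChartedSpace E M] [MulAction G M] (x : M) : EG →L[ℝ] E :=
  mfderiv 𝓘(ℝ, EG) 𝓘(ℝ, E) (fun g : G => g • x) 1

/-- The orbit map of a point in the preferred charts. -/
noncomputable def orbitChart (EG : Type*) [NormedAddCommGroup EG] [NormedSpace ℝ EG]
    (G : Type*) [TopologicalSpace G] [ChartedSpace EG G] [Group G]
    (E : Type*) [NormedAddCommGroup E] [NormedSpace ℝ E]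
    {M : Type*} [TopologicalSpace M] [ChartedSpace E M] [MulAction G M] (x : M) : EG → E :=
  fun v => extChartAt 𝓘(ℝ, E) x ((extChartAt 𝓘(ℝ, EG) (1 : G)).symm v • x)

/-- The domain of the orbit map in the preferred charts. -/
def orbitChartSource (EG : Type*) [NormedAddCommGroup EG] [NormedSpace ℝ EG]
    (G : Type*) [TopologicalSpace G] [ChartedSpace EG G] [Group G]
    (E : Type*) [NormedAddCommGroup E] [NormedSpace ℝ E]
    {M : Type*} [TopologicalSpace M] [ChartedSpace E M] [MulAction G M] (x : M) : Set EG :=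
  (extChartAt 𝓘(ℝ, EG) (1 : G)).target ∩ (extChartAt 𝓘(ℝ, EG) (1 : G)).symm ⁻¹'
    {h | h • x ∈ (extChartAt 𝓘(ℝ, E) x).source}

theorem isOpen_orbitChartSource (x : M) : IsOpen (orbitChartSource EG G E x) := by
  refine (continuousOn_extChartAt_symm (I := 𝓘(ℝ, EG)) (1 : G)).isOpen_inter_preimage
    (isOpen_extChartAt_target _) ?_
  exact (isOpen_extChartAt_source (I := 𝓘(ℝ, E)) x).preimage
    (contMDiff_orbit (E := E) (EG := EG) x).continuous

theorem mem_orbitChartSource (x : M) :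
    extChartAt 𝓘(ℝ, EG) (1 : G) 1 ∈ orbitChartSource EG G E x := by
  refine ⟨mem_extChartAt_target _, ?_⟩
  change (extChartAt 𝓘(ℝ, EG) (1 : G)).symm (extChartAt 𝓘(ℝ, EG) (1 : G) 1) • x ∈
    (extChartAt 𝓘(ℝ, E) x).source
  rw [extChartAt_to_inv, one_smul]
  exact mem_extChartAt_source x

theorem contMDiffAt_orbitChart {x : M} {v : EG} (hv : v ∈ orbitChartSource EG G E x) :
    ContMDiffAt 𝓘(ℝ, EG) 𝓘(ℝ, E) ∞ (orbitChart EG G E x) v := by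
  have h1 : ContMDiffAt 𝓘(ℝ, EG) 𝓘(ℝ, EG) ∞ (extChartAt 𝓘(ℝ, EG) (1 : G)).symm v :=
    (contMDiffOn_extChartAt_symm 1).contMDiffAt ((isOpen_extChartAt_target _).mem_nhds hv.1)
  have h2 : ContMDiffAt 𝓘(ℝ, E) 𝓘(ℝ, E) ∞ (extChartAt 𝓘(ℝ, E) x)
      ((extChartAt 𝓘(ℝ, EG) (1 : G)).symm v • x) :=
    contMDiffAt_extChartAt' (by simpa using hv.2)
  exact ContMDiffAt.comp v h2 (ContMDiffAt.comp v (contMDiff_orbit x).contMDiffAt h1)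

theorem contDiffOn_orbitChart (x : M) :
    ContDiffOn ℝ ∞ (orbitChart EG G E x) (orbitChartSource EG G E x) := fun _ hv =>
  (contMDiffAt_orbitChart hv).contDiffAt.contDiffWithinAt

/-- Homogeneity of the orbit maps. -/
theorem mfderiv_orbit_eq_comp (x : M) (h : G) :
    ∃ (L : E →L[ℝ] E) (R : EG →L[ℝ] EG),
      (mfderiv 𝓘(ℝ, EG) 𝓘(ℝ, E) (fun g : G => g • x) h : EG →L[ℝ] E) =
        L.comp ((orbitDeriv EG G E x).comp R) := by
  have e1 : (fun g : G => g • x) =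
      (fun y : M => h • y) ∘ (fun g : G => g • x) ∘ (fun g : G => h⁻¹ * g) := by
    funext g
    simp [← mul_smul]
  have hm := (contMDiff_mul_left (I := 𝓘(ℝ, EG)) (n := ∞) (a := h⁻¹)).mdifferentiable (by simp) h
  have ho : MDifferentiableAt 𝓘(ℝ, EG) 𝓘(ℝ, E) (fun g : G => g • x) (h⁻¹ * h) :=
    (contMDiff_orbit (E := E) (EG := EG) x).mdifferentiable (by simp) _
  have h1 := HasMFDerivAt.comp h ho.hasMFDerivAt hm.hasMFDerivAt
  have ht : MDifferentiableAt 𝓘(ℝ, E) 𝓘(ℝ, E) (fun y : M => h • y) ((h⁻¹ * h) • x) :=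
    (contMDiff_translation EG E M h).mdifferentiable (by simp) _
  have h2 := (HasMFDerivAt.comp h ht.hasMFDerivAt h1).mfderiv
  rw [← e1] at h2
  have h3 : (mfderiv 𝓘(ℝ, EG) 𝓘(ℝ, E) (fun g : G => g • x) (h⁻¹ * h) : EG →L[ℝ] E) =
      orbitDeriv EG G E x :=
    congrArg (fun k : G => (show EG →L[ℝ] E from
        mfderiv 𝓘(ℝ, EG) 𝓘(ℝ, E) (fun g : G => g • x) k)) (inv_mul_cancel h)
  refine ⟨mfderiv 𝓘(ℝ, E) 𝓘(ℝ, E) (fun y : M => h • y) ((h⁻¹ * h) • x),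
    mfderiv 𝓘(ℝ, EG) 𝓘(ℝ, EG) (fun g : G => h⁻¹ * g) h, h2.trans ?_⟩
  rw [← h3]
  rfl

/-- The factorisation is used for ranks: nowhere in the chart does the rank of the orbit map exceed
its rank at the neutral element. -/
theorem fderiv_orbitChart {x : M} {v : EG} (hv : v ∈ orbitChartSource EG G E x) :
    ∃ (L : E →L[ℝ] E) (R : EG →L[ℝ] EG),
      fderiv ℝ (orbitChart EG G E x) v = L.comp ((orbitDeriv EG G E x).comp R) := by
  obtain ⟨L, R, hLR⟩ := mfderiv_orbit_eq_comp (EG := EG) (E := E) x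
    ((extChartAt 𝓘(ℝ, EG) (1 : G)).symm v)
  have h1 : MDifferentiableAt 𝓘(ℝ, EG) 𝓘(ℝ, EG) (extChartAt 𝓘(ℝ, EG) (1 : G)).symm v :=
    ((contMDiffOn_extChartAt_symm (n := ∞) 1).contMDiffAt
      ((isOpen_extChartAt_target _).mem_nhds hv.1)).mdifferentiableAt (by simp)
  have h2 : MDifferentiableAt 𝓘(ℝ, E) 𝓘(ℝ, E) (extChartAt 𝓘(ℝ, E) x)
      ((extChartAt 𝓘(ℝ, EG) (1 : G)).symm v • x) :=
    (contMDiffAt_extChartAt' (n := ∞) (by simpa using hv.2)).mdifferentiableAt (by simp)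
  have ho : MDifferentiableAt 𝓘(ℝ, EG) 𝓘(ℝ, E) (fun g : G => g • x)
      ((extChartAt 𝓘(ℝ, EG) (1 : G)).symm v) :=
    (contMDiff_orbit (E := E) (EG := EG) x).mdifferentiable (by simp) _
  have h3 := (HasMFDerivAt.comp v h2.hasMFDerivAt
    (HasMFDerivAt.comp v ho.hasMFDerivAt h1.hasMFDerivAt)).mfderiv
  rw [mfderiv_eq_fderiv] at h3
  let L' : E →L[ℝ] E := mfderiv 𝓘(ℝ, E) 𝓘(ℝ, E) (extChartAt 𝓘(ℝ, E) x)
      ((extChartAt 𝓘(ℝ, EG) (1 : G)).symm v • x)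
  let R' : EG →L[ℝ] EG := mfderiv 𝓘(ℝ, EG) 𝓘(ℝ, EG) (extChartAt 𝓘(ℝ, EG) (1 : G)).symm v
  refine ⟨L'.comp L, R.comp R', ?_⟩
  refine Eq.trans h3 ?_
  exact (congrArg (fun S : EG →L[ℝ] E => L'.comp (S.comp R')) hLR)

theorem fderiv_orbitChart_one (x : M) (v : EG) :
    fderiv ℝ (orbitChart EG G E x) (extChartAt 𝓘(ℝ, EG) (1 : G) 1)
      (mfderiv 𝓘(ℝ, EG) 𝓘(ℝ, EG) (extChartAt 𝓘(ℝ, EG) (1 : G)) 1 v) =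
      (mfderiv 𝓘(ℝ, E) 𝓘(ℝ, E) (extChartAt 𝓘(ℝ, E) x) x (orbitDeriv EG G E x v) : E) := by
  have hφ : MDifferentiableAt 𝓘(ℝ, EG) 𝓘(ℝ, EG) (extChartAt 𝓘(ℝ, EG) (1 : G)) 1 :=
    (contMDiffAt_extChartAt (n := ∞)).mdifferentiableAt (by simp)
  have hf := ((contMDiffAt_orbitChart (EG := EG) (G := G) (E := E) (mem_orbitChartSource x)).mdifferentiableAt
    (by simp))
  have h1 := (HasMFDerivAt.comp (1 : G) hf.hasMFDerivAt hφ.hasMFDerivAt).mfderiv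
  have hg : MDifferentiableAt 𝓘(ℝ, E) 𝓘(ℝ, E) (extChartAt 𝓘(ℝ, E) x) ((1 : G) • x) := by
    rw [one_smul]
    exact (contMDiffAt_extChartAt (n := ∞)).mdifferentiableAt (by simp)
  have ho : MDifferentiableAt 𝓘(ℝ, EG) 𝓘(ℝ, E) (fun g : G => g • x) 1 :=
    (contMDiff_orbit (E := E) (EG := EG) x).mdifferentiable (by simp) _
  have h2 := (HasMFDerivAt.comp (1 : G) hg.hasMFDerivAt ho.hasMFDerivAt).mfderiv
  have h3 : orbitChart EG G E x ∘ extChartAt 𝓘(ℝ, EG) (1 : G) =ᶠ[𝓝 1]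
      extChartAt 𝓘(ℝ, E) x ∘ (fun g : G => g • x) := by
    filter_upwards [extChartAt_source_mem_nhds (I := 𝓘(ℝ, EG)) (1 : G)] with g hg
    simp only [orbitChart, Function.comp_apply]
    rw [(extChartAt 𝓘(ℝ, EG) (1 : G)).left_inv hg]
  have h4 : (mfderiv 𝓘(ℝ, EG) 𝓘(ℝ, E) (orbitChart EG G E x ∘ extChartAt 𝓘(ℝ, EG) (1 : G)) 1 :
      EG →L[ℝ] E) = mfderiv 𝓘(ℝ, EG) 𝓘(ℝ, E) (extChartAt 𝓘(ℝ, E) x ∘ (fun g : G => g • x)) 1 :=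
    h3.mfderiv_eq
  have h5 := congrArg (fun S : EG →L[ℝ] E => S v) ((h1.symm.trans h4).trans h2)
  rw [mfderiv_eq_fderiv] at h5
  refine h5.trans ?_
  exact congrArg (fun y : M => (show E →L[ℝ] E from
    mfderiv 𝓘(ℝ, E) 𝓘(ℝ, E) (extChartAt 𝓘(ℝ, E) x) y) (orbitDeriv EG G E x v)) (one_smul G x)

theorem finrank_range_comp_le [FiniteDimensional ℝ EG] [FiniteDimensional ℝ E]
    (L : E →L[ℝ] E) (T : EG →L[ℝ] E) (R : EG →L[ℝ] EG) :
    Module.finrank ℝ (LinearMap.range (L.comp (T.comp R) : EG →ₗ[ℝ] E)) ≤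
      Module.finrank ℝ (LinearMap.range (T : EG →ₗ[ℝ] E)) := by
  have h1 : (L.comp (T.comp R) : EG →ₗ[ℝ] E) = (L : E →ₗ[ℝ] E) ∘ₗ ((T : EG →ₗ[ℝ] E) ∘ₗ R) := rfl
  rw [h1, LinearMap.range_comp]
  exact (Submodule.finrank_map_le _ _).trans
    (Submodule.finrank_mono (LinearMap.range_comp_le_range _ _))

/-- Orbit maps of a transitive action are submersions. -/
theorem orbitDeriv_surjective [FiniteDimensional ℝ EG] [FiniteDimensional ℝ E] [T2Space M]
    [SecondCountableTopology G] [MulAction.IsPretransitive G M] (x : M) :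
    Function.Surjective (orbitDeriv EG G E x) := by
  by_contra hns
  set a := extChartAt 𝓘(ℝ, EG) (1 : G) 1 with ha
  set f := orbitChart EG G E x with hf
  have hrange : Module.finrank ℝ (LinearMap.range (orbitDeriv EG G E x : EG →ₗ[ℝ] E)) ≤
      Module.finrank ℝ (LinearMap.range (fderiv ℝ f a : EG →ₗ[ℝ] E)) := by
    let dg : E →L[ℝ] E := mfderiv 𝓘(ℝ, E) 𝓘(ℝ, E) (extChartAt 𝓘(ℝ, E) x) x
    let dφ : EG →L[ℝ] EG := mfderiv 𝓘(ℝ, EG) 𝓘(ℝ, EG) (extChartAt 𝓘(ℝ, EG) (1 : G)) 1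
    let dgi : E →L[ℝ] E := (mfderiv 𝓘(ℝ, E) 𝓘(ℝ, E) (extChartAt 𝓘(ℝ, E) x) x).inverse
    have h1 : orbitDeriv EG G E x = dgi.comp ((fderiv ℝ f a).comp dφ) := by
      ext v
      have h2 : fderiv ℝ f a (dφ v) = dg (orbitDeriv EG G E x v) := fderiv_orbitChart_one x v
      change _ = dgi (fderiv ℝ f a (dφ v))
      rw [h2]
      exact ((isInvertible_mfderiv_extChartAt
        (mem_extChartAt_source (I := 𝓘(ℝ, E)) x)).inverse_apply_self _).symm
    rw [h1]
    exact finrank_range_comp_le _ _ _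
  have hne : LinearMap.range (fderiv ℝ f a : EG →ₗ[ℝ] E) ≠ ⊤ := by
    intro h
    apply hns
    have h1 : LinearMap.range (orbitDeriv EG G E x : EG →ₗ[ℝ] E) = ⊤ := by
      obtain ⟨L, R, hLR⟩ := fderiv_orbitChart (E := E) (mem_orbitChartSource (EG := EG) (G := G) x)
      refine Submodule.eq_top_of_finrank_eq (le_antisymm (Submodule.finrank_le _) ?_)
      rw [← finrank_top ℝ E, ← h]
      change Module.finrank ℝ (LinearMap.range (fderiv ℝ f a : EG →ₗ[ℝ] E)) ≤ _
      rw [hLR]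
      exact finrank_range_comp_le _ _ _
    exact LinearMap.range_eq_top.1 h1
  -- If the rank, which is maximal at the neutral element, were not full, a neighbourhood of that
  -- element would sweep out a set that is not a neighbourhood of `x`.
  obtain ⟨N, hN, hfN⟩ := exists_image_notMem_nhds_of_rank_le (isOpen_orbitChartSource x)
    (contDiffOn_orbitChart x) (mem_orbitChartSource x) (fun y hy => by
      obtain ⟨L, R, hLR⟩ := fderiv_orbitChart hy
      rw [hLR]
      exact (finrank_range_comp_le _ _ _).trans hrange) hne
  apply hfN
  have : ContinuousSMul G M := ContMDiffSMul.continuousSMul (I := 𝓘(ℝ, EG)) (I' := 𝓘(ℝ, E)) ∞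
  have : IsTopologicalGroup G := topologicalGroup_of_lieGroup 𝓘(ℝ, EG) ∞
  have : LocallyCompactSpace G := ChartedSpace.locallyCompactSpace EG G
  have : LocallyCompactSpace M := ChartedSpace.locallyCompactSpace E M
  set φ := extChartAt 𝓘(ℝ, EG) (1 : G) with hφ
  have hN' : φ.source ∩ φ ⁻¹' N ∈ 𝓝 (1 : G) :=
    inter_mem (extChartAt_source_mem_nhds _) ((continuousAt_extChartAt _).preimage_mem_nhds hN)
  -- The contradiction is the open mapping property of transitive actions of σ-compact groups, a
  -- Baire category argument: second countability of `G` and local compactness enter here.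
  have h1 := smul_singleton_mem_nhds_of_sigmaCompact hN' x
  have hfa : f a = extChartAt 𝓘(ℝ, E) x x := by
    change extChartAt 𝓘(ℝ, E) x (φ.symm (φ 1) • x) = _
    rw [hφ, extChartAt_to_inv, one_smul]
  change f '' N ∈ 𝓝 (f a)
  rw [hfa]
  have h2 : extChartAt 𝓘(ℝ, E) x '' ((φ.source ∩ φ ⁻¹' N) • {x}) ∈
      𝓝 (extChartAt 𝓘(ℝ, E) x x) := by
    rw [← map_extChartAt_nhds_of_boundaryless]
    exact image_mem_map h1
  refine mem_of_superset h2 ?_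
  rintro _ ⟨_, ⟨g, ⟨hg1, hg2⟩, y, hy, rfl⟩, rfl⟩
  rw [mem_singleton_iff.1 hy]
  refine ⟨φ g, hg2, ?_⟩
  change extChartAt 𝓘(ℝ, E) x (φ.symm (φ g) • x) = _
  rw [φ.left_inv hg1]

/-- Every tangent vector is a value of a fundamental vector field. -/
theorem exists_fundamentalField_eq [FiniteDimensional ℝ EG] [FiniteDimensional ℝ E] [T2Space M]
    [SecondCountableTopology G] [MulAction.IsPretransitive G M] (x : M)
    (v : TangentSpace 𝓘(ℝ, E) x) :
    ∃ A : GroupLieAlgebra 𝓘(ℝ, EG) G, fundamentalField (E := E) M A x = v := by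
  obtain ⟨A, hA⟩ := orbitDeriv_surjective (EG := EG) (G := G) (E := E) x (-(v : E))
  exact ⟨A, neg_eq_iff_eq_neg.2 hA⟩

/-- The Lie algebra of a stabilizer consists of the elements whose fundamental vector field
vanishes at the point. -/
theorem mem_subgroupLieAlgebra_stabilizer_iff [FiniteDimensional ℝ EG] [FiniteDimensional ℝ E]
    [T2Space M] [SecondCountableTopology G] [MulAction.IsPretransitive G M] {x : M}
    {A : GroupLieAlgebra 𝓘(ℝ, EG) G} :
    A ∈ subgroupLieAlgebra (MulAction.stabilizer G x) ↔ fundamentalField (E := E) M A x = 0 := by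
  have hiff : fundamentalField (E := E) M A x = 0 ↔ orbitDeriv EG G E x A = 0 :=
    neg_eq_zero (a := orbitDeriv EG G E x A)
  rw [hiff]
  constructor
  · rintro ⟨γ, hγ0, hγH, hγd, hγA⟩
    have ho : MDifferentiableAt 𝓘(ℝ, EG) 𝓘(ℝ, E) (fun g : G => g • x) (γ 0) :=
      (contMDiff_orbit (E := E) (EG := EG) x).mdifferentiable (by simp) _
    have h1 := (HasMFDerivAt.comp (0 : ℝ) ho.hasMFDerivAt hγd.hasMFDerivAt).mfderiv
    have h2 : (fun g : G => g • x) ∘ γ = fun _ => x := funext fun t => hγH t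
    rw [h2, mfderiv_const] at h1
    have h3 := congrArg (fun S : ℝ →L[ℝ] E => S 1) h1
    have h4 : (show EG →L[ℝ] E from mfderiv 𝓘(ℝ, EG) 𝓘(ℝ, E) (fun g : G => g • x) (γ 0)) =
        orbitDeriv EG G E x :=
      congrArg (fun h : G => (show EG →L[ℝ] E from
        mfderiv 𝓘(ℝ, EG) 𝓘(ℝ, E) (fun g : G => g • x) h)) hγ0
    exact (congrArg₂ (fun (S : EG →L[ℝ] E) (v : EG) => S v) h4.symm hγA.symm).trans h3.symm
  · intro hA
    have := FiniteDimensional.complete ℝ E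
    have := FiniteDimensional.complete ℝ EG
    set φ := extChartAt 𝓘(ℝ, EG) (1 : G) with hφ
    set a := φ 1 with ha
    set f := orbitChart EG G E x with hf
    let dφ : EG →L[ℝ] EG := mfderiv 𝓘(ℝ, EG) 𝓘(ℝ, EG) φ 1
    have hstrict : HasStrictFDerivAt f (fderiv ℝ f a) a :=
      (contMDiffAt_orbitChart (mem_orbitChartSource x)).contDiffAt.hasStrictFDerivAt (by simp)
    have hdf : ∀ v : EG, fderiv ℝ f a (dφ v) =
        (mfderiv 𝓘(ℝ, E) 𝓘(ℝ, E) (extChartAt 𝓘(ℝ, E) x) x (orbitDeriv EG G E x v) : E) :=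
      fun v => fderiv_orbitChart_one x v
    have hsurj : (fderiv ℝ f a : EG →L[ℝ] E).range = ⊤ := by
      refine LinearMap.range_eq_top.2 fun w => ?_
      obtain ⟨v, hv⟩ := orbitDeriv_surjective (EG := EG) (G := G) (E := E) x
        ((mfderiv 𝓘(ℝ, E) 𝓘(ℝ, E) (extChartAt 𝓘(ℝ, E) x) x).inverse w)
      refine ⟨dφ v, (hdf v).trans ?_⟩
      rw [hv]
      exact (isInvertible_mfderiv_extChartAt
        (mem_extChartAt_source (I := 𝓘(ℝ, E)) x)).self_apply_inverse w
    have hker : dφ A ∈ (fderiv ℝ f a : EG →L[ℝ] E).ker := by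
      refine LinearMap.mem_ker.2 ((hdf A).trans ?_)
      rw [hA]
      exact map_zero _
    -- The implicit function theorem gives a curve in the fibre of the orbit map with the prescribed
    -- kernel vector as velocity.
    set c : ℝ → EG := fun t => hstrict.implicitFunction f _ hsurj (f a) (t • ⟨dφ A, hker⟩) with hc
    have hc0 : c 0 = a := by
      simp only [hc]
      rw [zero_smul]
      exact hstrict.implicitFunction_apply_image hsurj
    have hcd : HasDerivAt c (dφ A) 0 := by
      have h1 : HasDerivAt (fun t : ℝ => t • (⟨dφ A, hker⟩ : (fderiv ℝ f a : EG →L[ℝ] E).ker))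
          ⟨dφ A, hker⟩ 0 := by
        simpa using (hasDerivAt_id (0 : ℝ)).smul_const
          (⟨dφ A, hker⟩ : (fderiv ℝ f a : EG →L[ℝ] E).ker)
      have h2 := (hstrict.to_implicitFunction hsurj).hasFDerivAt
      rw [← zero_smul ℝ (⟨dφ A, hker⟩ : (fderiv ℝ f a : EG →L[ℝ] E).ker)] at h2
      exact h2.comp_hasDerivAt (0 : ℝ) h1
    have hfc : ∀ᶠ t in 𝓝 (0 : ℝ), f (c t) = f a := by
      have h1 : Tendsto (fun t : ℝ => (f a, t • (⟨dφ A, hker⟩ : (fderiv ℝ f a : EG →L[ℝ] E).ker)))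
          (𝓝 0) (𝓝 (f a, 0)) := by
        have : Continuous (fun t : ℝ => (f a,
            t • (⟨dφ A, hker⟩ : (fderiv ℝ f a : EG →L[ℝ] E).ker))) := by fun_prop
        simpa using this.tendsto 0
      exact h1.eventually (hstrict.map_implicitFunction_eq hsurj)
    have hstab : ∀ᶠ t in 𝓝 (0 : ℝ), φ.symm (c t) • x = x := by
      have h1 : ∀ᶠ t in 𝓝 (0 : ℝ), c t ∈ orbitChartSource EG G E x := by
        refine hcd.continuousAt.eventually ?_
        rw [hc0]
        exact (isOpen_orbitChartSource x).mem_nhds (mem_orbitChartSource x)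
      filter_upwards [h1, hfc] with t ht hft
      refine (extChartAt 𝓘(ℝ, E) x).injOn ht.2 (mem_extChartAt_source x) (hft.trans ?_)
      change extChartAt 𝓘(ℝ, E) x (φ.symm (φ 1) • x) = _
      rw [hφ, extChartAt_to_inv, one_smul]
    have hφ0 : φ.symm (c 0) = 1 := by
      rw [hc0]
      exact extChartAt_to_inv 1
    classical
    -- The curve must lie in the stabilizer for every `t`, whereas the implicit function controls
    -- only small `t`; elsewhere the value 1 is substituted.
    set γ : ℝ → G := fun t => if φ.symm (c t) • x = x then φ.symm (c t) else 1 with hγ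
    have hγev : γ =ᶠ[𝓝 0] fun t => φ.symm (c t) := hstab.mono fun t ht => if_pos ht
    obtain ⟨hd, hdA⟩ := mfderiv_extChartAt_symm_comp hc0 hcd
    refine ⟨γ, ?_, fun t => ?_, hd.congr_of_eventuallyEq hγev, ?_⟩
    · rw [hγev.self_of_nhds]
      exact hφ0
    · rw [MulAction.mem_stabilizer_iff]
      simp only [hγ]
      split_ifs with h
      · exact h
      · exact one_smul G x
    · exact (congrArg (fun S : ℝ →L[ℝ] EG => S 1) (hγev.mfderiv_eq (I := 𝓘(ℝ, ℝ))
        (I' := 𝓘(ℝ, EG)))).trans hdA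

end LieGroupAction

/-! ### Algebra of vector fields and tensoriality of the Nijenhuis tensor -/

section FieldAlgebra

variable {E : Type*} [NormedAddCommGroup E] [NormedSpace ℝ E] [CompleteSpace E]
  {M : Type*} [TopologicalSpace M] [ChartedSpace E M] [IsManifold 𝓘(ℝ, E) ∞ M]
  {X X' Y Y' F F' : ∀ x : M, TangentSpace 𝓘(ℝ, E) x} {x : M}
  {j : ∀ x : M, TangentSpace 𝓘(ℝ, E) x →L[ℝ] TangentSpace 𝓘(ℝ, E) x}

theorem IsSmoothField.fieldDiffAt (hX : IsSmoothField X) (x : M) : FieldDiffAt X x :=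
  hX.mdifferentiable (by simp) x

theorem isSmoothField_zero : IsSmoothField (0 : ∀ x : M, TangentSpace 𝓘(ℝ, E) x) :=
  contMDiff_zeroSection ℝ (TangentSpace 𝓘(ℝ, E) : M → Type _)

theorem IsSmoothField.add (hX : IsSmoothField X) (hY : IsSmoothField Y) : IsSmoothField (X + Y) :=
  ContMDiff.add_section hX hY

theorem IsSmoothField.neg (hX : IsSmoothField X) : IsSmoothField (-X) :=
  ContMDiff.neg_section hX

theorem IsSmoothField.sub (hX : IsSmoothField X) (hY : IsSmoothField Y) : IsSmoothField (X - Y) := by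
  rw [sub_eq_add_neg]
  exact hX.add hY.neg

theorem IsSmoothField.const_smul (hX : IsSmoothField X) (c : ℝ) : IsSmoothField (c • X) :=
  ContMDiff.const_smul_section hX

theorem IsSmoothField.endApply (hX : IsSmoothField X) (hj : IsSmoothEnd j) :
    IsSmoothField (endApply j X) :=
  ContMDiff.clm_bundle_apply (IM := 𝓘(ℝ, E)) (F₁ := E) (F₂ := E)
    (E₁ := (TangentSpace 𝓘(ℝ, E) : M → Type _)) (E₂ := (TangentSpace 𝓘(ℝ, E) : M → Type _))
    (b := fun x => x) hj hX

theorem IsSmoothField.bracket (hX : IsSmoothField X) (hY : IsSmoothField Y) :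
    IsSmoothField (bracket X Y) := by
  have : IsManifold 𝓘(ℝ, E) ((⊤ : ℕ∞) + 1) M := by simpa using ‹IsManifold 𝓘(ℝ, E) ∞ M›
  have : IsManifold 𝓘(ℝ, E) (minSmoothness ℝ 2) M := IsManifold.of_le (n := ∞) (by
    simpa using ENat.LEInfty.out)
  intro x
  exact ContMDiffAt.mlieBracket_vectorField (m := ⊤) (n := ⊤) (hX x) (hY x) (by simp)

theorem IsSmoothField.nijenhuis (hX : IsSmoothField X) (hY : IsSmoothField Y)
    (hj : IsSmoothEnd j) : IsSmoothField (nijenhuis j X Y) :=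
  ((((hX.endApply hj).bracket (hY.endApply hj)).sub
    (((hX.endApply hj).bracket hY).endApply hj)).sub
      ((hX.bracket (hY.endApply hj)).endApply hj)).add
        (((hX.bracket hY).endApply hj).endApply hj)

theorem FieldDiffAt.sub (hX : FieldDiffAt X x) (hY : FieldDiffAt Y x) : FieldDiffAt (X - Y) x := by
  rw [sub_eq_add_neg]
  exact mdifferentiableAt_add_section hX (mdifferentiableAt_neg_section hY)

theorem bracket_swap (X Y : ∀ x : M, TangentSpace 𝓘(ℝ, E) x) (x : M) :
    bracket X Y x = -bracket Y X x := VectorField.mlieBracket_swap_apply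

theorem bracket_add_left (hX : FieldDiffAt X x) (hX' : FieldDiffAt X' x)
    (Y : ∀ x : M, TangentSpace 𝓘(ℝ, E) x) :
    bracket (X + X') Y x = bracket X Y x + bracket X' Y x :=
  VectorField.mlieBracket_add_left hX hX'

theorem bracket_add_right (hY : FieldDiffAt Y x) (hY' : FieldDiffAt Y' x)
    (X : ∀ x : M, TangentSpace 𝓘(ℝ, E) x) :
    bracket X (Y + Y') x = bracket X Y x + bracket X Y' x :=
  VectorField.mlieBracket_add_right hY hY'

theorem bracket_smul_right (c : ℝ) (hY : FieldDiffAt Y x)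
    (X : ∀ x : M, TangentSpace 𝓘(ℝ, E) x) :
    bracket X (c • Y) x = c • bracket X Y x :=
  VectorField.mlieBracket_const_smul_right hY

theorem bracket_neg_right (hY : FieldDiffAt Y x) (X : ∀ x : M, TangentSpace 𝓘(ℝ, E) x) :
    bracket X (-Y) x = -bracket X Y x := by
  rw [← neg_one_smul ℝ Y, bracket_smul_right (-1) hY, neg_one_smul]

theorem bracket_neg_left (hX : FieldDiffAt X x) (Y : ∀ x : M, TangentSpace 𝓘(ℝ, E) x) :
    bracket (-X) Y x = -bracket X Y x := by
  rw [bracket_swap, bracket_neg_right hX, bracket_swap X Y]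

theorem bracket_sub_left (hX : FieldDiffAt X x) (hX' : FieldDiffAt X' x)
    (Y : ∀ x : M, TangentSpace 𝓘(ℝ, E) x) :
    bracket (X - X') Y x = bracket X Y x - bracket X' Y x := by
  rw [sub_eq_add_neg, bracket_add_left hX (mdifferentiableAt_neg_section hX'),
    bracket_neg_left hX', ← sub_eq_add_neg]

theorem bracket_sub_right (hY : FieldDiffAt Y x) (hY' : FieldDiffAt Y' x)
    (X : ∀ x : M, TangentSpace 𝓘(ℝ, E) x) :
    bracket X (Y - Y') x = bracket X Y x - bracket X Y' x := by
  rw [sub_eq_add_neg, bracket_add_right hY (mdifferentiableAt_neg_section hY'),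
    bracket_neg_right hY', ← sub_eq_add_neg]

theorem bracket_leibniz (hX : IsSmoothField X) (hY : IsSmoothField Y) (hF : IsSmoothField F)
    (x : M) : bracket F (bracket X Y) x =
      bracket (bracket F X) Y x + bracket X (bracket F Y) x := by
  have : IsManifold 𝓘(ℝ, E) (minSmoothness ℝ 3) M := IsManifold.of_le (n := ∞) (by
    simpa using ENat.LEInfty.out)
  have h2 : minSmoothness ℝ 2 ≤ ∞ := by simpa using ENat.LEInfty.out
  exact VectorField.leibniz_identity_mlieBracket_apply ((hF x).of_le h2) ((hX x).of_le h2)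
    ((hY x).of_le h2)

theorem endApply_sub (X Y : ∀ x : M, TangentSpace 𝓘(ℝ, E) x) :
    endApply j (X - Y) = endApply j X - endApply j Y :=
  funext fun x => map_sub (j x) _ _

theorem nijenhuis_apply (X Y : ∀ x : M, TangentSpace 𝓘(ℝ, E) x) (x : M) :
    nijenhuis j X Y x = bracket (endApply j X) (endApply j Y) x - j x (bracket (endApply j X) Y x) -
      j x (bracket X (endApply j Y) x) + j x (j x (bracket X Y x)) := rfl

theorem nijenhuis_swap (X Y : ∀ x : M, TangentSpace 𝓘(ℝ, E) x) (x : M) :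
    nijenhuis j X Y x = -nijenhuis j Y X x := by
  rw [nijenhuis_apply, nijenhuis_apply, bracket_swap (endApply j X) (endApply j Y),
    bracket_swap (endApply j X) Y, bracket_swap X (endApply j Y), bracket_swap X Y]
  simp only [map_neg]
  abel

theorem nijenhuis_sub_left (hj : IsSmoothEnd j) (hX : FieldDiffAt X x) (hX' : FieldDiffAt X' x)
    (Y : ∀ x : M, TangentSpace 𝓘(ℝ, E) x) :
    nijenhuis j (X - X') Y x = nijenhuis j X Y x - nijenhuis j X' Y x := by
  rw [nijenhuis_apply, nijenhuis_apply, nijenhuis_apply, endApply_sub,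
    bracket_sub_left (hX.endApply hj) (hX'.endApply hj), bracket_sub_left hX hX',
    bracket_sub_left (hX.endApply hj) (hX'.endApply hj), bracket_sub_left hX hX']
  simp only [map_sub]
  abel

/-- The Nijenhuis tensor is a tensor. -/
theorem nijenhuis_congr_left (hj : IsSmoothEnd j) (hX : FieldDiffAt X x) (hX' : FieldDiffAt X' x)
    (hY : FieldDiffAt Y x) (h : X x = X' x) : nijenhuis j X Y x = nijenhuis j X' Y x := by
  rw [← sub_eq_zero, ← nijenhuis_sub_left hj hX hX']
  exact nijenhuis_of_apply_eq_zero hj (hX.sub hX') hY (sub_eq_zero.2 h)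

theorem nijenhuis_congr (hj : IsSmoothEnd j) (hX : FieldDiffAt X x) (hX' : FieldDiffAt X' x)
    (hY : FieldDiffAt Y x) (hY' : FieldDiffAt Y' x) (h : X x = X' x) (h' : Y x = Y' x) :
    nijenhuis j X Y x = nijenhuis j X' Y' x := by
  rw [nijenhuis_congr_left hj hX hX' hY h, nijenhuis_swap, nijenhuis_congr_left hj hY hY' hX' h',
    ← nijenhuis_swap]

theorem nijenhuis_mem_imNijenhuis (hX : IsSmoothField X) (hY : IsSmoothField Y) (x : M) :
    nijenhuis j X Y x ∈ imNijenhuis j x :=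
  Submodule.subset_span ⟨X, Y, hX, hY, rfl⟩

theorem IsAlmostComplex.endApply_endApply (hj : IsAlmostComplex j)
    (X : ∀ x : M, TangentSpace 𝓘(ℝ, E) x) : endApply j (endApply j X) = -X :=
  funext fun x => hj.sq_eq_neg x (X x)

/-- Antilinearity of N^j in its first argument, a consequence of `j² = -id`; it is what makes Im N^j
stable under `j`. -/
theorem IsAlmostComplex.apply_nijenhuis (hj : IsAlmostComplex j) (hX : FieldDiffAt X x)
    (Y : ∀ x : M, TangentSpace 𝓘(ℝ, E) x) :
    j x (nijenhuis j X Y x) = -nijenhuis j (endApply j X) Y x := by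
  rw [nijenhuis_apply, nijenhuis_apply, hj.endApply_endApply, bracket_neg_left hX,
    bracket_neg_left hX]
  simp only [map_add, map_sub, map_neg, hj.sq_eq_neg]
  abel

/-- The image of the Nijenhuis tensor is stable under the almost complex structure. -/
theorem IsAlmostComplex.apply_mem_imNijenhuis (hj : IsAlmostComplex j)
    {v : TangentSpace 𝓘(ℝ, E) x} (hv : v ∈ imNijenhuis j x) : j x v ∈ imNijenhuis j x := by
  induction hv using Submodule.span_induction with
  | mem v hv =>
    obtain ⟨X, Y, hX, hY, rfl⟩ := hv
    rw [hj.apply_nijenhuis (hX.fieldDiffAt x)]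
    exact neg_mem (nijenhuis_mem_imNijenhuis (hX.endApply hj.smooth) hY x)
  | zero => rw [map_zero]; exact zero_mem _
  | add v w _ _ hv hw => rw [map_add]; exact add_mem hv hw
  | smul c v _ hv => rw [map_smul]; exact Submodule.smul_mem _ c hv

end FieldAlgebra

/-! ### Invariance of the Nijenhuis tensor under translations -/

section Pushforward

variable {G : Type*} [Group G]
  {E : Type*} [NormedAddCommGroup E] [NormedSpace ℝ E]
  {M : Type*} [TopologicalSpace M] [ChartedSpace E M] [MulAction G M]

/-- The push-forward of a vector field by the translation by a group element. -/
noncomputable def pushField (g : G) (X : ∀ x : M, TangentSpace 𝓘(ℝ, E) x) :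
    ∀ x : M, TangentSpace 𝓘(ℝ, E) x :=
  fun y => show E from mfderiv 𝓘(ℝ, E) 𝓘(ℝ, E) (fun z : M => g • z) (g⁻¹ • y) (X (g⁻¹ • y))

theorem mfderiv_translation_eq_pushField (g : G) (X : ∀ x : M, TangentSpace 𝓘(ℝ, E) x) (x : M) :
    mfderiv 𝓘(ℝ, E) 𝓘(ℝ, E) (fun z : M => g • z) x (X x) = pushField g X (g • x) :=
  congrArg (fun y : M => (show E from mfderiv 𝓘(ℝ, E) 𝓘(ℝ, E) (fun z : M => g • z) y (X y)))
    (inv_smul_smul g x).symm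

theorem pushField_mk_eq (g : G) (X : ∀ x : M, TangentSpace 𝓘(ℝ, E) x) (y : M) :
    (⟨y, pushField g X y⟩ : TangentBundle 𝓘(ℝ, E) M) =
      tangentMap 𝓘(ℝ, E) 𝓘(ℝ, E) (fun z : M => g • z) ⟨g⁻¹ • y, X (g⁻¹ • y)⟩ :=
  tangentBundle_mk_eq (E := E) (smul_inv_smul g y).symm rfl

variable {EG : Type*} [NormedAddCommGroup EG] [NormedSpace ℝ EG]
  [TopologicalSpace G] [ChartedSpace EG G] [LieGroup 𝓘(ℝ, EG) ∞ G]
  [IsManifold 𝓘(ℝ, E) ∞ M] [ContMDiffSMul 𝓘(ℝ, EG) 𝓘(ℝ, E) ∞ G M]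
  {X Y : ∀ x : M, TangentSpace 𝓘(ℝ, E) x} {x : M}
  {j : ∀ x : M, TangentSpace 𝓘(ℝ, E) x →L[ℝ] TangentSpace 𝓘(ℝ, E) x}

include EG in
theorem IsSmoothField.pushField (hX : IsSmoothField X) (g : G) : IsSmoothField (pushField g X) := by
  have h1 : ContMDiff 𝓘(ℝ, E).tangent 𝓘(ℝ, E).tangent ∞
      (tangentMap 𝓘(ℝ, E) 𝓘(ℝ, E) (fun z : M => g • z)) :=
    (contMDiff_translation EG E M g).contMDiff_tangentMap (m := ∞) (by simp)
  have h2 := (h1.comp hX).comp (contMDiff_translation EG E M g⁻¹)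
  exact h2.congr fun y => pushField_mk_eq g X y

include EG in
theorem FieldDiffAt.pushField (hX : FieldDiffAt X x) (g : G) :
    FieldDiffAt (pushField g X) (g • x) := by
  have h1 : ContMDiff 𝓘(ℝ, E).tangent 𝓘(ℝ, E).tangent ∞
      (tangentMap 𝓘(ℝ, E) 𝓘(ℝ, E) (fun z : M => g • z)) :=
    (contMDiff_translation EG E M g).contMDiff_tangentMap (m := ∞) (by simp)
  have h2 : MDifferentiableAt 𝓘(ℝ, E) 𝓘(ℝ, E) (fun z : M => g⁻¹ • z) (g • x) :=
    (contMDiff_translation EG E M g⁻¹).mdifferentiable (by simp) _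
  have h3 : MDifferentiableAt 𝓘(ℝ, E) 𝓘(ℝ, E).tangent
      (fun x => (⟨x, X x⟩ : TangentBundle 𝓘(ℝ, E) M)) (g⁻¹ • g • x) := by
    rwa [inv_smul_smul]
  have h4 := (MDifferentiableAt.comp (g • x) (h1.mdifferentiable (by simp) _)
    (MDifferentiableAt.comp (g • x) h3 h2))
  exact h4.congr_of_eventuallyEq (Eventually.of_forall fun y => pushField_mk_eq g X y)

theorem IsInvariantEnd.pushField_endApply (hinv : IsInvariantEnd G j) (g : G)
    (X : ∀ x : M, TangentSpace 𝓘(ℝ, E) x) :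
    pushField g (endApply j X) = endApply j (pushField g X) := by
  funext y
  have h := hinv g (g⁻¹ • y) (X (g⁻¹ • y))
  refine Eq.trans h ?_
  exact congrArg (fun z : M => (show E →L[ℝ] E from j z) (pushField g X y)) (smul_inv_smul g y)

variable [CompleteSpace E]

include EG in
theorem mfderiv_translation_bracket (hX : FieldDiffAt X x) (hY : FieldDiffAt Y x) (g : G) :
    mfderiv 𝓘(ℝ, E) 𝓘(ℝ, E) (fun z : M => g • z) x (bracket X Y x) =
      bracket (pushField g X) (pushField g Y) (g • x) :=
  mfderiv_mlieBracket_of_related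
    ((contMDiff_translation EG E M g).contMDiffAt.of_le ENat.LEInfty.out) hX hY
    (hX.pushField (EG := EG) g) (hY.pushField (EG := EG) g)
    (Eventually.of_forall fun y => mfderiv_translation_eq_pushField g X y)
    (Eventually.of_forall fun y => mfderiv_translation_eq_pushField g Y y)

include EG in
theorem mfderiv_translation_nijenhuis (hj : IsSmoothEnd j) (hinv : IsInvariantEnd G j)
    (hX : FieldDiffAt X x) (hY : FieldDiffAt Y x) (g : G) :
    mfderiv 𝓘(ℝ, E) 𝓘(ℝ, E) (fun z : M => g • z) x (nijenhuis j X Y x) =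
      nijenhuis j (pushField g X) (pushField g Y) (g • x) := by
  have hjX := hX.endApply hj
  have hjY := hY.endApply hj
  rw [nijenhuis_apply, nijenhuis_apply, ← hinv.pushField_endApply, ← hinv.pushField_endApply,
    ← mfderiv_translation_bracket (EG := EG) hjX hjY,
    ← mfderiv_translation_bracket (EG := EG) hjX hY,
    ← mfderiv_translation_bracket (EG := EG) hX hjY,
    ← mfderiv_translation_bracket (EG := EG) hX hY]
  simp only [map_add, map_sub, hinv g]

include EG in
/-- The image of the Nijenhuis tensor of an invariant almost complex structure is invariant. -/
theorem mfderiv_translation_mem_imNijenhuis (hj : IsSmoothEnd j) (hinv : IsInvariantEnd G j)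
    (g : G) (x : M) (v : TangentSpace 𝓘(ℝ, E) x) (hv : v ∈ imNijenhuis j x) :
    mfderiv 𝓘(ℝ, E) 𝓘(ℝ, E) (fun z : M => g • z) x v ∈ imNijenhuis j (g • x) := by
  induction hv using Submodule.span_induction with
  | mem v hv =>
    obtain ⟨X, Y, hX, hY, rfl⟩ := hv
    rw [mfderiv_translation_nijenhuis (EG := EG) hj hinv (hX.fieldDiffAt x) (hY.fieldDiffAt x)]
    exact nijenhuis_mem_imNijenhuis (hX.pushField (EG := EG) g) (hY.pushField (EG := EG) g) _
  | zero => rw [map_zero]; exact zero_mem _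
  | add v w _ _ hv hw => rw [map_add]; exact add_mem hv hw
  | smul c v _ hv => rw [map_smul]; exact Submodule.smul_mem _ c hv

end Pushforward

/-! ### The Nijenhuis tensor on fundamental vector fields -/

section Homogeneous

variable {EG : Type*} [NormedAddCommGroup EG] [NormedSpace ℝ EG] [FiniteDimensional ℝ EG]
  {G : Type*} [TopologicalSpace G] [ChartedSpace EG G] [Group G]
  [LieGroup 𝓘(ℝ, EG) ∞ G] [SecondCountableTopology G]
  {E : Type*} [NormedAddCommGroup E] [NormedSpace ℝ E] [FiniteDimensional ℝ E]
  {M : Type*} [TopologicalSpace M] [ChartedSpace E M]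
  [IsManifold 𝓘(ℝ, E) ∞ M] [T2Space M]
  [MulAction G M] [ContMDiffSMul 𝓘(ℝ, EG) 𝓘(ℝ, E) ∞ G M] [MulAction.IsPretransitive G M]
  {j : ∀ x : M, TangentSpace 𝓘(ℝ, E) x →L[ℝ] TangentSpace 𝓘(ℝ, E) x}
  {x₀ : M} {J : GroupLieAlgebra 𝓘(ℝ, EG) G →ₗ[ℝ] GroupLieAlgebra 𝓘(ℝ, EG) G}

include EG in
/-- The bracket with a section of an invariant distribution vanishing at a point. -/
theorem bracket_mem_of_apply_eq_zero (hj : IsSmoothEnd j)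
    {D : ∀ x : M, Submodule ℝ (TangentSpace 𝓘(ℝ, E) x)}
    (hD : ∀ (g : G) (x : M), ∀ v ∈ D x,
      mfderiv 𝓘(ℝ, E) 𝓘(ℝ, E) (fun y : M => g • y) x v ∈ D (g • x))
    {V Y : ∀ x : M, TangentSpace 𝓘(ℝ, E) x} {x : M} (hV : FieldDiffAt V x) (hY : FieldDiffAt Y x)
    (hVD : ∀ᶠ y in 𝓝 x, V y ∈ D y) (hV0 : V x = 0) : bracket V Y x ∈ D x := by
  have := FiniteDimensional.complete ℝ E
  -- As `V x = 0`, the bracket depends on `Y` only through `Y x`. So `Y` may be replaced by a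
  -- fundamental field, and those preserve sections of `D`.
  obtain ⟨A, hA⟩ := exists_fundamentalField_eq (EG := EG) (G := G) x (Y x)
  obtain ⟨L, hL⟩ := exists_mlieBracket_eq_of_apply_eq_zero hj hV hV0
  have hAs := (isSmoothField_fundamentalField (EG := EG) (E := E) (M := M) A).fieldDiffAt x
  have h1 : bracket V Y x = bracket V (fundamentalField (E := E) M A) x := by
    rw [(hL Y hY).1, (hL _ hAs).1, hA]
  rw [h1, bracket_swap]
  exact neg_mem (bracket_fundamentalField_mem hD A hV hVD)

omit [FiniteDimensional ℝ EG] [LieGroup 𝓘(ℝ, EG) ∞ G] [SecondCountableTopology G]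
  [FiniteDimensional ℝ E] [IsManifold 𝓘(ℝ, E) ∞ M] [T2Space M]
  [ContMDiffSMul 𝓘(ℝ, EG) 𝓘(ℝ, E) ∞ G M] [MulAction.IsPretransitive G M] in
theorem fundamentalField_add (A B : GroupLieAlgebra 𝓘(ℝ, EG) G) (x : M) :
    fundamentalField (E := E) M (A + B) x =
      fundamentalField (E := E) M A x + fundamentalField (E := E) M B x := by
  have h : -orbitDeriv EG G E x (A + B) = -orbitDeriv EG G E x A + -orbitDeriv EG G E x B := by
    rw [← neg_add]
    exact congrArg Neg.neg (map_add (orbitDeriv EG G E x) A B)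
  exact h

omit [FiniteDimensional ℝ EG] [LieGroup 𝓘(ℝ, EG) ∞ G] [SecondCountableTopology G]
  [FiniteDimensional ℝ E] [IsManifold 𝓘(ℝ, E) ∞ M] [T2Space M]
  [ContMDiffSMul 𝓘(ℝ, EG) 𝓘(ℝ, E) ∞ G M] [MulAction.IsPretransitive G M] in
theorem fundamentalField_smul (c : ℝ) (A : GroupLieAlgebra 𝓘(ℝ, EG) G) (x : M) :
    fundamentalField (E := E) M (c • A) x = c • fundamentalField (E := E) M A x := by
  have h : -orbitDeriv EG G E x (c • A) = c • -orbitDeriv EG G E x A := by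
    rw [smul_neg]
    exact congrArg Neg.neg (map_smul (orbitDeriv EG G E x) c A)
  exact h

/-- The values at a point of the fundamental vector fields, as a linear map. -/
noncomputable def fundamentalFieldAt (EG : Type*) [NormedAddCommGroup EG] [NormedSpace ℝ EG]
    (G : Type*) [TopologicalSpace G] [ChartedSpace EG G] [Group G]
    {E : Type*} [NormedAddCommGroup E] [NormedSpace ℝ E]
    {M : Type*} [TopologicalSpace M] [ChartedSpace E M] [MulAction G M] (x : M) :
    GroupLieAlgebra 𝓘(ℝ, EG) G →ₗ[ℝ] TangentSpace 𝓘(ℝ, E) x where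
  toFun A := fundamentalField (E := E) M A x
  map_add' A B := fundamentalField_add A B x
  map_smul' c A := fundamentalField_smul c A x

/-- The Nijenhuis tensor on fundamental vector fields. -/
theorem nijenhuis_fundamentalField (hj : IsAlmostComplex j) (hinv : IsInvariantEnd G j)
    (hJ : ∀ A : GroupLieAlgebra 𝓘(ℝ, EG) G,
      j x₀ (fundamentalField (E := E) M A x₀) = fundamentalField (E := E) M (J A) x₀)
    (A B : GroupLieAlgebra 𝓘(ℝ, EG) G) :
    nijenhuis j (fundamentalField (E := E) M A) (fundamentalField (E := E) M B) x₀ =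
      -fundamentalField (E := E) M (lieNijenhuis J A B) x₀ := by
  have := FiniteDimensional.complete ℝ E
  have := FiniteDimensional.complete ℝ EG
  have hs : ∀ A : GroupLieAlgebra 𝓘(ℝ, EG) G, FieldDiffAt (fundamentalField (E := E) M A) x₀ :=
    fun A => (isSmoothField_fundamentalField (EG := EG) A).fieldDiffAt x₀
  have hsj := fun A => (hs A).endApply hj.smooth
  have hb : ∀ A B : GroupLieAlgebra 𝓘(ℝ, EG) G,
      bracket (fundamentalField (E := E) M A) (fundamentalField (E := E) M B) x₀ =
        fundamentalField (E := E) M ⁅A, B⁆ x₀ := fun A B => congrFun (bracket_fundamentalField A B) x₀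
  have hbj : ∀ A B : GroupLieAlgebra 𝓘(ℝ, EG) G,
      bracket (fundamentalField (E := E) M A) (endApply j (fundamentalField (E := E) M B)) x₀ =
        j x₀ (fundamentalField (E := E) M ⁅A, B⁆ x₀) := fun A B => by
    rw [bracket_fundamentalField_endApply hj.smooth hinv A (hs B), hb]
  have hjb : ∀ A B : GroupLieAlgebra 𝓘(ℝ, EG) G,
      bracket (endApply j (fundamentalField (E := E) M A)) (fundamentalField (E := E) M B) x₀ =
        j x₀ (fundamentalField (E := E) M ⁅A, B⁆ x₀) := fun A B => by
    rw [bracket_swap, bracket_fundamentalField_endApply hj.smooth hinv B (hs A), ← map_neg,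
      ← bracket_swap, hb]
  -- The field jA* - (JA)* vanishes at `x₀`, so its brackets with jB* and (JB)* coincide there. This
  -- expresses [jA*, jB*], the only term of the tensor not given by invariance, through known ones.
  obtain ⟨L, hL⟩ := exists_mlieBracket_eq_of_apply_eq_zero hj.smooth
    ((hsj A).sub (hs (J A))) (sub_eq_zero.2 (hJ A))
  have h1 := (hL _ (hsj B)).1
  have h2 := (hL _ (hs (J B))).1
  have h3 : endApply j (fundamentalField (E := E) M B) x₀ = fundamentalField (E := E) M (J B) x₀ :=
    hJ B
  rw [h3, ← h2, bracket_sub_left (hsj A) (hs (J A)), bracket_sub_left (hsj A) (hs (J A)),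
    hbj, hjb, hb] at h1
  rw [nijenhuis_apply, hbj, hjb, hb, sub_eq_iff_eq_add.1 h1, hj.sq_eq_neg, hJ, hJ]
  have h4 : fundamentalField (E := E) M (lieNijenhuis J A B) x₀ =
      fundamentalField (E := E) M ⁅J A, J B⁆ x₀ - fundamentalField (E := E) M (J ⁅J A, B⁆) x₀ -
        fundamentalField (E := E) M (J ⁅A, J B⁆) x₀ - fundamentalField (E := E) M ⁅A, B⁆ x₀ := by
    change fundamentalFieldAt EG G x₀ _ = fundamentalFieldAt EG G x₀ _ -
      fundamentalFieldAt EG G x₀ _ - fundamentalFieldAt EG G x₀ _ - fundamentalFieldAt EG G x₀ _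
    rw [lieNijenhuis, map_sub, map_sub, map_sub]
  rw [h4]
  abel

/-- The derivative of the almost complex structure along a section of the image of its Nijenhuis
tensor, on fundamental vector fields. -/
theorem bracket_endApply_fundamentalField_sub_mem (hj : IsAlmostComplex j)
    (hinv : IsInvariantEnd G j)
    (hJ : ∀ A : GroupLieAlgebra 𝓘(ℝ, EG) G,
      j x₀ (fundamentalField (E := E) M A x₀) = fundamentalField (E := E) M (J A) x₀)
    (A n : GroupLieAlgebra 𝓘(ℝ, EG) G) {F : ∀ x : M, TangentSpace 𝓘(ℝ, E) x}
    (hF : FieldDiffAt F x₀) (hFD : ∀ᶠ y in 𝓝 x₀, F y ∈ imNijenhuis j y)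
    (hFn : F x₀ = fundamentalField (E := E) M n x₀) :
    bracket F (endApply j (fundamentalField (E := E) M A)) x₀ -
      j x₀ (bracket F (fundamentalField (E := E) M A) x₀) -
      fundamentalField (E := E) M (⁅J A, n⁆ - J ⁅A, n⁆) x₀ ∈ imNijenhuis j x₀ := by
  have := FiniteDimensional.complete ℝ E
  have := FiniteDimensional.complete ℝ EG
  have hs : ∀ A : GroupLieAlgebra 𝓘(ℝ, EG) G, FieldDiffAt (fundamentalField (E := E) M A) x₀ :=
    fun A => (isSmoothField_fundamentalField (EG := EG) A).fieldDiffAt x₀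
  have hsj := fun A => (hs A).endApply hj.smooth
  have hb : ∀ A B : GroupLieAlgebra 𝓘(ℝ, EG) G,
      bracket (fundamentalField (E := E) M A) (fundamentalField (E := E) M B) x₀ =
        fundamentalField (E := E) M ⁅A, B⁆ x₀ := fun A B => congrFun (bracket_fundamentalField A B) x₀
  have hD := mfderiv_translation_mem_imNijenhuis (EG := EG) hj.smooth hinv
  -- Brackets of jA* - (JA)* with `F` and with n* coincide at `x₀`. The brackets of `F` with
  -- fundamental fields stay in the distribution, and what remains is ([JA, n] - J[A, n])*.
  obtain ⟨L, hL⟩ := exists_mlieBracket_eq_of_apply_eq_zero hj.smooth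
    ((hsj A).sub (hs (J A))) (sub_eq_zero.2 (hJ A))
  have h1 := (hL _ hF).1
  rw [hFn, ← (hL _ (hs n)).1, bracket_sub_left (hsj A) (hs (J A)),
    bracket_sub_left (hsj A) (hs (J A)), bracket_swap (endApply j _) (fundamentalField (E := E) M n),
    bracket_fundamentalField_endApply hj.smooth hinv n (hs A), ← map_neg, ← bracket_swap, hb, hb,
    sub_eq_iff_eq_add] at h1
  have h2 := bracket_fundamentalField_mem hD (J A) hF hFD
  have h3 := hj.apply_mem_imNijenhuis (bracket_fundamentalField_mem hD A hF hFD)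
  have h4 : fundamentalField (E := E) M (⁅J A, n⁆ - J ⁅A, n⁆) x₀ =
      fundamentalField (E := E) M ⁅J A, n⁆ x₀ - fundamentalField (E := E) M (J ⁅A, n⁆) x₀ :=
    map_sub (fundamentalFieldAt EG G x₀) _ _
  rw [bracket_swap F, bracket_swap F, h1, h4, hJ, map_neg]
  convert! sub_mem h3 h2 using 1
  abel

end Homogeneous

/-! ### Transverse holomorphy and involutivity -/

section HomogeneousTransverse

variable {EG : Type*} [NormedAddCommGroup EG] [NormedSpace ℝ EG] [FiniteDimensional ℝ EG]
  {G : Type*} [TopologicalSpace G] [ChartedSpace EG G] [Group G]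
  [LieGroup 𝓘(ℝ, EG) ∞ G] [SecondCountableTopology G]
  {E : Type*} [NormedAddCommGroup E] [NormedSpace ℝ E] [FiniteDimensional ℝ E]
  {M : Type*} [TopologicalSpace M] [ChartedSpace E M]
  [IsManifold 𝓘(ℝ, E) ∞ M] [T2Space M]
  [MulAction G M] [ContMDiffSMul 𝓘(ℝ, EG) 𝓘(ℝ, E) ∞ G M] [MulAction.IsPretransitive G M]
  {j : ∀ x : M, TangentSpace 𝓘(ℝ, E) x →L[ℝ] TangentSpace 𝓘(ℝ, E) x}
  {x₀ : M} {J : GroupLieAlgebra 𝓘(ℝ, EG) G →ₗ[ℝ] GroupLieAlgebra 𝓘(ℝ, EG) G}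

/-- The image of the Nijenhuis tensor at the base point comes from the Lie algebra. -/
theorem imNijenhuis_eq_map (hj : IsAlmostComplex j) (hinv : IsInvariantEnd G j)
    (hJ : ∀ A : GroupLieAlgebra 𝓘(ℝ, EG) G,
      j x₀ (fundamentalField (E := E) M A x₀) = fundamentalField (E := E) M (J A) x₀) :
    imNijenhuis j x₀ = (imLieNijenhuis J).map (fundamentalFieldAt EG G x₀) := by
  have := FiniteDimensional.complete ℝ E
  refine le_antisymm (Submodule.span_le.2 ?_) ?_
  · rintro _ ⟨X, Y, hX, hY, rfl⟩
    obtain ⟨A, hA⟩ := exists_fundamentalField_eq (EG := EG) (G := G) x₀ (X x₀)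
    obtain ⟨B, hB⟩ := exists_fundamentalField_eq (EG := EG) (G := G) x₀ (Y x₀)
    rw [nijenhuis_congr hj.smooth (hX.fieldDiffAt x₀)
      ((isSmoothField_fundamentalField A).fieldDiffAt x₀) (hY.fieldDiffAt x₀)
      ((isSmoothField_fundamentalField B).fieldDiffAt x₀) hA.symm hB.symm,
      nijenhuis_fundamentalField hj hinv hJ]
    exact neg_mem (Submodule.mem_map_of_mem (f := fundamentalFieldAt EG G x₀)
      (Submodule.subset_span ⟨A, B, rfl⟩))
  · rw [imLieNijenhuis, Submodule.map_span, Submodule.span_le]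
    rintro _ ⟨_, ⟨A, B, rfl⟩, rfl⟩
    have h := nijenhuis_fundamentalField hj hinv hJ A B
    have h1 : fundamentalFieldAt EG G x₀ (lieNijenhuis J A B) =
        -nijenhuis j (fundamentalField (E := E) M A) (fundamentalField (E := E) M B) x₀ := by
      rw [h, neg_neg]
      rfl
    rw [h1]
    exact neg_mem (nijenhuis_mem_imNijenhuis (isSmoothField_fundamentalField A)
      (isSmoothField_fundamentalField B) x₀)

/-- Evaluation at `x₀` is linear with kernel 𝔥 and maps Im N^J onto the value of Im N^j, so
condition (2) becomes a condition on tangent vectors at `x₀`. -/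
theorem fundamentalField_mem_imNijenhuis_iff (hj : IsAlmostComplex j) (hinv : IsInvariantEnd G j)
    (hJ : ∀ A : GroupLieAlgebra 𝓘(ℝ, EG) G,
      j x₀ (fundamentalField (E := E) M A x₀) = fundamentalField (E := E) M (J A) x₀)
    (A : GroupLieAlgebra 𝓘(ℝ, EG) G) :
    fundamentalField (E := E) M A x₀ ∈ imNijenhuis j x₀ ↔
      A ∈ (imLieNijenhuis J : Set (GroupLieAlgebra 𝓘(ℝ, EG) G)) +
        subgroupLieAlgebra (MulAction.stabilizer G x₀) := by
  rw [imNijenhuis_eq_map hj hinv hJ, Submodule.mem_map, Set.mem_add]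
  constructor
  · rintro ⟨n, hn, h⟩
    refine ⟨n, hn, A - n, ?_, add_sub_cancel _ _⟩
    rw [mem_subgroupLieAlgebra_stabilizer_iff (E := E)]
    have h1 : fundamentalFieldAt EG G (E := E) x₀ (A - n) = 0 := by
      rw [map_sub, h]
      exact sub_self _
    exact h1
  · rintro ⟨n, hn, h, hh, rfl⟩
    refine ⟨n, hn, ?_⟩
    rw [mem_subgroupLieAlgebra_stabilizer_iff (E := E)] at hh
    change fundamentalFieldAt EG G (E := E) x₀ n = fundamentalFieldAt EG G (E := E) x₀ (n + h)
    rw [map_add]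
    exact (add_zero _).symm.trans (congrArg (fundamentalFieldAt EG G x₀ n + ·) hh.symm)

/-- Transverse holomorphy of the germs of sections at the base point. -/
theorem bracket_endApply_sub_mem_of_lie (hj : IsAlmostComplex j) (hinv : IsInvariantEnd G j)
    (hJ : ∀ A : GroupLieAlgebra 𝓘(ℝ, EG) G,
      j x₀ (fundamentalField (E := E) M A x₀) = fundamentalField (E := E) M (J A) x₀)
    (hlie : ∀ A B C : GroupLieAlgebra 𝓘(ℝ, EG) G,
      ⁅J A, lieNijenhuis J B C⁆ - J ⁅A, lieNijenhuis J B C⁆ ∈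
        (imLieNijenhuis J : Set (GroupLieAlgebra 𝓘(ℝ, EG) G)) +
          subgroupLieAlgebra (MulAction.stabilizer G x₀))
    {F U : ∀ x : M, TangentSpace 𝓘(ℝ, E) x} (hF : FieldDiffAt F x₀)
    (hFD : ∀ᶠ y in 𝓝 x₀, F y ∈ imNijenhuis j y) (hU : FieldDiffAt U x₀) :
    bracket F (endApply j U) x₀ - j x₀ (bracket F U x₀) ∈ imNijenhuis j x₀ := by
  have := FiniteDimensional.complete ℝ E
  have := FiniteDimensional.complete ℝ EG
  have : LieGroup 𝓘(ℝ, EG) (minSmoothness ℝ 3) G :=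
    LieGroup.of_le (n := ∞) (by simpa using ENat.LEInfty.out)
  obtain ⟨A, hA⟩ := exists_fundamentalField_eq (EG := EG) (G := G) x₀ (U x₀)
  have hAs := (isSmoothField_fundamentalField (E := E) (M := M) A).fieldDiffAt x₀
  -- Tensoriality in `U` allows `U` to be replaced by a fundamental field with the same value.
  have h1 := mlieBracket_endApply_of_apply_eq_zero hj.smooth hF (hU.sub hAs)
    (sub_eq_zero.2 hA.symm)
  rw [endApply_sub, bracket_sub_right (hU.endApply hj.smooth) (hAs.endApply hj.smooth),
    bracket_sub_right hU hAs, map_sub, sub_eq_sub_iff_sub_eq_sub] at h1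
  rw [h1]
  have h2 := hFD.self_of_nhds
  rw [imNijenhuis_eq_map hj hinv hJ] at h2
  obtain ⟨n, hn, hFn⟩ := h2
  have h3 := bracket_endApply_fundamentalField_sub_mem hj hinv hJ A n hF hFD hFn.symm
  -- The hypothesis concerns single values of N^J; linearity in `n` extends it to their span.
  have h4 : ∀ n ∈ imLieNijenhuis J,
      fundamentalFieldAt EG G x₀ (⁅J A, n⁆ - J ⁅A, n⁆) ∈ imNijenhuis j x₀ := by
    intro n hn
    induction hn using Submodule.span_induction with
    | mem n hn =>
      obtain ⟨B, C, rfl⟩ := hn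
      exact (fundamentalField_mem_imNijenhuis_iff hj hinv hJ _).2 (hlie A B C)
    | zero =>
      rw [lie_zero, lie_zero, map_zero, sub_zero, map_zero]
      exact zero_mem _
    | add n n' _ _ hn hn' =>
      rw [lie_add, lie_add, map_add, add_sub_add_comm, map_add]
      exact add_mem hn hn'
    | smul c n _ hn =>
      rw [lie_smul, lie_smul, map_smul, ← smul_sub, map_smul]
      exact Submodule.smul_mem _ c hn
  exact (Submodule.sub_mem_iff_left _ (h4 n hn)).1 h3

include EG in
theorem mem_of_mfderiv_translation_mem {D : ∀ x : M, Submodule ℝ (TangentSpace 𝓘(ℝ, E) x)}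
    (hD : ∀ (g : G) (x : M), ∀ v ∈ D x,
      mfderiv 𝓘(ℝ, E) 𝓘(ℝ, E) (fun y : M => g • y) x v ∈ D (g • x))
    {g : G} {x : M} {v : TangentSpace 𝓘(ℝ, E) x}
    (hv : mfderiv 𝓘(ℝ, E) 𝓘(ℝ, E) (fun y : M => g • y) x v ∈ D (g • x)) : v ∈ D x := by
  have h1 := hD g⁻¹ _ _ hv
  have h2 := (mfderiv_translation_mul (E := E) EG g⁻¹ g x v).trans
    (mfderiv_translation_one (E := E) (inv_mul_cancel g) x v)
  have h3 : ∀ {y : M} {w : E}, y = x → w ∈ (D y : Submodule ℝ E) → w = v →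
      v ∈ D x := by
    rintro y w rfl hw rfl
    exact hw
  exact h3 (inv_smul_smul g x) h1 h2

theorem pushField_mem {D : ∀ x : M, Submodule ℝ (TangentSpace 𝓘(ℝ, E) x)}
    (hD : ∀ (g : G) (x : M), ∀ v ∈ D x,
      mfderiv 𝓘(ℝ, E) 𝓘(ℝ, E) (fun y : M => g • y) x v ∈ D (g • x))
    {g : G} {F : ∀ x : M, TangentSpace 𝓘(ℝ, E) x} {y : M} (hF : F (g⁻¹ • y) ∈ D (g⁻¹ • y)) :
    pushField g F y ∈ D y := by
  have h1 := hD g _ _ hF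
  have h3 : ∀ {z : M} {w : E}, z = y → w ∈ (D z : Submodule ℝ E) →
      w ∈ (D y : Submodule ℝ E) := by
    rintro y w rfl hw
    exact hw
  exact h3 (smul_inv_smul g y) h1

/-- Transverse holomorphy of germs of sections. -/
theorem bracket_endApply_sub_mem (hj : IsAlmostComplex j) (hinv : IsInvariantEnd G j)
    (hJ : ∀ A : GroupLieAlgebra 𝓘(ℝ, EG) G,
      j x₀ (fundamentalField (E := E) M A x₀) = fundamentalField (E := E) M (J A) x₀)
    (hlie : ∀ A B C : GroupLieAlgebra 𝓘(ℝ, EG) G,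
      ⁅J A, lieNijenhuis J B C⁆ - J ⁅A, lieNijenhuis J B C⁆ ∈
        (imLieNijenhuis J : Set (GroupLieAlgebra 𝓘(ℝ, EG) G)) +
          subgroupLieAlgebra (MulAction.stabilizer G x₀))
    {F U : ∀ x : M, TangentSpace 𝓘(ℝ, E) x} {x : M} (hF : FieldDiffAt F x)
    (hFD : ∀ᶠ y in 𝓝 x, F y ∈ imNijenhuis j y) (hU : FieldDiffAt U x) :
    bracket F (endApply j U) x - j x (bracket F U x) ∈ imNijenhuis j x := by
  have := FiniteDimensional.complete ℝ E
  -- The assertion is invariant under translations, so it may be checked after moving `x` to the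
  -- base point.
  obtain ⟨g, hg⟩ := MulAction.exists_smul_eq G x x₀
  subst hg
  have hD := mfderiv_translation_mem_imNijenhuis (EG := EG) hj.smooth hinv
  refine mem_of_mfderiv_translation_mem (EG := EG) hD (g := g) ?_
  rw [map_sub, hinv g, mfderiv_translation_bracket (EG := EG) hF (hU.endApply hj.smooth),
    mfderiv_translation_bracket (EG := EG) hF hU, hinv.pushField_endApply]
  refine bracket_endApply_sub_mem_of_lie hj hinv hJ hlie (hF.pushField (EG := EG) g) ?_
    (hU.pushField (EG := EG) g)
  have h1 : Tendsto (fun y : M => g⁻¹ • y) (𝓝 (g • x)) (𝓝 x) := by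
    have := (contMDiff_translation EG E M g⁻¹).continuous.tendsto (g • x)
    rwa [inv_smul_smul] at this
  filter_upwards [h1.eventually hFD] with y hy using pushField_mem hD hy

/-- Brackets of sections with values of the Nijenhuis tensor. -/
theorem bracket_nijenhuis_mem (hj : IsAlmostComplex j)
    (hlie : ∀ F U : ∀ x : M, TangentSpace 𝓘(ℝ, E) x, IsSmoothField F →
      (∀ y, F y ∈ imNijenhuis j y) → IsSmoothField U → ∀ x,
      bracket F (endApply j U) x - j x (bracket F U x) ∈ imNijenhuis j x)
    {F X Y : ∀ x : M, TangentSpace 𝓘(ℝ, E) x} (hF : IsSmoothField F)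
    (hFD : ∀ y, F y ∈ imNijenhuis j y) (hX : IsSmoothField X) (hY : IsSmoothField Y) (x : M) :
    bracket F (nijenhuis j X Y) x ∈ imNijenhuis j x := by
  have := FiniteDimensional.complete ℝ E
  have hjX := hX.endApply hj.smooth
  have hjY := hY.endApply hj.smooth
  set X₁ := bracket F X with hX₁
  set Y₁ := bracket F Y with hY₁
  have hX₁s : IsSmoothField X₁ := hF.bracket hX
  have hY₁s : IsSmoothField Y₁ := hF.bracket hY
  -- `δ` and `δ'` are the values of L_F j on `X` and `Y`. They are sections of the distribution, so
  -- the hypothesis applies to them again as first arguments.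
  set δ := bracket F (endApply j X) - endApply j X₁ with hδ
  set δ' := bracket F (endApply j Y) - endApply j Y₁ with hδ'
  have hδs : IsSmoothField δ := (hF.bracket hjX).sub (hX₁s.endApply hj.smooth)
  have hδs' : IsSmoothField δ' := (hF.bracket hjY).sub (hY₁s.endApply hj.smooth)
  have hδD : ∀ y, δ y ∈ imNijenhuis j y := hlie F X hF hFD hX
  have hδD' : ∀ y, δ' y ∈ imNijenhuis j y := hlie F Y hF hFD hY
  have e1 : bracket F (endApply j X) = endApply j X₁ + δ := by rw [hδ]; abel
  have e2 : bracket F (endApply j Y) = endApply j Y₁ + δ' := by rw [hδ']; abel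
  have hjX₁ := hX₁s.endApply hj.smooth
  have hjY₁ := hY₁s.endApply hj.smooth
  have hP := hjX.bracket hjY
  have hQ := hjX.bracket hY
  have hR := hX.bracket hjY
  have hS := hX.bracket hY
  have hN : nijenhuis j X Y = bracket (endApply j X) (endApply j Y) -
      endApply j (bracket (endApply j X) Y) - endApply j (bracket X (endApply j Y)) -
        bracket X Y := by
    rw [nijenhuis, hj.endApply_endApply, ← sub_eq_add_neg]
  have d1 := hlie F _ hF hFD hQ x
  have d2 := hlie F _ hF hFD hR x
  have d3 := hlie δ Y hδs hδD hY x
  have d4 := hlie δ' X hδs' hδD' hX x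
  have n1 := nijenhuis_mem_imNijenhuis (j := j) hX₁s hY x
  have n2 := nijenhuis_mem_imNijenhuis (j := j) hX hY₁s x
  have f : ∀ {Z : ∀ x : M, TangentSpace 𝓘(ℝ, E) x}, IsSmoothField Z → FieldDiffAt Z x :=
    fun hZ => hZ.fieldDiffAt x
  rw [bracket_leibniz hjX hY hF, e1, bracket_add_left (f hjX₁) (f hδs)] at d1
  rw [bracket_leibniz hX hjY hF, e2, bracket_add_right (f hjY₁) (f hδs')] at d2
  rw [bracket_swap δ', bracket_swap δ'] at d4
  rw [nijenhuis_apply, hj.sq_eq_neg] at n1 n2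
  have hQj := hQ.endApply hj.smooth
  have hRj := hR.endApply hj.smooth
  rw [hN, bracket_sub_right (f ((hP.sub hQj).sub hRj)) (f hS),
    bracket_sub_right (f (hP.sub hQj)) (f hRj), bracket_sub_right (f hP) (f hQj),
    bracket_leibniz hjX hjY hF, bracket_leibniz hX hY hF, e1, e2,
    bracket_add_left (f hjX₁) (f hδs), bracket_add_right (f hjY₁) (f hδs')]
  -- By the Jacobi identity [F, N(X, Y)] is N([F, X], Y) + N(X, [F, Y]) plus L_δ j on `Y`, minus
  -- L_δ' j on `X`, minus L_F j on [jX, Y] and on [X, jY].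
  have key := sub_mem (sub_mem (sub_mem (add_mem (add_mem n1 n2) d3) d4) d1) d2
  simp only [map_add, map_neg] at key
  convert! key using 1
  abel

/-- Every element of the image of the Nijenhuis tensor extends to a section whose brackets with
sections are sections. -/
theorem exists_section_bracket_mem (hj : IsAlmostComplex j)
    (hlie : ∀ F U : ∀ x : M, TangentSpace 𝓘(ℝ, E) x, IsSmoothField F →
      (∀ y, F y ∈ imNijenhuis j y) → IsSmoothField U → ∀ x,
      bracket F (endApply j U) x - j x (bracket F U x) ∈ imNijenhuis j x)
    {x : M} {v : TangentSpace 𝓘(ℝ, E) x} (hv : v ∈ imNijenhuis j x) :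
    ∃ N : ∀ x : M, TangentSpace 𝓘(ℝ, E) x, IsSmoothField N ∧ (∀ y, N y ∈ imNijenhuis j y) ∧
      N x = v ∧ ∀ F : ∀ x : M, TangentSpace 𝓘(ℝ, E) x, IsSmoothField F →
        (∀ y, F y ∈ imNijenhuis j y) → bracket F N x ∈ imNijenhuis j x := by
  have := FiniteDimensional.complete ℝ E
  induction hv using Submodule.span_induction with
  | mem v hv =>
    obtain ⟨X, Y, hX, hY, rfl⟩ := hv
    exact ⟨nijenhuis j X Y, hX.nijenhuis hY hj.smooth, nijenhuis_mem_imNijenhuis hX hY, rfl,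
      fun F hF hFD => bracket_nijenhuis_mem hj hlie hF hFD hX hY x⟩
  | zero =>
    refine ⟨0, isSmoothField_zero, fun y => zero_mem _, rfl, fun F hF _ => ?_⟩
    rw [bracket, VectorField.mlieBracket_zero_right]
    exact zero_mem _
  | add v w _ _ hv hw =>
    obtain ⟨N, hN, hND, rfl, hNF⟩ := hv
    obtain ⟨N', hN', hND', rfl, hNF'⟩ := hw
    refine ⟨N + N', hN.add hN', fun y => add_mem (hND y) (hND' y), rfl, fun F hF hFD => ?_⟩
    rw [bracket_add_right (hN.fieldDiffAt x) (hN'.fieldDiffAt x)]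
    exact add_mem (hNF F hF hFD) (hNF' F hF hFD)
  | smul c v _ hv =>
    obtain ⟨N, hN, hND, rfl, hNF⟩ := hv
    refine ⟨c • N, hN.const_smul c, fun y => Submodule.smul_mem _ c (hND y), rfl,
      fun F hF hFD => ?_⟩
    rw [bracket_smul_right c (hN.fieldDiffAt x)]
    exact Submodule.smul_mem _ c (hNF F hF hFD)

include EG in
/-- Involutivity for germs of sections. -/
theorem bracket_mem_imNijenhuis (hj : IsAlmostComplex j) (hinv : IsInvariantEnd G j)
    (hlie : ∀ F U : ∀ x : M, TangentSpace 𝓘(ℝ, E) x, IsSmoothField F →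
      (∀ y, F y ∈ imNijenhuis j y) → IsSmoothField U → ∀ x,
      bracket F (endApply j U) x - j x (bracket F U x) ∈ imNijenhuis j x)
    {F F' : ∀ x : M, TangentSpace 𝓘(ℝ, E) x} {x : M} (hF : FieldDiffAt F x)
    (hF' : FieldDiffAt F' x) (hFD : ∀ᶠ y in 𝓝 x, F y ∈ imNijenhuis j y)
    (hFD' : ∀ᶠ y in 𝓝 x, F' y ∈ imNijenhuis j y) : bracket F F' x ∈ imNijenhuis j x := by
  have := FiniteDimensional.complete ℝ E
  have hD := mfderiv_translation_mem_imNijenhuis (EG := EG) hj.smooth hinv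
  obtain ⟨N, hN, hND, hNx, -⟩ :=
    exists_section_bracket_mem hj hlie hFD.self_of_nhds
  obtain ⟨N', hN', hND', hNx', hNN⟩ :=
    exists_section_bracket_mem hj hlie hFD'.self_of_nhds
  have hNd := hN.fieldDiffAt x
  have hNd' := hN'.fieldDiffAt x
  -- The decomposition is [F, F'] = [F - N, F'] + [N, F' - N'] + [N, N']. In the first two terms one
  -- entry is a section vanishing at `x`; the third is covered by the choice of `N'`.
  have h1 := bracket_mem_of_apply_eq_zero (EG := EG) hj.smooth hD (hF.sub hNd) hF'
    (hFD.mono fun y hy => sub_mem hy (hND y)) (sub_eq_zero.2 hNx.symm)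
  have h2 := bracket_mem_of_apply_eq_zero (EG := EG) hj.smooth hD (hF'.sub hNd') hNd
    (hFD'.mono fun y hy => sub_mem hy (hND' y)) (sub_eq_zero.2 hNx'.symm)
  have h3 := hNN N hN hND
  rw [bracket_sub_left hF hNd] at h1
  rw [bracket_swap, bracket_sub_right hF' hNd'] at h2
  have h4 := add_mem (sub_mem h1 h2) h3
  convert! h4 using 1
  abel

end HomogeneousTransverse

/-! ### Flat charts on manifolds -/

section FoliationChart

variable {E : Type*} [NormedAddCommGroup E] [NormedSpace ℝ E]
  {M : Type*} [TopologicalSpace M] [ChartedSpace E M] [IsManifold 𝓘(ℝ, E) ∞ M]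

theorem IsSmoothField.contDiffOn_chartField {X : ∀ x : M, TangentSpace 𝓘(ℝ, E) x}
    (hX : IsSmoothField X) (x : M) :
    ContDiffOn ℝ ∞ (chartField x X) (extChartAt 𝓘(ℝ, E) x).target := by
  have h1 := ((trivializationAt E (TangentSpace 𝓘(ℝ, E)) x).contMDiffOn_section_baseSet_iff).1
    (ContMDiff.contMDiffOn hX)
  have h2 : ContMDiffOn 𝓘(ℝ, E) 𝓘(ℝ, E) ∞ (derivAlong (extChartAt 𝓘(ℝ, E) x) X)
      (extChartAt 𝓘(ℝ, E) x).source := by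
    rw [extChartAt_source]
    refine ContMDiffOn.congr h1 fun y hy => ?_
    have hb : y ∈ (trivializationAt E (TangentSpace 𝓘(ℝ, E)) x).baseSet := hy
    have e1 : derivAlong (extChartAt 𝓘(ℝ, E) x) X y =
        (trivializationAt E (TangentSpace 𝓘(ℝ, E)) x).continuousLinearMapAt ℝ y (X y) := by
      rw [TangentBundle.continuousLinearMapAt_trivializationAt hy]
      rfl
    rw [e1, Trivialization.continuousLinearMapAt_apply, Trivialization.linearMapAt_apply,
      if_pos hb]
  have h3 := (h2.comp (contMDiffOn_extChartAt_symm x)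
    (extChartAt 𝓘(ℝ, E) x).symm.mapsTo).contDiffOn
  exact h3.congr fun y hy => chartField_apply hy X

/-- A distribution of constant rank that is spanned by smooth sections and involutive on germs of
sections has flat charts. -/
theorem exists_flat_chart [FiniteDimensional ℝ E]
    {D : ∀ x : M, Submodule ℝ (TangentSpace 𝓘(ℝ, E) x)} (x : M)
    (hrank : ∀ y, Module.finrank ℝ (D y) = Module.finrank ℝ (D x))
    (hsec : ∀ (y : M), ∀ v ∈ D y, ∃ N : ∀ x : M, TangentSpace 𝓘(ℝ, E) x,
      IsSmoothField N ∧ (∀ y, N y ∈ D y) ∧ N y = v)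
    (hinv : ∀ (F F' : ∀ x : M, TangentSpace 𝓘(ℝ, E) x) (y : M), FieldDiffAt F y →
      FieldDiffAt F' y → (∀ᶠ z in 𝓝 y, F z ∈ D z) → (∀ᶠ z in 𝓝 y, F' z ∈ D z) →
      bracket F F' y ∈ D y) :
    ∃ F : Submodule ℝ E, ∃ φ ∈ IsManifold.maximalAtlas 𝓘(ℝ, E) ∞ M, x ∈ φ.source ∧
      ∀ y ∈ φ.source, ∀ v : TangentSpace 𝓘(ℝ, E) y,
        v ∈ D y ↔ (mfderiv 𝓘(ℝ, E) 𝓘(ℝ, E) φ y v : E) ∈ F := by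
  have := FiniteDimensional.complete ℝ E
  set φ := extChartAt 𝓘(ℝ, E) x with hφ
  have hφi : ∀ {q : M}, q ∈ φ.source → (mfderiv 𝓘(ℝ, E) 𝓘(ℝ, E) φ q).IsInvertible :=
    fun hq => isInvertible_mfderiv_extChartAt hq
  have hφs : ∀ {q : M}, q ∈ φ.source → ContMDiffAt 𝓘(ℝ, E) 𝓘(ℝ, E) ∞ φ q :=
    fun hq => contMDiffAt_extChartAt' (by rwa [hφ, extChartAt_source] at hq)
  have hsrc : IsOpen φ.source := isOpen_extChartAt_source x
  have htgt : IsOpen φ.target := isOpen_extChartAt_target x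
  let P : M → E →L[ℝ] E := fun q => (mfderiv 𝓘(ℝ, E) 𝓘(ℝ, E) φ q).inverse
  have hPl : ∀ {q : M}, q ∈ φ.source → ∀ v : TangentSpace 𝓘(ℝ, E) q,
      P q (mfderiv 𝓘(ℝ, E) 𝓘(ℝ, E) φ q v) = v :=
    fun hq v => (hφi hq).inverse_apply_self v
  have hPr : ∀ {q : M}, q ∈ φ.source → ∀ v : E,
      (mfderiv 𝓘(ℝ, E) 𝓘(ℝ, E) φ q (P q v) : E) = v :=
    fun hq v => (hφi hq).self_apply_inverse v
  let Q : M → Submodule ℝ E := fun q => Submodule.comap (P q : E →ₗ[ℝ] E) (D q)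
  have hQ : ∀ {q : M}, q ∈ φ.source → ∀ v : TangentSpace 𝓘(ℝ, E) q,
      (mfderiv 𝓘(ℝ, E) 𝓘(ℝ, E) φ q v : E) ∈ Q q ↔ v ∈ D q := by
    intro q hq v
    change P q (mfderiv 𝓘(ℝ, E) 𝓘(ℝ, E) φ q v) ∈ D q ↔ v ∈ D q
    rw [hPl hq]
    exact Iff.rfl
  have hQrank : ∀ {q : M}, q ∈ φ.source →
      Module.finrank ℝ (Q q) = Module.finrank ℝ (D x) := by
    intro q hq
    rw [← hrank q]
    have hbij : Function.Bijective (P q) :=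
      ⟨fun v w h => (hPr hq v).symm.trans ((congrArg _ h).trans (hPr hq w)),
        fun v => ⟨_, hPl hq v⟩⟩
    let e : E ≃ₗ[ℝ] E := LinearEquiv.ofBijective (P q : E →ₗ[ℝ] E) hbij
    let Dq : Submodule ℝ E := D q
    exact (LinearEquiv.ofSubmodule' e Dq).finrank_eq
  let D' : E → Submodule ℝ E := fun y => Q (φ.symm y)
  set a := φ x with ha
  have hat : a ∈ φ.target := mem_extChartAt_target x
  have hm : ∀ {y}, y ∈ φ.target → φ.symm y ∈ φ.source := fun hy => φ.map_target hy
  have hcf : ∀ {y}, y ∈ φ.target → ∀ X : ∀ x : M, TangentSpace 𝓘(ℝ, E) x,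
      X (φ.symm y) ∈ D (φ.symm y) → chartField x X y ∈ D' y := by
    intro y hy X hX
    rw [chartField_apply hy]
    exact (hQ (hm hy) _).2 hX
  let b := Module.finBasis ℝ (D' a)
  -- Global sections through a basis of the value at `a` provide the smooth frame required by the
  -- Frobenius theorem.
  have hN := fun i => hsec (φ.symm a) (P (φ.symm a) (b i)) (b i).2
  choose N hNs hND hNv using hN
  let S : E → D' a →L[ℝ] E := fun y => ∑ i,
    (LinearMap.toContinuousLinearMap (b.coord i)).smulRight (chartField x (N i) y)
  have hS : ContDiffOn ℝ ∞ S φ.target := by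
    exact ContDiffOn.sum fun i _ =>
      contDiffOn_const.smulRight ((hNs i).contDiffOn_chartField x)
  have hSa : ∀ u, S a u = u := by
    intro u
    have h1 : ∀ i, chartField x (N i) a = b i := by
      intro i
      rw [chartField_apply hat, derivAlong, hNv]
      exact hPr (hm hat) _
    simp only [S, _root_.sum_apply, ContinuousLinearMap.smulRight_apply, h1,
      LinearMap.coe_toContinuousLinearMap', Module.Basis.coord_apply]
    have h2 := congrArg Subtype.val (b.sum_repr u)
    rwa [Submodule.coe_sum] at h2
  have hSD : ∀ y ∈ φ.target, ∀ u, S y u ∈ D' y := by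
    intro y hy u
    simp only [S, _root_.sum_apply, ContinuousLinearMap.smulRight_apply]
    exact sum_mem fun i _ => Submodule.smul_mem _ _ (hcf hy _ (hND i _))
  have hinv' : ∀ y ∈ φ.target, ∀ X Y : E → E, ContDiffAt ℝ ∞ X y → ContDiffAt ℝ ∞ Y y →
      (∀ᶠ z in 𝓝 y, X z ∈ D' z) → (∀ᶠ z in 𝓝 y, Y z ∈ D' z) →
      VectorField.lieBracket ℝ X Y y ∈ D' y := by
    intro y hy X Y hX hY hXD hYD
    have hp := hm hy
    have hyp : φ (φ.symm y) = y := φ.right_inv hy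
    have hpd : D' y = Q (φ.symm y) := rfl
    -- The point of the manifold becomes the variable and `y` becomes `φ p`, so no transport along
    -- `φ (φ.symm y) = y` is needed.
    generalize φ.symm y = p at hp hyp hpd
    subst hyp
    have hXd : FieldDiffAt (M := E) X (φ p) :=
      (contMDiffAt_vectorSpace_iff_contDiffAt.2 hX).mdifferentiableAt (by simp)
    have hYd : FieldDiffAt (M := E) Y (φ p) :=
      (contMDiffAt_vectorSpace_iff_contDiffAt.2 hY).mdifferentiableAt (by simp)
    have hφ2 : ContMDiffAt 𝓘(ℝ, E) 𝓘(ℝ, E) 2 φ p := (hφs hp).of_le ENat.LEInfty.out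
    have : IsManifold 𝓘(ℝ, E) (minSmoothness ℝ 2) M :=
      IsManifold.of_le (n := ∞) (by simpa using ENat.LEInfty.out)
    -- Involutivity passes to the chart because pulling back by `φ` respects brackets; the
    -- pulled-back fields exist only near `p`, whence the hypothesis on germs.
    have h1 := VectorField.mpullback_mlieBracket (I := 𝓘(ℝ, E)) (I' := 𝓘(ℝ, E)) (M' := E) hXd hYd
      hφ2 (by simp)
    have hev : ∀ Z : E → E, (∀ᶠ z in 𝓝 (φ p), Z z ∈ D' z) →
        ∀ᶠ q in 𝓝 p, VectorField.mpullback 𝓘(ℝ, E) 𝓘(ℝ, E) φ Z q ∈ D q := by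
      intro Z hZ
      filter_upwards [(hφs hp).continuousAt.eventually hZ, hsrc.mem_nhds hp] with q hq hqs
      change _ ∈ Q (φ.symm (φ q)) at hq
      rw [φ.left_inv hqs] at hq
      exact hq
    have h2 := hinv _ _ p (hXd.mpullback_vectorField hφ2 (hφi hp) le_rfl)
      (hYd.mpullback_vectorField hφ2 (hφi hp) le_rfl) (hev X hXD) (hev Y hYD)
    rw [bracket, ← h1] at h2
    have h3 : (VectorField.mlieBracket 𝓘(ℝ, E) X Y (φ p) : E) =
        VectorField.lieBracket ℝ X Y (φ p) :=
      (congrFun VectorField.mlieBracketWithin_univ (φ p)).symm.trans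
        ((congrFun VectorField.mlieBracketWithin_eq_lieBracketWithin (φ p)).trans
          (congrFun VectorField.lieBracketWithin_univ (φ p)))
    rw [hpd, ← h3]
    exact h2
  obtain ⟨e, hae, heU, hes, hes', heD⟩ := exists_flattening_of_involutive (D := D') htgt hat
    (fun y hy => (hQrank (hm hy)).trans (hQrank (hm hat)).symm) hS hSa hSD hinv'
  let Φ : OpenPartialHomeomorph M E := (chartAt E x).trans e
  have hΦs : ∀ {y}, y ∈ Φ.source → y ∈ φ.source ∧ φ y ∈ e.source := by
    intro y hy
    rw [OpenPartialHomeomorph.trans_source] at hy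
    rw [hφ, extChartAt_source]
    exact hy
  refine ⟨D' a, Φ, ?_, ?_, ?_⟩
  · refine OpenPartialHomeomorph.mem_maximalAtlas_of_contMDiffOn _ ?_ ?_
    · exact hes.contMDiffOn.comp (contMDiffOn_chart.mono fun y hy => hy.1) fun y hy => hy.2
    · exact contMDiffOn_chart_symm.comp (hes'.contMDiffOn.mono fun y hy => hy.1) fun y hy => hy.2
  · rw [OpenPartialHomeomorph.trans_source]
    exact ⟨mem_chart_source E x, hae⟩
  · intro y hy v
    obtain ⟨hy1, hy2⟩ := hΦs hy
    have h1 : HasFDerivAt e (fderiv ℝ e (φ y)) (φ y) :=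
      ((hes.contDiffAt (e.open_source.mem_nhds hy2)).differentiableAt (by simp)).hasFDerivAt
    have h2 : mfderiv 𝓘(ℝ, E) 𝓘(ℝ, E) Φ y = (fderiv ℝ e (φ y)).comp
        (mfderiv 𝓘(ℝ, E) 𝓘(ℝ, E) φ y) :=
      (HasMFDerivAt.comp y h1.hasMFDerivAt
        ((hφs hy1).mdifferentiableAt (by simp)).hasMFDerivAt).mfderiv
    rw [h2]
    refine Iff.trans ?_ (heD _ hy2 _)
    rw [← hQ hy1]
    change _ ↔ _ ∈ Q (φ.symm (φ y))
    rw [φ.left_inv hy1]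
    exact Iff.rfl

end FoliationChart

/-! ### Invariant involutive distributions define foliations -/

section HomogeneousFoliation

variable {EG : Type*} [NormedAddCommGroup EG] [NormedSpace ℝ EG] [FiniteDimensional ℝ EG]
  {G : Type*} [TopologicalSpace G] [ChartedSpace EG G] [Group G]
  [LieGroup 𝓘(ℝ, EG) ∞ G] [SecondCountableTopology G]
  {E : Type*} [NormedAddCommGroup E] [NormedSpace ℝ E] [FiniteDimensional ℝ E]
  {M : Type*} [TopologicalSpace M] [ChartedSpace E M]
  [IsManifold 𝓘(ℝ, E) ∞ M] [T2Space M]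
  [MulAction G M] [ContMDiffSMul 𝓘(ℝ, EG) 𝓘(ℝ, E) ∞ G M] [MulAction.IsPretransitive G M]

include EG G in
/-- An invariant distribution on a homogeneous space that is spanned by smooth sections and
involutive on germs of sections defines a foliation. -/
theorem definesFoliation_of_invariant {D : ∀ x : M, Submodule ℝ (TangentSpace 𝓘(ℝ, E) x)}
    (hD : ∀ (g : G) (x : M), ∀ v ∈ D x,
      mfderiv 𝓘(ℝ, E) 𝓘(ℝ, E) (fun y : M => g • y) x v ∈ D (g • x))
    (hsec : ∀ (y : M), ∀ v ∈ D y, ∃ N : ∀ x : M, TangentSpace 𝓘(ℝ, E) x,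
      IsSmoothField N ∧ (∀ y, N y ∈ D y) ∧ N y = v)
    (hinv : ∀ (F F' : ∀ x : M, TangentSpace 𝓘(ℝ, E) x) (y : M), FieldDiffAt F y →
      FieldDiffAt F' y → (∀ᶠ z in 𝓝 y, F z ∈ D z) → (∀ᶠ z in 𝓝 y, F' z ∈ D z) →
      bracket F F' y ∈ D y) : DefinesFoliation D := by
  rcases isEmpty_or_nonempty M with hM | ⟨⟨x₀⟩⟩
  · exact ⟨⊥, fun x => (hM.false x).elim⟩
  have hDi : ∀ (g : G) (x : M) (v : TangentSpace 𝓘(ℝ, E) x),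
      v ∈ D x ↔ mfderiv 𝓘(ℝ, E) 𝓘(ℝ, E) (fun y : M => g • y) x v ∈ D (g • x) :=
    fun g x v => ⟨hD g x v, mem_of_mfderiv_translation_mem (EG := EG) hD⟩
  -- Translations are invertible on tangent spaces and preserve the distribution, so by transitivity
  -- its rank is constant.
  have hle : ∀ x y : M, Module.finrank ℝ (D y) ≤ Module.finrank ℝ (D x) := by
    intro x y
    obtain ⟨g, rfl⟩ := MulAction.exists_smul_eq G y x
    let T : E →L[ℝ] E := mfderiv 𝓘(ℝ, E) 𝓘(ℝ, E) (fun z : M => g • z) y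
    let p : Submodule ℝ E := D y
    let q : Submodule ℝ E := D (g • y)
    have hT : ∀ v ∈ p, T v ∈ q := hD g y
    have hTi : Function.Injective T := by
      refine fun v w h => ?_
      have h2 := fun v => (mfderiv_translation_mul (E := E) EG g⁻¹ g y v).trans
        (mfderiv_translation_one (E := E) (inv_mul_cancel g) y v)
      exact (h2 v).symm.trans ((congrArg _ h).trans (h2 w))
    have h3 := LinearMap.finrank_le_finrank_of_injective
      (f := (T : E →ₗ[ℝ] E).restrict (p := p) (q := q) hT)
      fun v w h => Subtype.ext (hTi (congrArg Subtype.val h))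
    exact h3
  obtain ⟨F, φ, hφ, hx₀, hφF⟩ := exists_flat_chart x₀ (fun y => (hle _ _).antisymm (hle _ _))
    hsec hinv
  refine ⟨F, fun x => ?_⟩
  obtain ⟨g, hg⟩ := MulAction.exists_smul_eq G x x₀
  have hs := contMDiff_translation EG (G := G) E M
  let τ : M ≃ₜ M :=
    { MulAction.toPerm g with
      continuous_toFun := (hs g).continuous
      continuous_invFun := (hs g⁻¹).continuous }
  have hφs := contMDiffOn_of_mem_maximalAtlas hφ
  -- The one chart at `x₀`, composed with a translation, serves at every point. By invariance the
  -- model subspace stays `F`, which must not depend on the point.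
  refine ⟨τ.toOpenPartialHomeomorph.trans φ, ?_, ?_, ?_⟩
  · refine OpenPartialHomeomorph.mem_maximalAtlas_of_contMDiffOn _ ?_ ?_
    · exact hφs.comp (hs g).contMDiffOn fun y hy => hy.2
    · exact ((hs g⁻¹).contMDiffOn (s := univ)).comp
        ((contMDiffOn_symm_of_mem_maximalAtlas hφ).mono fun y hy => hy.1) fun y hy => mem_univ _
  · refine ⟨mem_univ x, ?_⟩
    change g • x ∈ φ.source
    rwa [hg]
  · rintro y ⟨-, hy⟩ v
    change g • y ∈ φ.source at hy
    have h2 : mfderiv 𝓘(ℝ, E) 𝓘(ℝ, E) (τ.toOpenPartialHomeomorph.trans φ) y =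
        (mfderiv 𝓘(ℝ, E) 𝓘(ℝ, E) φ (g • y)).comp
          (mfderiv 𝓘(ℝ, E) 𝓘(ℝ, E) (fun z : M => g • z) y) :=
      (HasMFDerivAt.comp y
        ((hφs.contMDiffAt (φ.open_source.mem_nhds hy)).mdifferentiableAt (by simp)).hasMFDerivAt
        ((hs g y).mdifferentiableAt (by simp)).hasMFDerivAt).mfderiv
    rw [h2, hDi g]
    exact hφF _ hy _

end HomogeneousFoliation

end TransverseComplex

/-! ### The main theorem -/

open TransverseComplex

theorem mainTheorem8
    {EG : Type*} [NormedAddCommGroup EG] [NormedSpace ℝ EG] [FiniteDimensional ℝ EG]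
    {G : Type*} [TopologicalSpace G] [ChartedSpace EG G] [Group G]
    [LieGroup 𝓘(ℝ, EG) ∞ G] [T2Space G] [SecondCountableTopology G]
    {E : Type*} [NormedAddCommGroup E] [NormedSpace ℝ E] [FiniteDimensional ℝ E]
    {M : Type*} [TopologicalSpace M] [ChartedSpace E M]
    [IsManifold 𝓘(ℝ, E) ∞ M] [T2Space M]
    [MulAction G M] [ContMDiffSMul 𝓘(ℝ, EG) 𝓘(ℝ, E) ∞ G M] [MulAction.IsPretransitive G M]
    (j : ∀ x : M, TangentSpace 𝓘(ℝ, E) x →L[ℝ] TangentSpace 𝓘(ℝ, E) x)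
    (hj : TransverseComplex.IsAlmostComplex j)
    (hinv : TransverseComplex.IsInvariantEnd G j)
    (x₀ : M)
    (J : GroupLieAlgebra 𝓘(ℝ, EG) G →ₗ[ℝ] GroupLieAlgebra 𝓘(ℝ, EG) G)
    (hJ : ∀ A : GroupLieAlgebra 𝓘(ℝ, EG) G,
      j x₀ (TransverseComplex.fundamentalField (E := E) M A x₀) =
        TransverseComplex.fundamentalField (E := E) M (J A) x₀) :
    (TransverseComplex.IsInvolutive
        (TransverseComplex.smoothSections (TransverseComplex.imNijenhuis j)) ∧
      TransverseComplex.DefinesFoliation (TransverseComplex.imNijenhuis j) ∧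
      TransverseComplex.IsTransverseComplex
        (TransverseComplex.smoothSections (TransverseComplex.imNijenhuis j)) j) ↔
    ∀ A B C : GroupLieAlgebra 𝓘(ℝ, EG) G,
      ⁅J A, TransverseComplex.lieNijenhuis J B C⁆ - J ⁅A, TransverseComplex.lieNijenhuis J B C⁆ ∈
        (TransverseComplex.imLieNijenhuis J : Set (GroupLieAlgebra 𝓘(ℝ, EG) G)) +
          TransverseComplex.subgroupLieAlgebra (MulAction.stabilizer G x₀) := by
  have := FiniteDimensional.complete ℝ E
  constructor
  · rintro ⟨-, -, h⟩ A B C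
    have hs := fun A : GroupLieAlgebra 𝓘(ℝ, EG) G =>
      isSmoothField_fundamentalField (E := E) (M := M) A
    -- The minus sign makes the value at `x₀` the fundamental vector of N^J(B, C), since N^j(B*, C*)
    -- = -N^J(B, C)* there.
    have hF : IsSmoothField (-nijenhuis j (fundamentalField (E := E) M B)
        (fundamentalField (E := E) M C)) := ((hs B).nijenhuis (hs C) hj.smooth).neg
    have hFD : ∀ y, (-nijenhuis j (fundamentalField (E := E) M B)
        (fundamentalField (E := E) M C)) y ∈ imNijenhuis j y :=
      fun y => neg_mem (nijenhuis_mem_imNijenhuis (hs B) (hs C) y)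
    have h1 := bracket_endApply_fundamentalField_sub_mem hj hinv hJ A (lieNijenhuis J B C)
      (hF.fieldDiffAt x₀) (Filter.Eventually.of_forall hFD)
      ((congrArg Neg.neg (nijenhuis_fundamentalField hj hinv hJ B C)).trans (neg_neg _))
    have h2 := (h.lie_mem _ ⟨hF, hFD⟩ _ (hs A)).2 x₀
    exact (fundamentalField_mem_imNijenhuis_iff hj hinv hJ _).1
      ((Submodule.sub_mem_iff_right _ h2).1 h1)
  · intro hlie
    -- Condition (2) gives the Lie derivative condition at every point; involutivity, the foliation
    -- and the remaining clauses are derived from it.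
    have hlie' : ∀ F U : ∀ x : M, TangentSpace 𝓘(ℝ, E) x, IsSmoothField F →
        (∀ y, F y ∈ imNijenhuis j y) → IsSmoothField U → ∀ x,
        bracket F (endApply j U) x - j x (bracket F U x) ∈ imNijenhuis j x :=
      fun F U hF hFD hU x => bracket_endApply_sub_mem hj hinv hJ hlie (hF.fieldDiffAt x)
        (Filter.Eventually.of_forall hFD) (hU.fieldDiffAt x)
    have hbr : ∀ (F F' : ∀ x : M, TangentSpace 𝓘(ℝ, E) x) (y : M), FieldDiffAt F y →
        FieldDiffAt F' y → (∀ᶠ z in nhds y, F z ∈ imNijenhuis j z) →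
        (∀ᶠ z in nhds y, F' z ∈ imNijenhuis j z) → bracket F F' y ∈ imNijenhuis j y :=
      fun F F' y => bracket_mem_imNijenhuis (EG := EG) (G := G) hj hinv hlie'
    refine ⟨?_, ?_, ⟨⟨hj.smooth, ?_, ?_, ?_⟩, ?_⟩⟩
    · rintro X ⟨hX, hXD⟩ Y ⟨hY, hYD⟩
      exact ⟨hX.bracket hY, fun x => hbr X Y x (hX.fieldDiffAt x) (hY.fieldDiffAt x)
        (Filter.Eventually.of_forall hXD) (Filter.Eventually.of_forall hYD)⟩
    · refine definesFoliation_of_invariant (EG := EG)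
        (mfderiv_translation_mem_imNijenhuis (EG := EG) hj.smooth hinv) (fun y v hv => ?_) hbr
      obtain ⟨N, hN, hND, hNv, -⟩ := exists_section_bracket_mem hj hlie' hv
      exact ⟨N, hN, hND, hNv⟩
    · rintro F ⟨hF, hFD⟩
      exact ⟨hF.endApply hj.smooth, fun x => hj.apply_mem_imNijenhuis (hFD x)⟩
    · intro U hU
      rw [hj.endApply_endApply, neg_add_cancel]
      exact ⟨isSmoothField_zero, fun x => zero_mem _⟩
    · rintro F ⟨hF, hFD⟩ U hU
      exact ⟨(hF.bracket (hU.endApply hj.smooth)).sub ((hF.bracket hU).endApply hj.smooth),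
        hlie' F U hF hFD hU⟩
    · intro U V hU hV
      exact ⟨hU.nijenhuis hV hj.smooth, nijenhuis_mem_imNijenhuis hU hV⟩
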